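/- Let $N\ge 2$, $m>0$, $\mu>0$, and write $\hat\xi(p)=(2\pi)^{-3(N-1)/2}\int e^{-ip\cdot x}\xi(x)\,dx$. The subscript "as" denotes functions on $\mathbb{R}^{3(N-1)}=(\mathbb{R}^3)^{N-1}$ antisymmetric under permutations of the $N-1$ variables in $\mathbb{R}^3$. Put $$G(q_1,\dots,q_N)=\Big(\sum_{i=1}^N q_i^2+\tfrac{2}{m+1}\sum_{i<j}q_i\cdot q_j+\mu\Big)^{-1},$$ $$L(q_1,\dots,q_{N-1})=2\pi^2\Big(\tfrac{m(m+2)}{(m+1)^2}\sum_{i=1}^{N-1}q_i^2+\tfrac{2m}{(m+1)^2}\sum_{i<j}q_i\cdot q_j+\mu\Big)^{1/2},$$ and let $L$ also denote the operator of multiplication by this function in momentum space, acting in $L^2_{\rm as}(\mathbb{R}^{3(N-1)})$ with its maximal domain $D(L)$. On $H^{1/2}_{\rm as}(\mathbb{R}^{3(N-1)})$ consider the quadratic form $T_{\rm diag}+T_{\rm off}$, $$T_{\rm diag}(\xi)=\int|\hat\xi(s,\vec q)|^2L(s,\vec q)\,ds\,d\vec q,\qquad T_{\rm off}(\xi)=(N-1)\int\overline{\hat\xi(s,\vec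 q)}\,\hat\xi(t,\vec q)\,G(s,t,\vec q)\,ds\,dt\,d\vec q,$$ with $s,t\in\mathbb{R}^3$, $\vec q\in\mathbb{R}^{3(N-2)}$, and let $t(\zeta,\xi)$ be the corresponding sesquilinear form. Let $\Gamma$ be the operator in $L^2_{\rm as}$ associated with it: $\xi\in D(\Gamma)$ and $\Gamma\xi=\eta$ iff $\xi\in H^{1/2}_{\rm as}$, $\eta\in L^2_{\rm as}$ and $\langle\zeta|\eta\rangle=t(\zeta,\xi)$ for all $\zeta\in H^{1/2}_{\rm as}$. For general $\xi\in H^{1/2}_{\rm as}$, $\Gamma\xi\in H^{-1/2}_{\rm as}$ is defined by the same identity. For $\beta\ge 0$ let, with $A=(2+m)^{-1}$ and $\ell_m(s,K,Q)=\big(\tfrac{m}{(m+1)^2}(s+K)^2+\tfrac{m}{m+1}(s^2+Q^2)\big)^{1/2}$, $$\Lambda_\beta(m)=\sup_{s,K\in\mathbb{R}^3,\,Q>0}\frac{s^2+Q^2}{\pi^2(1+m)}\int_{\mathbb{R}^3}\frac1{t^2}\left(\frac{\ell_m(s,K,Q)^{(\beta-1)/2}}{\ell_m(t,K,Q)^{(\beta+1)/2}}+\frac{\ell_m(t,K,Q)^{(\beta-1)/2}}{\ell_m(s,K,Q)^{(\beta+1)/2}}\right)\frac{|(s+AK)\cdot(t+AK)|\;dt}{\big[(s+AK)^2+(t+AK)^2+\frac{m}{1+m}(Q^2+AK^2)\big]^2-\big[\frac{2}{1+m}(s+AK)\cdot(t+AK)\big]^2}.$$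 Then: (i) Every $\xi\in H^1_{\rm as}(\mathbb{R}^{3(N-1)})$ lies in $D(\Gamma)$, $\Gamma\xi$ is uniquely determined, and $$\|\Gamma\xi\|^2_{L^2}\ge(1-\Lambda_1(m))\,\|L\xi\|^2_{L^2}.$$ (ii) If $\Lambda_1(m)<1$, then $D(\Gamma)=D(L)=H^1_{\rm as}(\mathbb{R}^{3(N-1)})$. (iii) For $0\le\beta\le2$, $\Lambda_\beta(m)$ is finite, and for every $\xi\in H^{(\beta+1)/2}_{\rm as}(\mathbb{R}^{3(N-1)})$ the element $\Gamma\xi\in H^{-1/2}_{\rm as}$ exists and $$\|L^{(\beta-1)/2}\Gamma\xi\|^2_{L^2}\ge(1-\Lambda_\beta(m))\,\|L^{(\beta+1)/2}\xi\|^2_{L^2},$$ where the left side may a priori be $+\infty$. -/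

import Mathlib

open MeasureTheory FourierTransform
open scoped ENNReal SchwartzMap ComplexConjugate

noncomputable section

namespace PointInteraction

/-- One-particle space `ℝ³`. -/
abbrev E3 : Type := EuclideanSpace ℝ (Fin 3)

/-- `ℝ^{3k}` as the Euclidean space of `k`-tuples of vectors in `ℝ³`. -/
abbrev Config (k : ℕ) : Type := PiLp 2 (fun _ : Fin k => E3)

/-- `L²(ℝ^{3k})`, complex valued. -/
abbrev L2 (k : ℕ) : Type := Lp (α := Config k) ℂ 2 (volume : Measure (Config k))

/-- Unitary Fourier transform `ξ̂(p) = (2π)^{-3k/2} ∫ e^{-i p·x} ξ(x) dx`, obtained by rescaling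
Mathlib's `L²` Fourier transform (which uses the phase `e^{-2πi p·x}`). -/
def hat {k : ℕ} (ξ : L2 k) (p : Config k) : ℂ :=
  (((2 * Real.pi) ^ (-(3 * (k : ℝ)) / 2) : ℝ) : ℂ) * (𝓕 ξ : L2 k) ((2 * Real.pi)⁻¹ • p)

/-- The tuple `(x_{σ 1}, …, x_{σ k})`. -/
def permute {k : ℕ} (σ : Equiv.Perm (Fin k)) (x : Config k) : Config k :=
  WithLp.toLp 2 (fun i => x (σ i))

/-- Antisymmetry (almost everywhere) under permutations of the `k` vector variables. -/
def Antisymm {k : ℕ} (f : Config k → ℂ) : Prop :=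
  ∀ σ : Equiv.Perm (Fin k),
    (fun x => f (permute σ x)) =ᵐ[volume] fun x => ((Equiv.Perm.sign σ : ℤ) : ℂ) * f x

/-- `L²_as(ℝ^{3k})`. -/
def L2as (k : ℕ) : Set (L2 k) := {ξ | Antisymm (ξ : Config k → ℂ)}

/-- `H^r_as(ℝ^{3k})` for `r ≥ 0`, as a subset of `L²(ℝ^{3k})`. -/
def Has (k : ℕ) (r : ℝ) : Set (L2 k) :=
  {ξ | ξ ∈ L2as k ∧ TemperedDistribution.MemSobolev r 2 (ξ : 𝓢'(Config k, ℂ))}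

/-- `G(q₁, …, q_k) = (∑ q_i² + 2/(m+1) ∑_{i<j} q_i·q_j + μ)⁻¹`. -/
def G {k : ℕ} (m μ : ℝ) (q : Fin k → E3) : ℝ :=
  (∑ i, ‖q i‖ ^ 2 + 2 / (m + 1) * ∑ i, ∑ j ∈ Finset.Ioi i, inner ℝ (q i) (q j) + μ)⁻¹

/-- The symbol
`L(q₁, …, q_k) = 2π² (m(m+2)/(m+1)² ∑ q_i² + 2m/(m+1)² ∑_{i<j} q_i·q_j + μ)^{1/2}`. -/
def L {k : ℕ} (m μ : ℝ) (q : Config k) : ℝ :=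
  2 * Real.pi ^ 2 * Real.sqrt (m * (m + 2) / (m + 1) ^ 2 * ∑ i, ‖q i‖ ^ 2
    + 2 * m / (m + 1) ^ 2 * ∑ i, ∑ j ∈ Finset.Ioi i, inner ℝ (q i) (q j) + μ)

/-- For a function `g` of momentum, `∫ |L^r g|² ∈ [0, ∞]`; with `g = û` this is `‖L^r u‖²`. -/
def LpowNormSq {k : ℕ} (m μ r : ℝ) (g : Config k → ℂ) : ℝ≥0∞ :=
  ∫⁻ p, ‖((L m μ p ^ r : ℝ) : ℂ) * g p‖ₑ ^ 2

/-- The domain of the multiplication operator `L` in `L²_as`. -/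
def domL (k : ℕ) (m μ : ℝ) : Set (L2 k) :=
  {ξ | ξ ∈ L2as k ∧ LpowNormSq m μ 1 (hat ξ) < ⊤}

/-- The vector `(s, q₁, …, q_n)`. -/
def cons {n : ℕ} (s : E3) (q : Fin n → E3) : Config (n + 1) :=
  WithLp.toLp 2 (Fin.cons s q : Fin (n + 1) → E3)

/-- Sesquilinear version of the diagonal form; `Tdiag m μ ξ ξ` is the quadratic form. -/
def Tdiag {k : ℕ} (m μ : ℝ) (ζ ξ : L2 k) : ℂ :=
  ∫ p, conj (hat ζ p) * hat ξ p * (L m μ p : ℂ)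

/-- Sesquilinear version of the off-diagonal form for `N = n + 2`, so that `N - 1 = n + 1`
and `q` runs over `ℝ^{3(N-2)}`; `Toff m μ ξ ξ` is the quadratic form. -/
def Toff {n : ℕ} (m μ : ℝ) (ζ ξ : L2 (n + 1)) : ℂ :=
  ((n : ℂ) + 1) * ∫ x : E3 × E3 × (Fin n → E3),
    conj (hat ζ (cons x.1 x.2.2)) * hat ξ (cons x.2.1 x.2.2)
      * (G m μ (Fin.cons x.1 (Fin.cons x.2.1 x.2.2 : Fin (n + 1) → E3) : Fin (n + 2) → E3) : ℂ)

/-- The relation `Γ ξ = η`, where `Γ` is the operator in `L²_as` associated with the form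
`Tdiag + Toff` on the form domain `H^{1/2}_as`. -/
def IsGamma {n : ℕ} (m μ : ℝ) (ξ η : L2 (n + 1)) : Prop :=
  ξ ∈ Has (n + 1) (1 / 2) ∧ η ∈ L2as (n + 1) ∧
    ∀ ζ ∈ Has (n + 1) (1 / 2), inner ℂ ζ η = Tdiag m μ ζ ξ + Toff m μ ζ ξ

/-- The operator domain `D(Γ)`. -/
def domGamma (n : ℕ) (m μ : ℝ) : Set (L2 (n + 1)) := {ξ | ∃ η, IsGamma m μ ξ η}

/-- `g` is the Fourier transform of `Γ ξ`, where `Γ` is understood as the operator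
`H^{1/2}_as → H^{-1/2}_as` given by the form (it extends the operator of `IsGamma`). -/
structure IsGammaHat {n : ℕ} (m μ : ℝ) (ξ : L2 (n + 1)) (g : Config (n + 1) → ℂ) : Prop where
  mem_form_domain : ξ ∈ Has (n + 1) (1 / 2)
  aestronglyMeasurable : AEStronglyMeasurable g volume
  antisymm : Antisymm g
  finite_norm : LpowNormSq m μ (-1 / 2) g < ⊤
  form_eq : ∀ ζ ∈ Has (n + 1) (1 / 2),
    ∫ p, conj (hat ζ p) * g p = Tdiag m μ ζ ξ + Toff m μ ζ ξ

/-- `ℓ_m(s, K, Q)`. -/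
def ell (m : ℝ) (s K : E3) (Q : ℝ) : ℝ :=
  Real.sqrt (m / (m + 1) ^ 2 * ‖s + K‖ ^ 2 + m / (m + 1) * (‖s‖ ^ 2 + Q ^ 2))

/-- The integrand (including the factor `1 / t²`) in the definition of `Λ_β(m)`, with
`A = 1 / (2 + m)`. -/
def LambdaIntegrand (β m : ℝ) (s K : E3) (Q : ℝ) (t : E3) : ℝ :=
  let A : ℝ := (2 + m)⁻¹
  1 / ‖t‖ ^ 2
    * (ell m s K Q ^ ((β - 1) / 2) / ell m t K Q ^ ((β + 1) / 2)
      + ell m t K Q ^ ((β - 1) / 2) / ell m s K Q ^ ((β + 1) / 2))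
    * (|inner ℝ (s + A • K) (t + A • K)|
      / ((‖s + A • K‖ ^ 2 + ‖t + A • K‖ ^ 2 + m / (1 + m) * (Q ^ 2 + A * ‖K‖ ^ 2)) ^ 2
        - (2 / (1 + m) * inner ℝ (s + A • K) (t + A • K)) ^ 2))

/-- `Λ_β(m)`, as a supremum in `[0, ∞]`. -/
def Lambda (β m : ℝ) : ℝ≥0∞ :=
  ⨆ (s : E3) (K : E3) (Q : ℝ) (_ : 0 < Q),
    ENNReal.ofReal ((‖s‖ ^ 2 + Q ^ 2) / (Real.pi ^ 2 * (1 + m)))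
      * ∫⁻ t, ENNReal.ofReal (LambdaIntegrand β m s K Q t)

end PointInteraction

end

open PointInteraction

/-! The form is tested with `f(L)ξ` instead of `ξ`, where `f = reg β ε` is a bounded version of `x ^
β`; boundedness keeps `f(L)ξ` in the form domain even when `ξ` is only in `H^{1/2}`. The diagonal
part then gives exactly `F = ∫ f(L) L |ξ̂|²` (`regEnergy`). The point is that the off-diagonal part
has real part at least `-ΛF/2`.

With `K = ∑ q_i` and a suitable `Q`, completing squares writes `G = 1/(X + B)`, where `B` is odd and
`X` is even under reflection of `s + AK`. Hence `G = X/(X² - B²) - B/(X² - B²)`. Symmetrising in `s`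
and `t` replaces `f(L(s,q))` by half of `f(L(s,q)) + f(L(t,q))`.

The even part is nonnegative because its kernel, for fixed `q`, is positive semidefinite
(`PSD_reg_evenPart`). It is a product of the geometric series `X²/(X² - B²) = ∑ (B/X)^{2j}` and of
`(f + f)/X`, which is handled through the kernels `(u^θ + v^θ)/(u + v)` with `0 ≤ θ = β/2 ≤ 1`; this
is where `β ≤ 2` enters. The odd part is bounded by a Schur test with weight `s²/t²`
(`lintegral_oddKernel_le`). The row integral produces `Λ_β` times `s²/(s² + Q²)`, and the factor `N
- 1` is absorbed because `|ξ̂|²` is permutation symmetric and the fractions `q_i²/∑ q_j²` add up to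
at most one.

Writing `c = 1 - Λ/2` and letting `g` be the Fourier transform of `Γξ`, this gives `cF ≤ |⟨f(L)ξ,
Γξ⟩|`. Cauchy-Schwarz bounds the right side by `F` and `∫ |L^{(β-1)/2} g|²`, so `c²F` is at most the
latter, and `c² ≥ 1 - Λ`. Fatou's lemma removes `ε` (`IsGammaHat.lower_bound`). Since only `ξ ∈
H^{1/2}` is assumed there, the case `β = 1` is also a regularity statement and identifies the
domain. Existence of `Γξ` follows from a second Schur test and the Riesz representation theorem
(`exists_integral_eq_fullForm`). -/

namespace PointInteraction

/-! ### Positive semidefinite kernels and their integrals. -/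

/-- A symmetric positive semidefinite kernel. -/
structure PSD {X : Type*} (K : X → X → ℝ) : Prop where
  symm : ∀ x y, K x y = K y x
  nonneg : ∀ (N : ℕ) (x : Fin N → X) (c : Fin N → ℝ), 0 ≤ ∑ i, ∑ j, c i * K (x i) (x j) * c j

namespace PSD

variable {X Y : Type*} {K K' : X → X → ℝ}

theorem add (h : PSD K) (h' : PSD K') : PSD fun x y => K x y + K' x y where
  symm x y := by rw [h.symm, h'.symm]
  nonneg N x c := by
    have := add_nonneg (h.nonneg N x c) (h'.nonneg N x c)
    simpa [mul_add, add_mul, Finset.sum_add_distrib] using this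

theorem const_mul {a : ℝ} (ha : 0 ≤ a) (h : PSD K) : PSD fun x y => a * K x y where
  symm x y := by rw [h.symm]
  nonneg N x c := by
    have := mul_nonneg ha (h.nonneg N x c)
    simp only [Finset.mul_sum] at this
    refine this.trans_eq (Finset.sum_congr rfl fun i _ => Finset.sum_congr rfl fun j _ => ?_)
    ring

/-- This is the Schur product theorem, applied to the matrices of the two kernels on finitely many
points. -/
theorem mul (h : PSD K) (h' : PSD K') : PSD fun x y => K x y * K' x y where
  symm x y := by rw [h.symm, h'.symm]
  nonneg N x c := by
    have key : ∀ {K : X → X → ℝ}, PSD K →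
        (Matrix.of fun i j => K (x i) (x j)).PosSemidef := by
      intro K hK
      rw [Matrix.posSemidef_iff_dotProduct_mulVec]
      refine ⟨?_, fun y => ?_⟩
      · ext i j
        simpa using hK.symm _ _
      · have := hK.nonneg N x y
        simpa [dotProduct, Matrix.mulVec, Finset.mul_sum, mul_assoc] using this
    have := ((key h).hadamard (key h')).dotProduct_mulVec_nonneg c
    simpa [dotProduct, Matrix.mulVec, Finset.mul_sum, mul_assoc] using this

theorem inner {E : Type*} [NormedAddCommGroup E] [InnerProductSpace ℝ E] (f : X → E) :
    PSD fun x y => inner ℝ (f x) (f y) where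
  symm x y := real_inner_comm _ _
  nonneg N x c := by
    have h : ∑ i, ∑ j, c i * Inner.inner ℝ (f (x i)) (f (x j)) * c j
        = Inner.inner ℝ (∑ i, c i • f (x i)) (∑ i, c i • f (x i)) := by
      simp only [sum_inner, inner_sum, real_inner_smul_left, real_inner_smul_right]
      refine Finset.sum_congr rfl fun i _ => Finset.sum_congr rfl fun j _ => ?_
      rw [real_inner_comm]; ring
    rw [h]
    exact real_inner_self_nonneg

theorem rankOne (f : X → ℝ) : PSD fun x y => f x * f y := by
  have := inner f
  simp only [RCLike.inner_apply, conj_trivial] at this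
  refine ⟨fun x y => mul_comm _ _, fun N x c => ?_⟩
  simpa [mul_comm] using this.nonneg N x c

theorem const {a : ℝ} (ha : 0 ≤ a) : PSD fun _ _ : X => a := by
  simpa using (rankOne fun _ : X => (1 : ℝ)).const_mul ha

theorem pow (h : PSD K) (n : ℕ) : PSD fun x y => K x y ^ n := by
  induction n with
  | zero => simpa using const (X := X) zero_le_one
  | succ n ih => simpa [pow_succ] using ih.mul h

theorem of_hasSum {k : ℕ → X → X → ℝ} (hk : ∀ n, PSD (k n))
    (h : ∀ x y, HasSum (fun n => k n x y) (K x y)) : PSD K where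
  symm x y := (h x y).unique (by simpa only [(hk _).symm x y] using h y x)
  nonneg N x c := by
    have : HasSum (fun n => ∑ i, ∑ j, c i * k n (x i) (x j) * c j)
        (∑ i, ∑ j, c i * K (x i) (x j) * c j) :=
      hasSum_sum fun i _ => hasSum_sum fun j _ => ((h _ _).mul_left _).mul_right _
    exact this.nonneg fun n => (hk n).nonneg N x c

theorem integral {T : Type*} [MeasurableSpace T] {ν : Measure T} {k : T → X → X → ℝ}
    (hk : ∀ᵐ t ∂ν, PSD (k t)) (hi : ∀ x y, Integrable (fun t => k t x y) ν) :
    PSD fun x y => ∫ t, k t x y ∂ν where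
  symm x y := integral_congr_ae (hk.mono fun t h => h.symm x y)
  nonneg N x c := by
    have : ∑ i, ∑ j, c i * (∫ t, k t (x i) (x j) ∂ν) * c j
        = ∫ t, ∑ i, ∑ j, c i * k t (x i) (x j) * c j ∂ν := by
      rw [integral_finsetSum _ fun i _ => integrable_finsetSum _ fun j _ =>
        ((hi _ _).const_mul _).mul_const _]
      refine Finset.sum_congr rfl fun i _ => ?_
      rw [integral_finsetSum _ fun j _ => ((hi _ _).const_mul _).mul_const _]
      refine Finset.sum_congr rfl fun j _ => ?_
      rw [integral_mul_const, integral_const_mul]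
    rw [this]
    exact integral_nonneg_of_ae (hk.mono fun t h => h.nonneg N x c)

/-- The Cauchy kernel is a Laplace integral, hence a superposition of the rank one kernels `exp(-r u
x) exp(-r u y)`. -/
theorem inv_add {u : X → ℝ} (hu : ∀ x, 0 < u x) : PSD fun x y => (u x + u y)⁻¹ := by
  have h : ∀ x y, (u x + u y)⁻¹
      = ∫ r in Set.Ioi (0 : ℝ), Real.exp (-(u x) * r) * Real.exp (-(u y) * r) := by
    intro x y
    have : -(u x + u y) < 0 := by linarith [hu x, hu y]
    simp_rw [← Real.exp_add, ← add_mul]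
    rw [show -u x + -u y = -(u x + u y) by ring, integral_exp_mul_Ioi this, mul_zero, Real.exp_zero,
      neg_div_neg_eq, one_div]
  simp_rw [h]
  refine integral (Filter.Eventually.of_forall fun r =>
    rankOne fun x => Real.exp (-(u x) * r)) fun x y => ?_
  simp_rw [← Real.exp_add, ← add_mul]
  exact integrableOn_exp_mul_Ioi (by linarith [hu x, hu y]) 0

/-- For `0 < θ < 1`, `x ^ θ` is a positive superposition of the functions `t^{θ-1} x/(t + x)`, so it
suffices to treat each `t`; the endpoints are the Cauchy kernel and a constant. -/
theorem rpow_add_div {u : X → ℝ} (hu : ∀ x, 0 < u x) {θ : ℝ} (h0 : 0 ≤ θ) (h1 : θ ≤ 1) :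
    PSD fun x y => (u x ^ θ + u y ^ θ) / (u x + u y) := by
  rcases h0.eq_or_lt with rfl | h0
  · have := (inv_add hu).const_mul zero_le_two
    simpa [div_eq_mul_inv, one_add_one_eq_two] using this
  rcases h1.eq_or_lt with rfl | h1
  · have h := const (X := X) zero_le_one
    convert h using 3 with x y
    simp only [Real.rpow_one]
    exact div_self (by linarith [hu x, hu y])
  obtain ⟨ν, hν⟩ := Real.exists_measure_rpow_eq_integral_rpowIntegrand₀₁ (p := θ) ⟨h0, h1⟩
  have hi := fun x => (hν (u x) (hu x).le).1
  have h : ∀ x y, (u x ^ θ + u y ^ θ) / (u x + u y) = ∫ t in Set.Ioi 0,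
      (Real.rpowIntegrand₀₁ θ t (u x) + Real.rpowIntegrand₀₁ θ t (u y)) / (u x + u y) ∂ν := by
    intro x y
    rw [integral_div, integral_add (hi x) (hi y), ← (hν (u x) (hu x).le).2,
      ← (hν (u y) (hu y).le).2]
  simp_rw [h]
  refine integral ?_ fun x y => ((hi x).add (hi y)).div_const _
  filter_upwards [ae_restrict_mem measurableSet_Ioi] with t ht
  have ht : 0 < t := ht
  -- The identity used is `(u/(t+u) + v/(t+v))/(u+v) = (t + 2uv/(u+v)) / ((t+u)(t+v))`.
  have h1 := ((inv_add hu).const_mul zero_le_two).mul (rankOne u)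
  have h2 := (h1.add (const (X := X) ht.le)).mul (rankOne fun x => (t + u x)⁻¹)
  have h3 := h2.const_mul (a := t ^ θ * t⁻¹) (by positivity)
  convert h3 using 3 with x y
  have := hu x
  have := hu y
  rw [Real.rpowIntegrand₀₁, Real.rpowIntegrand₀₁]
  field_simp
  ring

theorem abs_le (h : PSD K) (x y : X) : |K x y| ≤ (K x x + K y y) / 2 := by
  have h1 := h.nonneg 2 ![x, y] ![1, 1]
  have h2 := h.nonneg 2 ![x, y] ![1, -1]
  simp only [Fin.sum_univ_two, Matrix.cons_val_zero, Matrix.cons_val_one] at h1 h2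
  rw [_root_.abs_le]
  have := h.symm x y
  constructor <;> linarith

/-- Draw `N` independent points with law `P` and average the finite inequality with all coefficients
one. The diagonal contributes `N D`, the off-diagonal terms `N(N-1) I`, and large `N` forces `0 ≤
I`. -/
theorem integral_nonneg_of_bounded [MeasurableSpace X] (P : Measure X) [IsProbabilityMeasure P]
    (h : PSD K) (hm : Measurable (Function.uncurry K)) {C : ℝ} (hC : ∀ x y, |K x y| ≤ C) :
    0 ≤ ∫ z, K z.1 z.2 ∂(P.prod P) := by
  set I := ∫ z, K z.1 z.2 ∂(P.prod P)
  set D := ∫ x, K x x ∂P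
  have key : ∀ N : ℕ, 0 ≤ (N : ℝ) * D + N * (N - 1) * I := by
    intro N
    have h_int : ∀ i j : Fin N, Integrable (fun w : Fin N → X => K (w i) (w j))
        (Measure.pi fun _ => P) := by
      intro i j
      refine Integrable.of_bound (C := C) ?_ (Filter.Eventually.of_forall fun w => by
        simpa using hC _ _)
      have : Measurable fun w : Fin N → X => (w i, w j) := by fun_prop
      exact (hm.comp this).aestronglyMeasurable
    have hval : ∀ i j : Fin N, ∫ w : Fin N → X, K (w i) (w j) ∂(Measure.pi fun _ => P)
        = if i = j then D else I := by
      intro i j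
      split_ifs with hij
      · subst hij
        have hp := measurePreserving_eval (fun _ : Fin N => P) i
        have hm' : Measurable fun x => K x x := hm.comp (measurable_id.prodMk measurable_id)
        have := integral_map (μ := Measure.pi fun _ : Fin N => P) hp.measurable.aemeasurable
          (f := fun x => K x x)
          hm'.aestronglyMeasurable
        rw [hp.map_eq] at this
        exact this.symm
      · have hind : ProbabilityTheory.iIndepFun (fun (i : Fin N) (w : Fin N → X) => w i)
            (Measure.pi fun _ => P) :=
          ProbabilityTheory.iIndepFun_pi (X := fun _ x => x) fun _ => aemeasurable_id
        have h2 := (ProbabilityTheory.indepFun_iff_map_prod_eq_prod_map_map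
          (measurable_pi_apply i).aemeasurable (measurable_pi_apply j).aemeasurable).1
          (hind.indepFun hij)
        have e : ∀ i : Fin N, Measure.map (fun w : Fin N → X => w i) (Measure.pi fun _ => P) = P :=
          fun i => (measurePreserving_eval (fun _ : Fin N => P) i).map_eq
        rw [e, e] at h2
        have := integral_map (μ := Measure.pi fun _ : Fin N => P)
          (φ := fun w => (w i, w j))
          ((measurable_pi_apply i).prodMk (measurable_pi_apply j)).aemeasurable
          (f := fun z : X × X => K z.1 z.2) hm.aestronglyMeasurable
        rw [h2] at this
        exact this.symm
    have h0 : 0 ≤ ∫ w : Fin N → X, ∑ i, ∑ j, K (w i) (w j) ∂(Measure.pi fun _ => P) :=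
      integral_nonneg fun w => by simpa using h.nonneg N w fun _ => 1
    rw [integral_finsetSum _ fun i _ => integrable_finsetSum _ fun j _ => h_int i j] at h0
    simp_rw [integral_finsetSum _ fun j _ => h_int _ j, hval] at h0
    convert h0 using 1
    have : ∀ i j : Fin N, (if i = j then D else I) = (if i = j then D - I else 0) + I := by
      intro i j; split_ifs <;> ring
    simp_rw [this, Finset.sum_add_distrib]
    simp
    ring
  by_contra hI
  push Not at hI
  -- With `N + 1` points the inequality divided by `N + 1` reads `0 ≤ D + N I`, which this choice of
  -- `N` violates.
  obtain ⟨N, hN⟩ := exists_nat_gt (D / (-I))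
  have h1 := key (N + 1)
  have h2 : D < N * (-I) := by rwa [div_lt_iff₀ (by linarith)] at hN
  push_cast at h1
  nlinarith

/-- Exhaustion by sets of finite measure on which the diagonal is bounded: by `abs_le` the kernel is
then bounded on the square of each set, and the normalised measure there is a probability. -/
theorem integral_nonneg [MeasurableSpace X] {ν : Measure X} [SigmaFinite ν] (h : PSD K)
    (hm : Measurable (Function.uncurry K)) (hi : Integrable (Function.uncurry K) (ν.prod ν)) :
    0 ≤ ∫ z, K z.1 z.2 ∂(ν.prod ν) := by
  have hd : Measurable fun x => K x x := hm.comp (measurable_id.prodMk measurable_id)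
  let S : ℕ → Set X := fun N => spanningSets ν N ∩ {x | K x x ≤ N}
  have hS : ∀ N, MeasurableSet (S N) := fun N =>
    (measurableSet_spanningSets ν N).inter (measurableSet_le hd measurable_const)
  have hmono : Monotone S := fun i j hij => Set.inter_subset_inter
    (monotone_spanningSets ν hij) fun x (hx : K x x ≤ i) => hx.trans (by exact_mod_cast hij)
  have hfin : ∀ N, ν (S N) < ⊤ := fun N =>
    (measure_mono Set.inter_subset_left).trans_lt (measure_spanningSets_lt_top ν N)
  have hpos : ∀ N, 0 ≤ ∫ z in S N ×ˢ S N, K z.1 z.2 ∂(ν.prod ν) := by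
    intro N
    rw [← Measure.prod_restrict]
    by_cases h0 : ν (S N) = 0
    · rw [Measure.restrict_eq_zero.2 h0]; simp
    set P : Measure X := ProbabilityTheory.cond ν (S N) with hP
    have : IsProbabilityMeasure P :=
      ProbabilityTheory.cond_isProbabilityMeasure_of_finite h0 (hfin N).ne
    let K' : X → X → ℝ := fun x y => (S N).indicator 1 x * (S N).indicator 1 y * K x y
    have hK' : PSD K' := (rankOne _).mul h
    have hb : ∀ x y, |K' x y| ≤ N := by
      intro x y
      refine (hK'.abs_le x y).trans ?_
      have : ∀ x, K' x x ≤ N := by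
        intro x
        by_cases hx : x ∈ S N
        · simpa [K', hx] using hx.2
        · simp [K', hx]
      linarith [this x, this y]
    have hKm : Measurable (Function.uncurry K') := by
      have h1 : Measurable ((S N).indicator (1 : X → ℝ)) := measurable_one.indicator (hS N)
      exact ((h1.comp measurable_fst).mul (h1.comp measurable_snd)).mul hm
    have h1 := hK'.integral_nonneg_of_bounded P hKm hb
    have hν : ν.restrict (S N) = ν (S N) • P := by
      rw [hP, ProbabilityTheory.cond, smul_smul, ENNReal.mul_inv_cancel h0 (hfin N).ne, one_smul]
    have h2 : ∫ z, K z.1 z.2 ∂((ν.restrict (S N)).prod (ν.restrict (S N)))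
        = ∫ z, K' z.1 z.2 ∂((ν.restrict (S N)).prod (ν.restrict (S N))) := by
      rw [Measure.prod_restrict]
      refine setIntegral_congr_fun ((hS N).prod (hS N)) fun z hz => ?_
      simp [K', hz.1, hz.2]
    rw [h2, hν, Measure.prod_smul_left, Measure.prod_smul_right, integral_smul_measure,
      integral_smul_measure]
    positivity
  have hun : ⋃ N, S N ×ˢ S N = Set.univ := by
    refine Set.eq_univ_of_forall fun z => ?_
    have ex : ∀ x, ∃ N, x ∈ S N := by
      intro x
      have : x ∈ ⋃ N, spanningSets ν N := by rw [iUnion_spanningSets]; trivial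
      obtain ⟨N, hN⟩ := Set.mem_iUnion.1 this
      obtain ⟨M, hM⟩ := exists_nat_ge (K x x)
      refine ⟨max N M, monotone_spanningSets ν (le_max_left _ _) hN, hM.trans ?_⟩
      exact_mod_cast le_max_right _ _
    obtain ⟨N, hN⟩ := ex z.1
    obtain ⟨M, hM⟩ := ex z.2
    exact Set.mem_iUnion.2 ⟨max N M, hmono (le_max_left _ _) hN, hmono (le_max_right _ _) hM⟩
  have ht := tendsto_setIntegral_of_monotone (μ := ν.prod ν)
    (f := fun z : X × X => K z.1 z.2) (s := fun N => S N ×ˢ S N)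
    (fun N => (hS N).prod (hS N)) (fun i j hij => Set.prod_mono (hmono hij) (hmono hij))
    hi.integrableOn
  rw [hun, setIntegral_univ] at ht
  exact ge_of_tendsto' ht hpos

end PSD

/-! ### Even and odd parts of the denominator, and their bounds by `ell`. -/

/-- The part of `1 / G` that is even under reflection of `s + A K`. -/
noncomputable def evenDen (m : ℝ) (K : E3) (Q : ℝ) (s t : E3) : ℝ :=
  ‖s + (2 + m)⁻¹ • K‖ ^ 2 + ‖t + (2 + m)⁻¹ • K‖ ^ 2 + m / (1 + m) * (Q ^ 2 + (2 + m)⁻¹ * ‖K‖ ^ 2)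

/-- The part of `1 / G` that is odd under reflection of `s + A K`. -/
noncomputable def oddDen (m : ℝ) (K : E3) (s t : E3) : ℝ :=
  2 / (1 + m) * inner ℝ (s + (2 + m)⁻¹ • K) (t + (2 + m)⁻¹ • K)

theorem evenDen_comm (m : ℝ) (K : E3) (Q : ℝ) (s t : E3) :
    evenDen m K Q s t = evenDen m K Q t s := by
  unfold evenDen; ring

theorem oddDen_comm (m : ℝ) (K : E3) (s t : E3) : oddDen m K s t = oddDen m K t s := by
  unfold oddDen; rw [real_inner_comm]

theorem ell_sq {m : ℝ} (hm : 0 < m) (s K : E3) (Q : ℝ) :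
    ell m s K Q ^ 2 = m / (m + 1) ^ 2 * ‖s + K‖ ^ 2 + m / (m + 1) * (‖s‖ ^ 2 + Q ^ 2) :=
  Real.sq_sqrt (by positivity)

/-- The shift by `A = 1/(2+m)` completes the square in `s`; the remainder is the same
`s`-independent term as in `evenDen`. -/
theorem ell_sq_shift {m : ℝ} (hm : 0 < m) (s K : E3) (Q : ℝ) :
    ell m s K Q ^ 2 = m * (m + 2) / (m + 1) ^ 2 * ‖s + (2 + m)⁻¹ • K‖ ^ 2
      + m / (1 + m) * (Q ^ 2 + (2 + m)⁻¹ * ‖K‖ ^ 2) := by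
  rw [ell_sq hm, norm_add_sq_real, norm_add_sq_real, real_inner_smul_right, norm_smul,
    Real.norm_of_nonneg (by positivity)]
  field_simp
  ring

theorem ell_pos {m : ℝ} (hm : 0 < m) (s K : E3) {Q : ℝ} (hQ : 0 < Q) : 0 < ell m s K Q :=
  Real.sqrt_pos.2 (by positivity)

theorem evenDen_pos {m : ℝ} (hm : 0 < m) (K : E3) {Q : ℝ} (hQ : 0 < Q) (s t : E3) :
    0 < evenDen m K Q s t := by
  unfold evenDen; positivity

/-- Up to a constant factor and a term free of `s` and `t`, the even part is the sum of the two `ell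
^ 2`. This makes kernels in powers of `ell` comparable with `1/evenDen`. -/
theorem evenDen_eq {m : ℝ} (hm : 0 < m) (K : E3) (Q : ℝ) (s t : E3) :
    evenDen m K Q s t = (m * (m + 2) / (m + 1) ^ 2)⁻¹ * (ell m s K Q ^ 2 + ell m t K Q ^ 2
      - (2 - m * (m + 2) / (m + 1) ^ 2) * (m / (1 + m) * (Q ^ 2 + (2 + m)⁻¹ * ‖K‖ ^ 2))) := by
  rw [ell_sq_shift hm, ell_sq_shift hm, evenDen]
  field_simp
  ring

theorem half_ell_sq_le_evenDen {m : ℝ} (hm : 0 < m) (K : E3) (Q : ℝ) (s t : E3) :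
    (ell m s K Q ^ 2 + ell m t K Q ^ 2) / 2 ≤ evenDen m K Q s t := by
  rw [ell_sq_shift hm, ell_sq_shift hm, evenDen]
  have h : m * (m + 2) / (m + 1) ^ 2 ≤ 1 := by
    rw [div_le_one (by positivity)]; nlinarith
  nlinarith [mul_le_mul_of_nonneg_right h (sq_nonneg ‖s + (2 + m)⁻¹ • K‖),
    mul_le_mul_of_nonneg_right h (sq_nonneg ‖t + (2 + m)⁻¹ • K‖),
    sq_nonneg ‖s + (2 + m)⁻¹ • K‖, sq_nonneg ‖t + (2 + m)⁻¹ • K‖]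

theorem norm_shift_sq_le {m : ℝ} (hm : 0 < m) (s K : E3) (Q : ℝ) :
    ‖s + (2 + m)⁻¹ • K‖ ^ 2 ≤ (m * (m + 2) / (m + 1) ^ 2)⁻¹ * ell m s K Q ^ 2 := by
  rw [ell_sq_shift hm, mul_add, inv_mul_cancel_left₀ (by positivity)]
  have : 0 ≤ (m * (m + 2) / (m + 1) ^ 2)⁻¹ * (m / (1 + m) * (Q ^ 2 + (2 + m)⁻¹ * ‖K‖ ^ 2)) := by
    positivity
  linarith

theorem norm_sq_add_le_ell {m : ℝ} (hm : 0 < m) (s K : E3) (Q : ℝ) :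
    m / (m + 1) * (‖s‖ ^ 2 + Q ^ 2) ≤ ell m s K Q ^ 2 := by
  rw [ell_sq hm]
  have : 0 ≤ m / (m + 1) ^ 2 * ‖s + K‖ ^ 2 := by positivity
  linarith

theorem abs_oddDen_le {m : ℝ} (hm : 0 < m) (K : E3) (Q : ℝ) (s t : E3) :
    |oddDen m K s t| ≤ (1 + m)⁻¹ * evenDen m K Q s t := by
  unfold oddDen evenDen
  rw [abs_mul, abs_of_pos (by positivity), div_eq_inv_mul, mul_assoc]
  have h := abs_real_inner_le_norm (s + (2 + m)⁻¹ • K) (t + (2 + m)⁻¹ • K)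
  have h2 := two_mul_le_add_sq ‖s + (2 + m)⁻¹ • K‖ ‖t + (2 + m)⁻¹ • K‖
  have h3 : 0 ≤ m / (1 + m) * (Q ^ 2 + (2 + m)⁻¹ * ‖K‖ ^ 2) := by positivity
  gcongr
  nlinarith

theorem abs_oddDen_lt {m : ℝ} (hm : 0 < m) (K : E3) {Q : ℝ} (hQ : 0 < Q) (s t : E3) :
    |oddDen m K s t| < evenDen m K Q s t := by
  refine (abs_oddDen_le hm K Q s t).trans_lt ?_
  have := evenDen_pos hm K hQ s t
  exact (mul_lt_iff_lt_one_left this).2 (inv_lt_one_of_one_lt₀ (by linarith))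

theorem den_sq_sub_ge {m : ℝ} (hm : 0 < m) (K : E3) (Q : ℝ) (s t : E3) :
    m * (m + 2) / (m + 1) ^ 2 * evenDen m K Q s t ^ 2
      ≤ evenDen m K Q s t ^ 2 - oddDen m K s t ^ 2 := by
  have h := abs_oddDen_le hm K Q s t
  have h2 := pow_le_pow_left₀ (abs_nonneg _) h 2
  rw [sq_abs, mul_pow] at h2
  have : m * (m + 2) / (m + 1) ^ 2 = 1 - (1 + m)⁻¹ ^ 2 := by field_simp; ring
  rw [this]; linarith

theorem den_sq_sub_pos {m : ℝ} (hm : 0 < m) (K : E3) {Q : ℝ} (hQ : 0 < Q) (s t : E3) :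
    0 < evenDen m K Q s t ^ 2 - oddDen m K s t ^ 2 := by
  have := evenDen_pos hm K hQ s t
  exact (by positivity : 0 < m * (m + 2) / (m + 1) ^ 2 * evenDen m K Q s t ^ 2).trans_le
    (den_sq_sub_ge hm K Q s t)

/-! ### Positivity of the even part. -/

theorem PSD_evenDen_inv {m : ℝ} (hm : 0 < m) (K : E3) {Q : ℝ} (hQ : 0 < Q) :
    PSD fun s t => (evenDen m K Q s t)⁻¹ := by
  have h := PSD.inv_add (u := fun s : E3 => ‖s + (2 + m)⁻¹ • K‖ ^ 2
    + m / (1 + m) * (Q ^ 2 + (2 + m)⁻¹ * ‖K‖ ^ 2) / 2) fun s => by positivity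
  convert h using 4 with s t
  unfold evenDen; ring

/-- Geometric series in `(B/X)²`, convergent since `|B| < X`. Each power is positive semidefinite
because `B` is a multiple of an inner product and `1/X` is a Cauchy kernel. -/
theorem PSD_evenDen_mul_evenPart {m : ℝ} (hm : 0 < m) (K : E3) {Q : ℝ} (hQ : 0 < Q) :
    PSD fun s t => evenDen m K Q s t ^ 2 / (evenDen m K Q s t ^ 2 - oddDen m K s t ^ 2) := by
  have h1 : PSD fun s t => oddDen m K s t :=
    (PSD.inner fun s : E3 => s + (2 + m)⁻¹ • K).const_mul (by positivity)
  have h2 := (h1.mul (PSD_evenDen_inv hm K hQ)).pow 2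
  refine PSD.of_hasSum (fun j => h2.pow j) fun s t => ?_
  have hX := evenDen_pos hm K hQ s t
  have hlt := abs_oddDen_lt hm K hQ s t
  have hlt2 : oddDen m K s t ^ 2 < evenDen m K Q s t ^ 2 := by
    rw [← sq_abs (oddDen m K s t)]
    exact pow_lt_pow_left₀ hlt (abs_nonneg _) two_ne_zero
  have hr : (oddDen m K s t * (evenDen m K Q s t)⁻¹) ^ 2 < 1 := by
    rw [mul_pow, inv_pow, ← div_eq_mul_inv, div_lt_one (by positivity)]
    exact hlt2
  convert hasSum_geometric_of_lt_one (sq_nonneg _) hr using 1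
  have := den_sq_sub_pos hm K hQ s t
  field_simp

/-- The kernel factors as `(u^{β/2} + v^{β/2})/(u + v)` with `u`, `v` the two `ell ^ 2`, times `(u +
v)/X = c + (2 - c) e / X`. Both are positive semidefinite, the second because `c ≤ 1`. -/
theorem PSD_rpow_add_div_evenDen {m : ℝ} (hm : 0 < m) (K : E3) {Q : ℝ} (hQ : 0 < Q) {β : ℝ}
    (h0 : 0 ≤ β) (h2 : β ≤ 2) :
    PSD fun s t => (ell m s K Q ^ β + ell m t K Q ^ β) / evenDen m K Q s t := by
  set c : ℝ := m * (m + 2) / (m + 1) ^ 2 with hc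
  have hcp : 0 < c := by positivity
  have hc1 : c ≤ 1 := by rw [hc, div_le_one (by positivity)]; nlinarith
  set e : ℝ := m / (1 + m) * (Q ^ 2 + (2 + m)⁻¹ * ‖K‖ ^ 2) with he
  have hep : 0 < e := by positivity
  have hl := fun s => ell_pos hm s K hQ
  have k1 := PSD.rpow_add_div (u := fun s => ell m s K Q ^ 2) (fun s => by have := hl s; positivity)
    (θ := β / 2) (by linarith) (by linarith)
  have k2 := (PSD.const (X := E3) hcp.le).add
    ((PSD_evenDen_inv hm K hQ).const_mul (a := (2 - c) * e) (by nlinarith))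
  have k3 := k1.mul k2
  convert k3 using 3 with s t
  have r : ∀ s, (ell m s K Q ^ 2) ^ (β / 2) = ell m s K Q ^ β := by
    intro s
    rw [← Real.rpow_natCast_mul (hl s).le]
    congr 1; push_cast; ring
  have hX := evenDen_pos hm K hQ s t
  have hE := evenDen_eq hm K Q s t
  rw [← hc, ← he] at hE
  have hs : ell m s K Q ^ 2 + ell m t K Q ^ 2 = evenDen m K Q s t * c + (2 - c) * e := by
    rw [hE]; field_simp; ring
  have hne : evenDen m K Q s t * c + (2 - c) * e ≠ 0 := by
    have : 0 < evenDen m K Q s t * c := by positivity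
    nlinarith
  rw [r, r, hs]
  field_simp

/-! ### The regularised symbol. -/

/-- The regularised symbol `x ^ β / (1 + ε x ^ β)`. -/
noncomputable def reg (β ε x : ℝ) : ℝ := x ^ β / (1 + ε * x ^ β)

theorem reg_nonneg {β ε x : ℝ} (hε : 0 ≤ ε) (hx : 0 ≤ x) : 0 ≤ reg β ε x := by
  unfold reg; positivity

theorem reg_pos {β ε x : ℝ} (hε : 0 ≤ ε) (hx : 0 < x) : 0 < reg β ε x := by
  unfold reg; positivity

theorem reg_le_rpow {β ε x : ℝ} (hε : 0 ≤ ε) (hx : 0 ≤ x) : reg β ε x ≤ x ^ β :=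
  div_le_self (by positivity) (by have : 0 ≤ ε * x ^ β := by positivity
                                  linarith)

theorem reg_le_inv {β ε x : ℝ} (hε : 0 < ε) (hx : 0 ≤ x) : reg β ε x ≤ ε⁻¹ := by
  have : 0 ≤ x ^ β := by positivity
  unfold reg
  rw [div_le_iff₀ (by positivity), mul_add, inv_mul_cancel_left₀ hε.ne']
  have : 0 < ε⁻¹ := by positivity
  linarith

/-- Regularising brings the ratio of the two values closer to one, so it can only lower the quotient
of their arithmetic and geometric means. Consequently `Λ_β`, defined with pure powers, also controls
the regularised symbol. -/
theorem reg_add_mul_le {β ε x y : ℝ} (hε : 0 ≤ ε) (hx : 0 < x) (hy : 0 < y) :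
    (reg β ε x + reg β ε y) * Real.sqrt (x ^ β * y ^ β)
      ≤ (x ^ β + y ^ β) * Real.sqrt (reg β ε x * reg β ε y) := by
  have hX : 0 < x ^ β := by positivity
  have hY : 0 < y ^ β := by positivity
  unfold reg
  generalize x ^ β = X at *
  generalize y ^ β = Y at *
  have hX1 : 0 < 1 + ε * X := by positivity
  have hY1 : 0 < 1 + ε * Y := by positivity
  have e1 : X / (1 + ε * X) * (Y / (1 + ε * Y)) = X * Y / ((1 + ε * X) * (1 + ε * Y)) := by
    field_simp
  rw [e1, Real.sqrt_div (by positivity)]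
  set D := Real.sqrt ((1 + ε * X) * (1 + ε * Y)) with hD
  have hDp : 0 < D := Real.sqrt_pos.2 (by positivity)
  have hDD : D ^ 2 = (1 + ε * X) * (1 + ε * Y) := Real.sq_sqrt (by positivity)
  have e2 : X / (1 + ε * X) + Y / (1 + ε * Y) = (X + Y + 2 * ε * X * Y) / D ^ 2 := by
    rw [hDD]; field_simp; ring
  have key : X + Y + 2 * ε * X * Y ≤ (X + Y) * D := by
    refine le_of_sq_le_sq ?_ (by positivity)
    rw [mul_pow, hDD]
    -- The difference of the two squares is exactly `ε (X+Y)(X-Y)² + ε² XY (X-Y)²`.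
    have h4 : 0 ≤ (X - Y) ^ 2 := sq_nonneg _
    have a1 : 0 ≤ ε * (X + Y) * (X - Y) ^ 2 := by positivity
    have a2 : 0 ≤ ε ^ 2 * (X * Y) * (X - Y) ^ 2 := by positivity
    nlinarith
  rw [e2, div_mul_eq_mul_div, div_le_iff₀ (by positivity)]
  calc (X + Y + 2 * ε * X * Y) * Real.sqrt (X * Y) ≤ ((X + Y) * D) * Real.sqrt (X * Y) := by gcongr
    _ = _ := by field_simp

/-- With `a`, `b` the two pure powers, the regularised values add up to `(a + b + 2ε ab)/((1 + εa)(1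
+ εb))`. The denominator is rank one, and the extra term `2ε ab` is again a positive semidefinite
kernel. -/
theorem PSD_reg_evenPart {m : ℝ} (hm : 0 < m) (K : E3) {Q : ℝ} (hQ : 0 < Q) {β ε : ℝ}
    (h0 : 0 ≤ β) (h2 : β ≤ 2) (hε : 0 ≤ ε) :
    PSD fun s t => (reg β ε (2 * Real.pi ^ 2 * ell m s K Q)
        + reg β ε (2 * Real.pi ^ 2 * ell m t K Q))
      * (evenDen m K Q s t / (evenDen m K Q s t ^ 2 - oddDen m K s t ^ 2)) := by
  have hl := fun s => ell_pos hm s K hQ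
  set p : ℝ := (2 * Real.pi ^ 2) ^ β with hp
  have hpp : 0 < p := by have := Real.pi_pos; positivity
  have hr : ∀ s, (2 * Real.pi ^ 2 * ell m s K Q) ^ β = p * ell m s K Q ^ β := fun s =>
    Real.mul_rpow (by positivity) (hl s).le
  have k1 := (PSD_rpow_add_div_evenDen hm K hQ h0 h2).const_mul hpp.le
  have k2 := ((PSD.rankOne fun s => p * ell m s K Q ^ β).mul
    (PSD_evenDen_inv hm K hQ)).const_mul (a := 2 * ε) (by positivity)
  have k3 := ((k1.add k2).mul (PSD.rankOne fun s => (1 + ε * (p * ell m s K Q ^ β))⁻¹)).mul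
    (PSD_evenDen_mul_evenPart hm K hQ)
  convert k3 using 3 with s t
  have hX := evenDen_pos hm K hQ s t
  have hd := den_sq_sub_pos hm K hQ s t
  have h1 : 0 < ell m s K Q ^ β := by have := hl s; positivity
  have h2 : 0 < ell m t K Q ^ β := by have := hl t; positivity
  simp only [reg, hr]
  generalize ell m s K Q ^ β = x at *
  generalize ell m t K Q ^ β = y at *
  generalize evenDen m K Q s t ^ 2 - oddDen m K s t ^ 2 = d at *
  generalize evenDen m K Q s t = X at *
  have h3 : 1 + ε * (p * x) ≠ 0 := by positivity
  have h4 : 1 + ε * (p * y) ≠ 0 := by positivity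
  field_simp
  ring

/-! ### The symbols `L` and `G` in the variables `(s, K, Q)`. -/

/-- `Q` with the mass term absorbed. -/
noncomputable def effQ {n : ℕ} (m μ : ℝ) (q : Fin n → E3) : ℝ :=
  Real.sqrt (∑ i, ‖q i‖ ^ 2 + (m + 1) / m * μ)

theorem sum_inner_Ioi {k : ℕ} (q : Fin k → E3) :
    ∑ i, ∑ j ∈ Finset.Ioi i, inner ℝ (q i) (q j) = (‖∑ i, q i‖ ^ 2 - ∑ i, ‖q i‖ ^ 2) / 2 := by
  induction k with
  | zero => simp
  | succ k ih =>
    rw [Fin.sum_univ_succ, Fin.sum_univ_succ, Fin.sum_univ_succ, norm_add_sq_real]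
    have h := ih fun i => q i.succ
    have h1 : ∑ j ∈ Finset.Ioi (0 : Fin (k + 1)), inner ℝ (q 0) (q j)
        = inner ℝ (q 0) (∑ i : Fin k, q i.succ) := by
      rw [inner_sum, Fin.Ioi_zero_eq_map, Finset.sum_map]; rfl
    have h2 : ∀ i : Fin k, ∑ j ∈ Finset.Ioi i.succ, inner ℝ (q i.succ) (q j)
        = ∑ j ∈ Finset.Ioi i, inner ℝ (q i.succ) (q j.succ) := by
      intro i
      rw [Fin.Ioi_succ, Finset.sum_map]; rfl
    simp_rw [h1, h2, h]
    ring

theorem effQ_sq {n : ℕ} {m μ : ℝ} (hm : 0 < m) (hμ : 0 < μ) (q : Fin n → E3) :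
    effQ m μ q ^ 2 = ∑ i, ‖q i‖ ^ 2 + (m + 1) / m * μ := Real.sq_sqrt (by positivity)

theorem effQ_pos {n : ℕ} {m μ : ℝ} (hm : 0 < m) (hμ : 0 < μ) (q : Fin n → E3) :
    0 < effQ m μ q := Real.sqrt_pos.2 (by positivity)

/-- The summand `(m+1)μ/m` in `effQ` is what the prefactor `m/(m+1)` of `Q²` turns into `μ`. Thus
positive `μ` is covered by the `μ`-free quantities in `Λ_β`, and `Q > 0` holds automatically. -/
theorem L_cons {n : ℕ} {m μ : ℝ} (hm : 0 < m) (hμ : 0 < μ) (s : E3) (q : Fin n → E3) :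
    L m μ (cons s q) = 2 * Real.pi ^ 2 * ell m s (∑ i, q i) (effQ m μ q) := by
  unfold L ell
  congr 2
  rw [effQ_sq hm hμ, sum_inner_Ioi]
  simp only [cons, Fin.sum_univ_succ, Fin.cons_zero, Fin.cons_succ]
  rw [norm_add_sq_real s]
  field_simp
  ring

theorem G_cons {n : ℕ} {m μ : ℝ} (hm : 0 < m) (hμ : 0 < μ) (s t : E3) (q : Fin n → E3) :
    G m μ (Fin.cons s (Fin.cons t q : Fin (n + 1) → E3) : Fin (n + 2) → E3)
      = (evenDen m (∑ i, q i) (effQ m μ q) s t + oddDen m (∑ i, q i) s t)⁻¹ := by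
  unfold G evenDen oddDen
  congr 1
  rw [effQ_sq hm hμ, sum_inner_Ioi]
  simp only [Fin.sum_univ_succ, Fin.cons_zero, Fin.cons_succ]
  generalize ∑ i, q i = K
  generalize ∑ i, ‖q i‖ ^ 2 = R
  simp only [← real_inner_self_eq_norm_sq, inner_add_left, inner_add_right, real_inner_smul_left,
    real_inner_smul_right]
  rw [real_inner_comm s t, real_inner_comm s K, real_inner_comm t K]
  field_simp
  ring

/-! ### Radial integrals, finiteness of `Λ_β` and the weighted row integrals. -/

theorem lintegral_eq_mul_lintegral_comp_smul {E : Type*} [NormedAddCommGroup E]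
    [InnerProductSpace ℝ E] [FiniteDimensional ℝ E] [MeasurableSpace E] [BorelSpace E]
    {R : ℝ} (hR : 0 < R) (f : E → ℝ≥0∞) :
    ∫⁻ x, f x = ENNReal.ofReal (R ^ Module.finrank ℝ E) * ∫⁻ x, f (R • x) := by
  have e : MeasurableEmbedding fun x : E => R • x :=
    (Homeomorph.smulOfNeZero R hR.ne').measurableEmbedding
  rw [← e.lintegral_map, Measure.map_addHaar_smul volume hR.ne', lintegral_smul_measure,
    abs_of_pos (by positivity), smul_eq_mul, ← mul_assoc, ← ENNReal.ofReal_mul (by positivity),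
    mul_inv_cancel₀ (by positivity), ENNReal.ofReal_one, one_mul]

/-- In polar coordinates the integrand behaves like `r^{2-δ}` at the origin and `r^{-δ}` at
infinity, which gives the two conditions on `δ`. -/
theorem integrable_norm_rpow_div {δ : ℝ} (h1 : 1 < δ) (h3 : δ < 3) :
    Integrable fun t : E3 => ‖t‖ ^ (-δ) / (‖t‖ ^ 2 + 1) := by
  have := integrable_fun_norm_addHaar (volume : Measure E3)
    (f := fun r : ℝ => r ^ (-δ) / (r ^ 2 + 1))
  rw [this]
  simp only [finrank_euclideanSpace, Fintype.card_fin, smul_eq_mul, Nat.add_one_sub_one]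
  have hm : Measurable fun r : ℝ => r ^ 2 * (r ^ (-δ) / (r ^ 2 + 1)) := by fun_prop
  have hbig : IntegrableOn (fun r : ℝ => r ^ 2 * (r ^ (-δ) / (r ^ 2 + 1))) (Set.Ioi 1) := by
    refine (integrableOn_Ioi_rpow_of_lt (a := -δ) (by linarith) one_pos).mono'
      hm.aestronglyMeasurable ?_
    filter_upwards [ae_restrict_mem measurableSet_Ioi] with r hr
    have hr : 1 < r := hr
    have : 0 < r ^ (-δ) := by positivity
    rw [Real.norm_of_nonneg (by positivity), mul_div_assoc', div_le_iff₀ (by positivity)]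
    nlinarith
  have hsmall : IntegrableOn (fun r : ℝ => r ^ 2 * (r ^ (-δ) / (r ^ 2 + 1))) (Set.Ioc 0 1) := by
    have := (intervalIntegral.intervalIntegrable_rpow' (a := 0) (b := 1) (r := 2 - δ)
      (by linarith)).1
    refine this.mono' hm.aestronglyMeasurable ?_
    filter_upwards [ae_restrict_mem measurableSet_Ioc] with r hr
    have hr : 0 < r := hr.1
    rw [Real.norm_of_nonneg (by positivity), mul_div_assoc', div_le_iff₀ (by positivity),
      sub_eq_add_neg, Real.rpow_add hr, Real.rpow_two]
    have : 0 < r ^ 2 * r ^ (-δ) := by positivity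
    nlinarith [sq_nonneg r]
  rw [← Set.Ioc_union_Ioi_eq_Ioi zero_le_one]
  exact hsmall.union hbig

theorem lintegral_norm_rpow_div_le {δ : ℝ} (h1 : 1 < δ) (h3 : δ < 3) :
    ∃ C : ℝ≥0∞, C ≠ ⊤ ∧ ∀ R : ℝ, 0 < R →
      ∫⁻ t : E3, ENNReal.ofReal (‖t‖ ^ (-δ) / (‖t‖ ^ 2 + R ^ 2))
        = C * ENNReal.ofReal (R ^ (1 - δ)) := by
  refine ⟨∫⁻ t : E3, ENNReal.ofReal (‖t‖ ^ (-δ) / (‖t‖ ^ 2 + 1)),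
    (integrable_norm_rpow_div h1 h3).lintegral_lt_top.ne, fun R hR => ?_⟩
  rw [lintegral_eq_mul_lintegral_comp_smul hR, ← lintegral_const_mul' _ _ ENNReal.ofReal_ne_top,
    mul_comm, ← lintegral_const_mul' _ _ ENNReal.ofReal_ne_top]
  refine lintegral_congr fun t => ?_
  rw [← ENNReal.ofReal_mul (by positivity), ← ENNReal.ofReal_mul (by positivity)]
  congr 1
  rw [norm_smul, Real.norm_of_nonneg hR.le, Real.mul_rpow hR.le (norm_nonneg _),
    Real.rpow_sub hR, Real.rpow_one, Real.rpow_neg hR.le, finrank_euclideanSpace, Fintype.card_fin]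
  field_simp

/-- Only the exponents `(β+1)/2` and `(2-β)/2`, nonnegative in this range of `β`, are moved up to
`z`; a `β`-independent power of `x` remains. -/
theorem rpow_mul_rpow_le {β x y z : ℝ} (h0 : 0 ≤ β) (h2 : β ≤ 2) (hx : 0 < x) (hy : 0 < y)
    (hxz : x ≤ z) (hyz : y ≤ z) :
    y ^ ((β + 1) / 2) * x ^ ((1 - β) / 2) ≤ z ^ (3 / 2 : ℝ) * x ^ (-1 / 2 : ℝ) := by
  have hz : 0 < z := hx.trans_le hxz
  have e1 : x ^ ((1 - β) / 2) = x ^ ((2 - β) / 2) * x ^ (-1 / 2 : ℝ) := by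
    rw [← Real.rpow_add hx]; congr 1; ring
  have e2 : z ^ (3 / 2 : ℝ) = z ^ ((β + 1) / 2) * z ^ ((2 - β) / 2) := by
    rw [← Real.rpow_add hz]; congr 1; ring
  rw [e1, e2, ← mul_assoc]
  gcongr

theorem lambdaIntegrand_eq (β m : ℝ) (s K : E3) (Q : ℝ) (t : E3) :
    LambdaIntegrand β m s K Q t = 1 / ‖t‖ ^ 2
      * (ell m s K Q ^ ((β - 1) / 2) / ell m t K Q ^ ((β + 1) / 2)
        + ell m t K Q ^ ((β - 1) / 2) / ell m s K Q ^ ((β + 1) / 2))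
      * (|inner ℝ (s + (2 + m)⁻¹ • K) (t + (2 + m)⁻¹ • K)|
        / (evenDen m K Q s t ^ 2 - oddDen m K s t ^ 2)) := rfl

theorem sqrt_mul_norm_le_ell {m : ℝ} (hm : 0 < m) (s K : E3) (Q : ℝ) :
    Real.sqrt (m / (m + 1)) * ‖s‖ ≤ ell m s K Q := by
  refine Real.le_sqrt_of_sq_le ?_
  rw [mul_pow, Real.sq_sqrt (by positivity)]
  have h1 : 0 ≤ m / (m + 1) ^ 2 * ‖s + K‖ ^ 2 := by positivity
  have h2 : 0 ≤ m / (m + 1) * Q ^ 2 := by positivity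
  linarith

theorem mul_sq_add_sq_le {m : ℝ} (hm : 0 < m) (s t K : E3) (Q : ℝ) :
    m / (m + 1) * (‖t‖ ^ 2 + ell m s K Q ^ 2) ≤ ell m t K Q ^ 2 + ell m s K Q ^ 2 := by
  have h := norm_sq_add_le_ell hm t K Q
  have h1 : m / (m + 1) ≤ 1 := by rw [div_le_one (by positivity)]; linarith
  have h2 : 0 ≤ m / (m + 1) * Q ^ 2 := by positivity
  have h3 := mul_le_mul_of_nonneg_right h1 (sq_nonneg (ell m s K Q))
  linarith

/-- With `x`, `y` the values of `ell` at `t`, `s` and `z² = x² + y²`, the inner product is at most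
of order `xy` and the denominator at least of order `z⁴`. What is left is `t^{-2} z^{-5/2}(x^{-1/2}
+ y^{-1/2})`. Then `x ≳ |t|` and `z² ≳ t² + y²` leave two radial integrands. -/
theorem lambdaIntegrand_le {m : ℝ} (hm : 0 < m) :
    ∃ C : ℝ, 0 ≤ C ∧ ∀ β : ℝ, 0 ≤ β → β ≤ 2 → ∀ (s K : E3) (Q : ℝ), 0 < Q → ∀ t : E3, t ≠ 0 →
      LambdaIntegrand β m s K Q t ≤
        C * (ell m s K Q ^ (-1 / 2 : ℝ) * (‖t‖ ^ (-(5 / 2) : ℝ) / (‖t‖ ^ 2 + ell m s K Q ^ 2))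
          + ell m s K Q ^ (-1 : ℝ) * (‖t‖ ^ (-2 : ℝ) / (‖t‖ ^ 2 + ell m s K Q ^ 2))) := by
  set c : ℝ := m * (m + 2) / (m + 1) ^ 2 with hc
  have hcp : 0 < c := by positivity
  set k : ℝ := m / (m + 1) with hk
  have hkp : 0 < k := by positivity
  refine ⟨4 * c⁻¹ * c⁻¹ * k⁻¹ * (Real.sqrt k ^ (-1 / 2 : ℝ) + 1), by positivity, ?_⟩
  intro β h0 h2 s K Q hQ t ht
  have htp : 0 < ‖t‖ := norm_pos_iff.2 ht
  rw [lambdaIntegrand_eq]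
  have hy := ell_pos hm s K hQ
  have hx := ell_pos hm t K hQ
  have hxt := sqrt_mul_norm_le_ell hm t K Q
  have hz2 := mul_sq_add_sq_le hm s t K Q
  have hX := half_ell_sq_le_evenDen hm K Q s t
  have hD := den_sq_sub_ge hm K Q s t
  have ha := norm_shift_sq_le hm s K Q
  have hb := norm_shift_sq_le hm t K Q
  have hin := abs_real_inner_le_norm (s + (2 + m)⁻¹ • K) (t + (2 + m)⁻¹ • K)
  rw [← hc] at hD ha hb
  rw [← hk] at hxt hz2
  set y := ell m s K Q
  set x := ell m t K Q
  set D := evenDen m K Q s t ^ 2 - oddDen m K s t ^ 2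
  have hN : |inner ℝ (s + (2 + m)⁻¹ • K) (t + (2 + m)⁻¹ • K)| ≤ c⁻¹ * (x * y) := by
    refine hin.trans (le_of_sq_le_sq ?_ (by positivity))
    calc (‖s + (2 + m)⁻¹ • K‖ * ‖t + (2 + m)⁻¹ • K‖) ^ 2
        = ‖s + (2 + m)⁻¹ • K‖ ^ 2 * ‖t + (2 + m)⁻¹ • K‖ ^ 2 := by ring
      _ ≤ (c⁻¹ * y ^ 2) * (c⁻¹ * x ^ 2) := by gcongr
      _ = _ := by ring
  set z := Real.sqrt (x ^ 2 + y ^ 2)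
  have hzz : z ^ 2 = x ^ 2 + y ^ 2 := Real.sq_sqrt (by positivity)
  have hzp : 0 < z := Real.sqrt_pos.2 (by positivity)
  have hxz : x ≤ z := Real.le_sqrt_of_sq_le (by nlinarith)
  have hyz : y ≤ z := Real.le_sqrt_of_sq_le (by nlinarith)
  have hDz : c / 4 * z ^ 4 ≤ D := by
    refine le_trans ?_ hD
    have : z ^ 2 / 2 ≤ evenDen m K Q s t := by rw [hzz]; linarith
    calc c / 4 * z ^ 4 = c * (z ^ 2 / 2) ^ 2 := by ring
      _ ≤ _ := by gcongr
  have hS : (y ^ ((β - 1) / 2) / x ^ ((β + 1) / 2) + x ^ ((β - 1) / 2) / y ^ ((β + 1) / 2))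
      * (x * y) ≤ z ^ (3 / 2 : ℝ) * (x ^ (-1 / 2 : ℝ) + y ^ (-1 / 2 : ℝ)) := by
    have q1 := rpow_mul_rpow_le h0 h2 hx hy hxz hyz
    have q2 := rpow_mul_rpow_le h0 h2 hy hx hyz hxz
    have e : ∀ {x y : ℝ}, 0 < x → 0 < y → y ^ ((β - 1) / 2) / x ^ ((β + 1) / 2) * (x * y)
        = y ^ ((β + 1) / 2) * x ^ ((1 - β) / 2) := by
      intro x y hx hy
      rw [show (β + 1) / 2 = (β - 1) / 2 + 1 by ring, Real.rpow_add hy, Real.rpow_one,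
        show (1 - β) / 2 = 1 - ((β - 1) / 2 + 1) by ring, Real.rpow_sub hx, Real.rpow_one]
      field_simp
    rw [add_mul, e hx hy, mul_comm x y, e hy hx]
    linarith
  have hfirst : 1 / ‖t‖ ^ 2
      * (y ^ ((β - 1) / 2) / x ^ ((β + 1) / 2) + x ^ ((β - 1) / 2) / y ^ ((β + 1) / 2))
      * (|inner ℝ (s + (2 + m)⁻¹ • K) (t + (2 + m)⁻¹ • K)| / D)
      ≤ 1 / ‖t‖ ^ 2 * (4 * c⁻¹ * c⁻¹) *
        ((z ^ (3 / 2 : ℝ) * (x ^ (-1 / 2 : ℝ) + y ^ (-1 / 2 : ℝ))) / z ^ 4) := by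
    have hDp : 0 < c / 4 * z ^ 4 := by positivity
    calc _ ≤ 1 / ‖t‖ ^ 2
        * (y ^ ((β - 1) / 2) / x ^ ((β + 1) / 2) + x ^ ((β - 1) / 2) / y ^ ((β + 1) / 2))
        * (c⁻¹ * (x * y) / (c / 4 * z ^ 4)) := by gcongr
      _ = 1 / ‖t‖ ^ 2 * (4 * c⁻¹ * c⁻¹) *
        (((y ^ ((β - 1) / 2) / x ^ ((β + 1) / 2) + x ^ ((β - 1) / 2) / y ^ ((β + 1) / 2))
          * (x * y)) / z ^ 4) := by field_simp
      _ ≤ _ := by gcongr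
  refine hfirst.trans ?_
  have hz32 : z ^ (3 / 2 : ℝ) / z ^ 4 ≤ y ^ (-1 / 2 : ℝ) / (k * (‖t‖ ^ 2 + y ^ 2)) := by
    have e : z ^ (3 / 2 : ℝ) / z ^ 4 = z ^ (-1 / 2 : ℝ) / z ^ 2 := by
      rw [show (-1 / 2 : ℝ) = 3 / 2 - 2 by norm_num, Real.rpow_sub hzp, Real.rpow_two]
      field_simp
    rw [e, hzz]
    have := Real.rpow_le_rpow_of_nonpos hy hyz (by norm_num : (-1 / 2 : ℝ) ≤ 0)
    gcongr
  have hx12 : x ^ (-1 / 2 : ℝ) ≤ Real.sqrt k ^ (-1 / 2 : ℝ) * ‖t‖ ^ (-1 / 2 : ℝ) := by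
    rw [← Real.mul_rpow (by positivity) (by positivity)]
    exact Real.rpow_le_rpow_of_nonpos (by positivity) hxt (by norm_num)
  have e52 : ‖t‖ ^ (-(5 / 2) : ℝ) = 1 / ‖t‖ ^ 2 * ‖t‖ ^ (-1 / 2 : ℝ) := by
    rw [show (-(5 / 2) : ℝ) = -1 / 2 - 2 by norm_num, Real.rpow_sub htp, Real.rpow_two]
    ring
  have e2 : ‖t‖ ^ (-2 : ℝ) = 1 / ‖t‖ ^ 2 := by
    rw [Real.rpow_neg htp.le, Real.rpow_two, one_div]
  have ey : y ^ (-1 : ℝ) = y ^ (-1 / 2 : ℝ) * y ^ (-1 / 2 : ℝ) := by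
    rw [← Real.rpow_add hy]; norm_num
  rw [e52, e2, ey]
  have hy12 : 0 < y ^ (-1 / 2 : ℝ) := by positivity
  have ht12 : 0 < ‖t‖ ^ (-1 / 2 : ℝ) := by positivity
  have hk12 : 0 < Real.sqrt k ^ (-1 / 2 : ℝ) := by positivity
  have hty : 0 < ‖t‖ ^ 2 + y ^ 2 := by positivity
  calc _ = 1 / ‖t‖ ^ 2 * (4 * c⁻¹ * c⁻¹) *
        ((x ^ (-1 / 2 : ℝ) + y ^ (-1 / 2 : ℝ)) * (z ^ (3 / 2 : ℝ) / z ^ 4)) := by ring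
    _ ≤ 1 / ‖t‖ ^ 2 * (4 * c⁻¹ * c⁻¹) *
        ((Real.sqrt k ^ (-1 / 2 : ℝ) * ‖t‖ ^ (-1 / 2 : ℝ) + y ^ (-1 / 2 : ℝ))
          * (y ^ (-1 / 2 : ℝ) / (k * (‖t‖ ^ 2 + y ^ 2)))) := by gcongr
    _ ≤ 1 / ‖t‖ ^ 2 * (4 * c⁻¹ * c⁻¹) *
        ((Real.sqrt k ^ (-1 / 2 : ℝ) + 1) * (‖t‖ ^ (-1 / 2 : ℝ) + y ^ (-1 / 2 : ℝ))
          * (y ^ (-1 / 2 : ℝ) / (k * (‖t‖ ^ 2 + y ^ 2)))) := by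
        gcongr
        nlinarith
    _ = _ := by field_simp

theorem ae_ne_zero : ∀ᵐ t : E3, t ≠ 0 := by
  simp [ae_iff]

/-- By scaling, both radial integrals contribute a multiple of `ell ^ (-2)`, which compensates the
prefactor `s² + Q²` uniformly in `s`, `K`, `Q`. -/
theorem lambda_ne_top {m : ℝ} (hm : 0 < m) {β : ℝ} (h0 : 0 ≤ β) (h2 : β ≤ 2) :
    Lambda β m ≠ ⊤ := by
  obtain ⟨C, hC0, hC⟩ := lambdaIntegrand_le hm
  obtain ⟨C1, hC1, h1⟩ := lintegral_norm_rpow_div_le (δ := 5 / 2) (by norm_num) (by norm_num)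
  obtain ⟨C2, hC2, h2'⟩ := lintegral_norm_rpow_div_le (δ := 2) (by norm_num) (by norm_num)
  set k : ℝ := m / (m + 1) with hk
  have hkp : 0 < k := by positivity
  refine ne_top_of_le_ne_top (b := ENNReal.ofReal (k⁻¹ / (Real.pi ^ 2 * (1 + m)) * C)
    * (C1 + C2)) (by finiteness) ?_
  refine iSup_le fun s => iSup_le fun K => iSup_le fun Q => iSup_le fun hQ => ?_
  have hy := ell_pos hm s K hQ
  have hle := norm_sq_add_le_ell hm s K Q
  rw [← hk] at hle
  have hb := hC β h0 h2 s K Q hQ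
  set y := ell m s K Q
  have hpi := Real.pi_pos
  have key : ∫⁻ t, ENNReal.ofReal (LambdaIntegrand β m s K Q t)
      ≤ ENNReal.ofReal (C * y ^ (-2 : ℝ)) * (C1 + C2) := by
    calc _ ≤ ∫⁻ t : E3, ENNReal.ofReal C * (ENNReal.ofReal (y ^ (-1 / 2 : ℝ))
            * ENNReal.ofReal (‖t‖ ^ (-(5 / 2) : ℝ) / (‖t‖ ^ 2 + y ^ 2))
          + ENNReal.ofReal (y ^ (-1 : ℝ))
            * ENNReal.ofReal (‖t‖ ^ (-2 : ℝ) / (‖t‖ ^ 2 + y ^ 2))) := by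
          refine lintegral_mono_ae ?_
          filter_upwards [ae_ne_zero] with t ht
          refine (ENNReal.ofReal_le_ofReal (hb t ht)).trans_eq ?_
          rw [ENNReal.ofReal_mul hC0, ENNReal.ofReal_add (by positivity) (by positivity),
            ENNReal.ofReal_mul (by positivity), ENNReal.ofReal_mul (by positivity)]
      _ = ENNReal.ofReal C * (ENNReal.ofReal (y ^ (-1 / 2 : ℝ))
            * (C1 * ENNReal.ofReal (y ^ (1 - 5 / 2 : ℝ)))
          + ENNReal.ofReal (y ^ (-1 : ℝ)) * (C2 * ENNReal.ofReal (y ^ (1 - 2 : ℝ)))) := by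
          rw [lintegral_const_mul' _ _ ENNReal.ofReal_ne_top, lintegral_add_left (by fun_prop),
            lintegral_const_mul' _ _ ENNReal.ofReal_ne_top,
            lintegral_const_mul' _ _ ENNReal.ofReal_ne_top, h1 y hy, h2' y hy]
      _ = _ := by
          have a1 : y ^ (-2 : ℝ) = y ^ (-1 / 2 : ℝ) * y ^ (1 - 5 / 2 : ℝ) := by
            rw [← Real.rpow_add hy]; norm_num
          have a2 : y ^ (-2 : ℝ) = y ^ (-1 : ℝ) * y ^ (1 - 2 : ℝ) := by
            rw [← Real.rpow_add hy]; norm_num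
          rw [ENNReal.ofReal_mul hC0, mul_add, mul_add]
          congr 1
          · rw [a1, ENNReal.ofReal_mul (by positivity)]; ring
          · rw [a2, ENNReal.ofReal_mul (by positivity)]; ring
  refine (mul_le_mul_right key _).trans ?_
  rw [← mul_assoc, ← ENNReal.ofReal_mul (by positivity)]
  refine mul_le_mul_left (ENNReal.ofReal_le_ofReal ?_) _
  rw [Real.rpow_neg hy.le, Real.rpow_two]
  calc (‖s‖ ^ 2 + Q ^ 2) / (Real.pi ^ 2 * (1 + m)) * (C * (y ^ 2)⁻¹)
      ≤ (k⁻¹ * y ^ 2) / (Real.pi ^ 2 * (1 + m)) * (C * (y ^ 2)⁻¹) := by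
        gcongr
        rw [inv_mul_eq_div, le_div_iff₀ hkp]
        linarith
    _ = _ := by field_simp

/-- Row bound for the Schur test with weight `(|s|/|t|)^{3/2}`. The radial exponent is `5/2 - α`,
which lies in `(1, 3)` for every `α` in `[0, 1]`; scaling leaves `|s|^{3/2} ell^{-3/2}`, which is
bounded. -/
theorem lintegral_schur_weight_le {m : ℝ} (hm : 0 < m) {α : ℝ} (h0 : 0 ≤ α) (h1 : α ≤ 1) :
    ∃ C : ℝ≥0∞, C ≠ ⊤ ∧ ∀ (s K : E3) (Q : ℝ), 0 < Q →
      ENNReal.ofReal (‖s‖ ^ (3 / 2 : ℝ)) * ∫⁻ t : E3, ENNReal.ofReal (‖t‖ ^ (-(3 / 2) : ℝ)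
        * (ell m s K Q ^ (-α) * ell m t K Q ^ (α - 1)
          * (evenDen m K Q s t + oddDen m K s t)⁻¹)) ≤ C := by
  obtain ⟨C1, hC1, hJ⟩ := lintegral_norm_rpow_div_le (δ := 5 / 2 - α) (by linarith) (by linarith)
  set k : ℝ := m / (m + 1) with hk
  have hkp : 0 < k := by positivity
  set B : ℝ := Real.sqrt k ^ (α - 1) * (2 * k⁻¹ * k⁻¹) with hB
  have hBp : 0 < B := by positivity
  refine ⟨ENNReal.ofReal (B * Real.sqrt k ^ (-(3 / 2) : ℝ)) * C1, by finiteness, ?_⟩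
  intro s K Q hQ
  have hy := ell_pos hm s K hQ
  have hys := sqrt_mul_norm_le_ell hm s K Q
  rw [← hk] at hys
  have hpt : ∀ t : E3, t ≠ 0 → ‖t‖ ^ (-(3 / 2) : ℝ)
      * (ell m s K Q ^ (-α) * ell m t K Q ^ (α - 1) * (evenDen m K Q s t + oddDen m K s t)⁻¹)
      ≤ B * ell m s K Q ^ (-α) * (‖t‖ ^ (-(5 / 2 - α)) / (‖t‖ ^ 2 + ell m s K Q ^ 2)) := by
    intro t ht
    have htp : 0 < ‖t‖ := norm_pos_iff.2 ht
    have hx := ell_pos hm t K hQ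
    have hxt := sqrt_mul_norm_le_ell hm t K Q
    have hz2 := mul_sq_add_sq_le hm s t K Q
    have hX := half_ell_sq_le_evenDen hm K Q s t
    have hXp := evenDen_pos hm K hQ s t
    have hO := (abs_le.1 (abs_oddDen_le hm K Q s t)).1
    rw [← hk] at hxt hz2
    have hk1 : 1 - (1 + m)⁻¹ = k := by rw [hk]; field_simp; ring
    have hden : k * k / 2 * (‖t‖ ^ 2 + ell m s K Q ^ 2)
        ≤ evenDen m K Q s t + oddDen m K s t := by
      have : k * evenDen m K Q s t ≤ evenDen m K Q s t + oddDen m K s t := by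
        rw [← hk1]; linarith
      refine le_trans ?_ this
      rw [mul_div_assoc, mul_assoc]
      gcongr
      linarith
    have hxa : ell m t K Q ^ (α - 1) ≤ Real.sqrt k ^ (α - 1) * ‖t‖ ^ (α - 1) := by
      rw [← Real.mul_rpow (by positivity) (by positivity)]
      exact Real.rpow_le_rpow_of_nonpos (by positivity) hxt (by linarith)
    have et : ‖t‖ ^ (-(5 / 2 - α)) = ‖t‖ ^ (-(3 / 2) : ℝ) * ‖t‖ ^ (α - 1) := by
      rw [← Real.rpow_add htp]; congr 1; ring
    have hd0 : 0 < k * k / 2 * (‖t‖ ^ 2 + ell m s K Q ^ 2) := by positivity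
    have hd1 : 0 ≤ (evenDen m K Q s t + oddDen m K s t)⁻¹ :=
      inv_nonneg.2 (hd0.le.trans hden)
    calc _ ≤ ‖t‖ ^ (-(3 / 2) : ℝ) * (ell m s K Q ^ (-α)
          * (Real.sqrt k ^ (α - 1) * ‖t‖ ^ (α - 1))
          * (k * k / 2 * (‖t‖ ^ 2 + ell m s K Q ^ 2))⁻¹) := by gcongr
      _ = _ := by rw [et, hB]; field_simp
  calc _ ≤ ENNReal.ofReal (‖s‖ ^ (3 / 2 : ℝ)) * ∫⁻ t : E3,
        ENNReal.ofReal (B * ell m s K Q ^ (-α))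
          * ENNReal.ofReal (‖t‖ ^ (-(5 / 2 - α)) / (‖t‖ ^ 2 + ell m s K Q ^ 2)) := by
        refine mul_le_mul_right (lintegral_mono_ae ?_) _
        filter_upwards [ae_ne_zero] with t ht
        rw [← ENNReal.ofReal_mul (by positivity)]
        exact ENNReal.ofReal_le_ofReal (hpt t ht)
    _ = ENNReal.ofReal (‖s‖ ^ (3 / 2 : ℝ) * (B * ell m s K Q ^ (-α)
          * ell m s K Q ^ (1 - (5 / 2 - α)))) * C1 := by
        rw [lintegral_const_mul' _ _ ENNReal.ofReal_ne_top, hJ _ hy,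
          ENNReal.ofReal_mul (p := ‖s‖ ^ (3 / 2 : ℝ)) (by positivity),
          ENNReal.ofReal_mul (p := B * ell m s K Q ^ (-α)) (by positivity)]
        ring
    _ ≤ _ := by
        refine mul_le_mul_left (ENNReal.ofReal_le_ofReal ?_) _
        rw [mul_assoc B, ← Real.rpow_add hy]
        have e1 : -α + (1 - (5 / 2 - α)) = -(3 / 2) := by ring
        rw [e1, mul_left_comm]
        gcongr
        have hs : ‖s‖ ≤ Real.sqrt k ^ (-1 : ℝ) * ell m s K Q := by
          rw [Real.rpow_neg_one, inv_mul_eq_div, le_div_iff₀ (by positivity)]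
          linarith
        calc ‖s‖ ^ (3 / 2 : ℝ) * ell m s K Q ^ (-(3 / 2) : ℝ)
            ≤ (Real.sqrt k ^ (-1 : ℝ) * ell m s K Q) ^ (3 / 2 : ℝ)
              * ell m s K Q ^ (-(3 / 2) : ℝ) := by gcongr
          _ = _ := by
            rw [Real.mul_rpow (by positivity) hy.le, mul_assoc, ← Real.rpow_add hy,
              ← Real.rpow_mul (by positivity)]
            norm_num

/-! ### Coordinates and measure on configuration space. -/

theorem norm_sq_config {k : ℕ} (q : Config k) : ‖q‖ ^ 2 = ∑ i, ‖q i‖ ^ 2 :=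
  PiLp.norm_sq_eq_of_L2 _ q

/-- `(s, q) ↦ (s, q₁, …, q_n)` as a linear isometry. -/
noncomputable def consIso (n : ℕ) : WithLp 2 (E3 × Config n) ≃ₗᵢ[ℝ] Config (n + 1) where
  toFun x := cons x.fst x.snd.ofLp
  invFun p := WithLp.toLp 2 (p 0, WithLp.toLp 2 fun i => p i.succ)
  left_inv x := by
    simp only [cons, Fin.cons_zero, Fin.cons_succ]
    rfl
  right_inv p := by
    ext i : 1
    refine Fin.cases ?_ (fun j => ?_) i <;> simp [cons]
  map_add' x y := by
    ext i : 1
    refine Fin.cases ?_ (fun j => ?_) i <;> simp [cons]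
  map_smul' c x := by
    ext i : 1
    refine Fin.cases ?_ (fun j => ?_) i <;> simp [cons]
  norm_map' x := by
    refine (sq_eq_sq₀ (norm_nonneg _) (norm_nonneg _)).1 ?_
    rw [WithLp.prod_norm_sq_eq_of_L2, norm_sq_config x.snd]
    exact (norm_sq_config _).trans (Fin.sum_univ_succ _)

theorem measurable_toLp_config (k : ℕ) :
    Measurable (WithLp.toLp 2 : (Fin k → E3) → Config k) :=
  (PiLp.continuous_toLp 2 _).measurable

theorem measurePreserving_cons_of {n : ℕ}
    (h : MeasurePreserving (WithLp.toLp 2 : (Fin n → E3) → Config n)) :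
    MeasurePreserving (fun z : E3 × (Fin n → E3) => cons z.1 z.2) := by
  have h1 : MeasurePreserving (fun z : E3 × (Fin n → E3) =>
      (z.1, (WithLp.toLp 2 z.2 : Config n))) :=
    (MeasurePreserving.id volume).prod h
  exact (consIso n).measurePreserving.comp ((WithLp.volume_preserving_toLp E3 (Config n)).comp h1)

/-- The Euclidean volume agrees with the product measure: induction on `k`, splitting off one
variable by the isometry `consIso`. For `k = 0` both are the Dirac mass. -/
theorem measurePreserving_toLp (k : ℕ) :
    MeasurePreserving (WithLp.toLp 2 : (Fin k → E3) → Config k) := by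
  induction k with
  | zero =>
    refine ⟨measurable_toLp_config 0, ?_⟩
    let e : EuclideanSpace ℝ (Fin 0) ≃ₗᵢ[ℝ] Config 0 :=
      { toLinearEquiv := LinearEquiv.ofFinrankEq _ _ 
          (by rw [Module.finrank_zero_of_subsingleton, Module.finrank_zero_of_subsingleton])
        norm_map' := fun x => by simp [Subsingleton.elim x 0] }
    rw [← e.measurePreserving.map_eq, volume_euclideanSpace_eq_dirac, Measure.volume_pi_eq_dirac 0,
      Measure.map_dirac, Measure.map_dirac]
    exact congrArg Measure.dirac (Subsingleton.elim _ _)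
  | succ n ih =>
    have h := (volume_preserving_piFinSuccAbove (fun _ : Fin (n + 1) => E3) 0)
    have h2 := (measurePreserving_cons_of ih).comp h
    convert h2 using 1
    funext x
    ext i : 1
    refine Fin.cases ?_ (fun j => ?_) i <;> simp [cons, MeasurableEquiv.piFinSuccAbove]

theorem measurePreserving_cons (n : ℕ) :
    MeasurePreserving (fun z : E3 × (Fin n → E3) => cons z.1 z.2) :=
  measurePreserving_cons_of (measurePreserving_toLp n)

theorem measurable_cons (n : ℕ) : Measurable (fun z : E3 × (Fin n → E3) => cons z.1 z.2) :=
  (measurePreserving_cons n).measurable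

/-- `permute σ` as a linear isometry. -/
noncomputable def permuteIso {k : ℕ} (σ : Equiv.Perm (Fin k)) : Config k ≃ₗᵢ[ℝ] Config k where
  toFun := permute σ
  invFun := permute σ⁻¹
  left_inv x := by ext i : 1; simp [permute]
  right_inv x := by ext i : 1; simp [permute]
  map_add' x y := by ext i : 1; simp [permute]
  map_smul' c x := by ext i : 1; simp [permute]
  norm_map' x := by
    refine (sq_eq_sq₀ (norm_nonneg _) (norm_nonneg _)).1 ?_
    rw [norm_sq_config, norm_sq_config]
    exact Equiv.sum_comp σ fun i => ‖x i‖ ^ 2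

theorem measurePreserving_permute {k : ℕ} (σ : Equiv.Perm (Fin k)) :
    MeasurePreserving (permute σ : Config k → Config k) := (permuteIso σ).measurePreserving

/-! ### Symmetry and size of the symbol `L`. -/

theorem L_sq_sum {k : ℕ} (m μ : ℝ) (q : Config k) :
    L m μ q = 2 * Real.pi ^ 2 * Real.sqrt (m * (m + 2) / (m + 1) ^ 2 * ∑ i, ‖q i‖ ^ 2
      + 2 * m / (m + 1) ^ 2 * ((‖∑ i, q i‖ ^ 2 - ∑ i, ‖q i‖ ^ 2) / 2) + μ) := by
  rw [L, sum_inner_Ioi]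

theorem L_permute {k : ℕ} (m μ : ℝ) (σ : Equiv.Perm (Fin k)) (q : Config k) :
    L m μ (permute σ q) = L m μ q := by
  rw [L_sq_sum, L_sq_sum]
  have h1 : ∑ i, ‖permute σ q i‖ ^ 2 = ∑ i, ‖q i‖ ^ 2 := Equiv.sum_comp σ fun i => ‖q i‖ ^ 2
  have h2 : ∑ i, permute σ q i = ∑ i, q i := Equiv.sum_comp σ fun i => q i
  rw [h1, h2]

theorem continuous_L {k : ℕ} (m μ : ℝ) : Continuous (L m μ : Config k → ℝ) := by
  unfold L; fun_prop

theorem L_eq_sqrt {k : ℕ} {m : ℝ} (hm : 0 < m) (μ : ℝ) (q : Config k) :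
    L m μ q = 2 * Real.pi ^ 2 * Real.sqrt (m / (m + 1) * ‖q‖ ^ 2
      + m / (m + 1) ^ 2 * ‖∑ i, q i‖ ^ 2 + μ) := by
  rw [L_sq_sum, norm_sq_config q]
  congr 2
  field_simp
  ring

theorem L_pos {k : ℕ} {m μ : ℝ} (hm : 0 < m) (hμ : 0 < μ) (q : Config k) : 0 < L m μ q := by
  rw [L_eq_sqrt hm]
  have := Real.pi_pos
  positivity

theorem norm_sum_sq_le {k : ℕ} (q : Config k) : ‖∑ i, q i‖ ^ 2 ≤ k * ‖q‖ ^ 2 := by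
  rw [norm_sq_config q]
  have h1 : ‖∑ i, q i‖ ≤ ∑ i, ‖q i‖ := norm_sum_le _ _
  have h2 := sq_sum_le_card_mul_sum_sq (s := Finset.univ) (f := fun i => ‖q i‖)
  simp only [Finset.card_univ, Fintype.card_fin] at h2
  exact (pow_le_pow_left₀ (norm_nonneg _) h1 2).trans h2

/-- `L` is comparable with the Bessel weight. -/
theorem exists_L_bounds (k : ℕ) {m μ : ℝ} (hm : 0 < m) (hμ : 0 < μ) :
    ∃ a b : ℝ, 0 < a ∧ 0 < b ∧ ∀ q : Config k,
      a * (1 + ‖(2 * Real.pi)⁻¹ • q‖ ^ 2) ^ (1 / 2 : ℝ) ≤ L m μ q ∧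
      L m μ q ≤ b * (1 + ‖(2 * Real.pi)⁻¹ • q‖ ^ 2) ^ (1 / 2 : ℝ) := by
  have hpi := Real.pi_pos
  set c := (2 * Real.pi)⁻¹ ^ 2 with hc
  have hcp : 0 < c := by positivity
  set a0 := min (m / (m + 1) / c) μ
  set b0 := max ((m / (m + 1) + m / (m + 1) ^ 2 * k) / c) μ
  have ha0 : 0 < a0 := by positivity
  have hb0 : 0 < b0 := lt_max_of_lt_right hμ
  refine ⟨2 * Real.pi ^ 2 * Real.sqrt a0, 2 * Real.pi ^ 2 * Real.sqrt b0, by positivity,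
    by positivity, fun q => ?_⟩
  rw [L_eq_sqrt hm, ← Real.sqrt_eq_rpow, mul_assoc _ (√a0), mul_assoc _ (√b0),
    ← Real.sqrt_mul ha0.le,
    ← Real.sqrt_mul hb0.le, norm_smul, mul_pow, Real.norm_of_nonneg (by positivity), ← hc]
  have hs := norm_sum_sq_le q
  have e1 : a0 * c ≤ m / (m + 1) := (le_div_iff₀ hcp).1 (min_le_left _ _)
  have e2 : a0 ≤ μ := min_le_right _ _
  have e3 : m / (m + 1) + m / (m + 1) ^ 2 * k ≤ b0 * c := (div_le_iff₀ hcp).1 (le_max_left _ _)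
  have e4 : μ ≤ b0 := le_max_right _ _
  have f1 := mul_le_mul_of_nonneg_right e1 (sq_nonneg ‖q‖)
  have f3 := mul_le_mul_of_nonneg_right e3 (sq_nonneg ‖q‖)
  have f4 : 0 ≤ m / (m + 1) ^ 2 * ‖∑ i, q i‖ ^ 2 := by positivity
  have f5 : m / (m + 1) ^ 2 * ‖∑ i, q i‖ ^ 2 ≤ m / (m + 1) ^ 2 * (k * ‖q‖ ^ 2) := by gcongr
  constructor
  · gcongr
    linarith
  · gcongr
    linarith

/-! ### Fourier transform, antisymmetry and Sobolev spaces. -/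

theorem memLp_two_iff {X : Type*} [MeasurableSpace X] {ν : Measure X} {f : X → ℂ}
    (hf : AEStronglyMeasurable f ν) : MemLp f 2 ν ↔ ∫⁻ x, ‖f x‖ₑ ^ 2 ∂ν < ⊤ := by
  have h := eLpNorm_lt_top_iff_lintegral_rpow_enorm_lt_top (f := f) (μ := ν) (p := 2)
    two_ne_zero ENNReal.ofNat_ne_top
  simp only [ENNReal.toReal_ofNat, ENNReal.rpow_ofNat] at h
  rw [← h]
  exact ⟨fun h => h.2, fun h => ⟨hf, h⟩⟩

theorem enorm_sq_eq_lintegral {k : ℕ} (ξ : L2 k) : ‖ξ‖ₑ ^ 2 = ∫⁻ x, ‖ξ x‖ₑ ^ 2 := by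
  rw [Lp.enorm_def, eLpNorm_eq_lintegral_rpow_enorm_toReal two_ne_zero ENNReal.ofNat_ne_top,
    ← ENNReal.rpow_natCast, ← ENNReal.rpow_mul]
  simp

theorem quasiMeasurePreserving_smul {k : ℕ} {c : ℝ} (hc : c ≠ 0) :
    Measure.QuasiMeasurePreserving (fun p : Config k => c • p) volume volume := by
  refine ⟨measurable_const_smul c, ?_⟩
  rw [Measure.map_addHaar_smul volume hc]
  exact Measure.smul_absolutelyContinuous

theorem measurable_hat {k : ℕ} (ξ : L2 k) : Measurable (hat ξ) := by
  have h : Measurable (𝓕 ξ : L2 k) := (Lp.stronglyMeasurable _).measurable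
  exact (h.comp (measurable_const_smul (2 * Real.pi)⁻¹)).const_mul _

theorem finrank_config (k : ℕ) : Module.finrank ℝ (Config k) = 3 * k := by
  have := (WithLp.linearEquiv 2 ℝ (Fin k → E3)).finrank_eq
  rw [this, Module.finrank_pi_fintype]
  simp [mul_comm]

theorem two_pi_rpow_sq (k : ℕ) : ((2 * Real.pi) ^ (-(3 * (k : ℝ)) / 2)) ^ 2
    = ((2 * Real.pi)⁻¹) ^ (3 * k) := by
  have : 0 < 2 * Real.pi := by have := Real.pi_pos; positivity
  rw [← Real.rpow_mul_natCast this.le, inv_pow, ← Real.rpow_natCast (2 * Real.pi) (3 * k),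
    ← Real.rpow_neg this.le]
  congr 1
  push_cast
  ring

theorem integral_conj_hat_comp_smul {k : ℕ} (F F' : Config k → ℂ) :
    ∫ p, conj ((((2 * Real.pi) ^ (-(3 * (k : ℝ)) / 2) : ℝ) : ℂ) * F ((2 * Real.pi)⁻¹ • p))
        * ((((2 * Real.pi) ^ (-(3 * (k : ℝ)) / 2) : ℝ) : ℂ) * F' ((2 * Real.pi)⁻¹ • p))
      = ∫ x, conj (F x) * F' x := by
  have h2 : 0 < (2 * Real.pi)⁻¹ := by have := Real.pi_pos; positivity
  have e := two_pi_rpow_sq k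
  generalize (2 * Real.pi) ^ (-(3 * (k : ℝ)) / 2) = κ at *
  have e1 : ∀ p, conj ((κ : ℂ) * F ((2 * Real.pi)⁻¹ • p)) * (κ * F' ((2 * Real.pi)⁻¹ • p))
      = ((κ ^ 2 : ℝ) : ℂ) * (fun x => conj (F x) * F' x) ((2 * Real.pi)⁻¹ • p) := by
    intro p
    rw [map_mul, Complex.conj_ofReal, Complex.ofReal_pow]
    ring
  simp_rw [e1]
  rw [integral_const_mul, Measure.integral_comp_smul_of_nonneg volume
    (fun x => conj (F x) * F' x) _ (hR := h2.le), finrank_config, e, Complex.real_smul,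
    ← mul_assoc, ← Complex.ofReal_mul, mul_inv_cancel₀ (by positivity), Complex.ofReal_one, one_mul]

theorem inner_eq_integral {k : ℕ} (ζ η : L2 k) : inner ℂ ζ η = ∫ x, conj (ζ x) * η x := by
  rw [L2.inner_def]
  refine integral_congr_ae (Filter.Eventually.of_forall fun x => ?_)
  simp only [RCLike.inner_apply, mul_comm]

theorem integral_conj_hat_mul_hat {k : ℕ} (ζ η : L2 k) :
    ∫ p, conj (hat ζ p) * hat η p = inner ℂ ζ η := by
  have h : inner ℂ ζ η = inner ℂ (𝓕 ζ : L2 k) (𝓕 η : L2 k) := (Lp.inner_fourier_eq ζ η).symm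
  rw [h, inner_eq_integral]
  exact integral_conj_hat_comp_smul (𝓕 ζ : L2 k) (𝓕 η : L2 k)

theorem lintegral_enorm_hat_sq {k : ℕ} (ξ : L2 k) : ∫⁻ p, ‖hat ξ p‖ₑ ^ 2 = ‖ξ‖ₑ ^ 2 := by
  have h2 : 0 < (2 * Real.pi)⁻¹ := by have := Real.pi_pos; positivity
  have e : ‖ξ‖ₑ = ‖(𝓕 ξ : L2 k)‖ₑ := by
    rw [← ofReal_norm, ← ofReal_norm, Lp.norm_fourier_eq]
  rw [e, enorm_sq_eq_lintegral,
    lintegral_eq_mul_lintegral_comp_smul h2 fun x => ‖(𝓕 ξ : L2 k) x‖ₑ ^ 2, finrank_config,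
    ← two_pi_rpow_sq, ← lintegral_const_mul' _ _ ENNReal.ofReal_ne_top]
  refine lintegral_congr fun p => ?_
  rw [hat, enorm_mul, mul_pow]
  congr 1
  have := Real.pi_pos
  rw [ENNReal.ofReal_pow (by positivity), ← ofReal_norm, Complex.norm_real,
    Real.norm_of_nonneg (by positivity)]

theorem memLp_hat {k : ℕ} (ξ : L2 k) : MemLp (hat ξ) 2 := by
  rw [memLp_two_iff (measurable_hat ξ).aestronglyMeasurable, lintegral_enorm_hat_sq]
  finiteness

theorem exists_hat_eq {k : ℕ} {u : Config k → ℂ} (hu : MemLp u 2) :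
    ∃ ξ : L2 k, hat ξ =ᵐ[volume] u := by
  have hpi := Real.pi_pos
  set κ : ℝ := (2 * Real.pi) ^ (-(3 * (k : ℝ)) / 2) with hκ
  have hκp : 0 < κ := by positivity
  have hv : MemLp (fun x : Config k => ((κ⁻¹ : ℝ) : ℂ) * u ((2 * Real.pi) • x)) 2 := by
    have hm : AEStronglyMeasurable (fun x : Config k => ((κ⁻¹ : ℝ) : ℂ) * u ((2 * Real.pi) • x)) :=
      (hu.1.comp_quasiMeasurePreserving
        (quasiMeasurePreserving_smul (c := 2 * Real.pi) (by positivity))).const_mul _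
    rw [memLp_two_iff hm]
    rw [memLp_two_iff hu.1, lintegral_eq_mul_lintegral_comp_smul
      (R := 2 * Real.pi) (by positivity)] at hu
    simp_rw [enorm_mul, mul_pow]
    rw [lintegral_const_mul' _ _ (by finiteness)]
    refine ENNReal.mul_lt_top (by finiteness) ?_
    refine ENNReal.lt_top_of_mul_ne_top_right hu.ne ?_
    rw [ne_eq, ENNReal.ofReal_eq_zero, not_le]
    positivity
  refine ⟨𝓕⁻ hv.toLp, ?_⟩
  have h := (quasiMeasurePreserving_smul (k := k) (c := (2 * Real.pi)⁻¹)
    (by positivity)).ae hv.coeFn_toLp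
  filter_upwards [h] with p hp
  rw [hat, FourierTransform.fourier_fourierInv_eq, hp, ← hκ, ← mul_assoc, ← Complex.ofReal_mul,
    mul_inv_cancel₀ hκp.ne', smul_smul, mul_inv_cancel₀ (by positivity)]
  simp

theorem eq_zero_of_hat {k : ℕ} {ξ : L2 k} (h : hat ξ =ᵐ[volume] 0) : ξ = 0 := by
  have h1 := lintegral_enorm_hat_sq ξ
  have h2 : ∫⁻ p, ‖hat ξ p‖ₑ ^ 2 = 0 := by
    rw [lintegral_congr_ae (h.mono fun p hp => by rw [hp])]
    simp
  rw [h2] at h1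
  simpa using h1.symm

/-- Permutations are linear isometries, so the identity holds for Schwartz functions; it extends by
density and continuity. -/
theorem fourier_compMeasurePreserving {k : ℕ} (σ : Equiv.Perm (Fin k)) (ξ : L2 k) :
    𝓕 (Lp.compMeasurePreserving (permute σ) (measurePreserving_permute σ) ξ)
      = Lp.compMeasurePreserving (permute σ) (measurePreserving_permute σ) (𝓕 ξ) := by
  let p : L2 k → Prop := fun ξ =>
    𝓕 (Lp.compMeasurePreserving (permute σ) (measurePreserving_permute σ) ξ)
      = Lp.compMeasurePreserving (permute σ) (measurePreserving_permute σ) (𝓕 ξ)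
  have hc : Continuous (Lp.compMeasurePreserving (E := ℂ) (p := 2) (permute σ)
      (measurePreserving_permute (k := k) σ)) :=
    (Lp.isometry_compMeasurePreserving (measurePreserving_permute σ)).continuous
  have hF : Continuous (𝓕 : L2 k → L2 k) := (Lp.fourierTransformₗᵢ (Config k) ℂ).continuous
  refine DenseRange.induction_on (p := p)
    (SchwartzMap.denseRange_toLpCLM (E := Config k) (F := ℂ) (p := 2) ENNReal.ofNat_ne_top) ξ
    (isClosed_eq (hF.comp hc) (hc.comp hF)) fun f => ?_
  have key : ∀ f : 𝓢(Config k, ℂ),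
      Lp.compMeasurePreserving (permute σ) (measurePreserving_permute σ) (f.toLp 2)
        = (SchwartzMap.compCLMOfContinuousLinearEquiv ℂ
            (permuteIso σ).toContinuousLinearEquiv f).toLp 2 := by
    intro f
    apply Lp.ext
    refine (Lp.coeFn_compMeasurePreserving _ _).trans ?_
    refine Filter.EventuallyEq.trans ?_ (SchwartzMap.coeFn_toLp _ _ _).symm
    exact (measurePreserving_permute σ).quasiMeasurePreserving.ae_eq_comp
      (SchwartzMap.coeFn_toLp f 2 volume)
  simp only [p, SchwartzMap.toLpCLM_apply]
  rw [key, SchwartzMap.toLp_fourier_eq, SchwartzMap.toLp_fourier_eq, key]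
  congr 1
  ext w
  rw [SchwartzMap.fourier_coe]
  exact Real.fourier_comp_linearIsometry (permuteIso σ) f w

theorem antisymm_iff_comp {k : ℕ} (ξ : L2 k) : Antisymm (ξ : Config k → ℂ) ↔
    ∀ σ : Equiv.Perm (Fin k), Lp.compMeasurePreserving (permute σ) (measurePreserving_permute σ) ξ
      = ((Equiv.Perm.sign σ : ℤ) : ℂ) • ξ := by
  refine forall_congr' fun σ => ?_
  rw [Lp.ext_iff]
  have h1 := Lp.coeFn_compMeasurePreserving ξ (measurePreserving_permute σ)
  have h2 := Lp.coeFn_smul ((Equiv.Perm.sign σ : ℤ) : ℂ) ξ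
  constructor
  · intro h
    exact h1.trans (h.trans h2.symm)
  · intro h
    exact h1.symm.trans (h.trans h2)

theorem antisymm_fourier_iff {k : ℕ} (ξ : L2 k) :
    Antisymm ((𝓕 ξ : L2 k) : Config k → ℂ) ↔ Antisymm (ξ : Config k → ℂ) := by
  rw [antisymm_iff_comp, antisymm_iff_comp]
  refine forall_congr' fun σ => ?_
  rw [← fourier_compMeasurePreserving, ← FourierTransform.fourier_smul]
  exact (Lp.fourierTransformₗᵢ (Config k) ℂ).injective.eq_iff

theorem permute_smul {k : ℕ} (σ : Equiv.Perm (Fin k)) (c : ℝ) (x : Config k) :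
    permute σ (c • x) = c • permute σ x := (permuteIso σ).map_smul c x

theorem antisymm_hat_iff {k : ℕ} (ξ : L2 k) :
    Antisymm (hat ξ) ↔ Antisymm (ξ : Config k → ℂ) := by
  have hpi := Real.pi_pos
  rw [← antisymm_fourier_iff]
  refine forall_congr' fun σ => ?_
  set κ : ℝ := (2 * Real.pi) ^ (-(3 * (k : ℝ)) / 2) with hκ
  have hκp : (κ : ℂ) ≠ 0 := by
    have : 0 < κ := by positivity
    exact_mod_cast this.ne'
  constructor
  · intro h
    have h' := (quasiMeasurePreserving_smul (k := k) (c := 2 * Real.pi) (by positivity)).ae h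
    filter_upwards [h'] with x hx
    simp only [hat, permute_smul, smul_smul, ← hκ] at hx
    rw [inv_mul_cancel₀ (by positivity), one_smul, one_smul, mul_left_comm] at hx
    exact mul_left_cancel₀ hκp hx
  · intro h
    have h' := (quasiMeasurePreserving_smul (k := k) (c := (2 * Real.pi)⁻¹) (by positivity)).ae h
    filter_upwards [h'] with x hx
    simp only [hat, ← permute_smul, hx]
    ring

theorem Antisymm.congr {k : ℕ} {f g : Config k → ℂ} (hf : Antisymm f) (h : f =ᵐ[volume] g) :
    Antisymm g := fun σ => by
  have h1 := (measurePreserving_permute σ).quasiMeasurePreserving.ae h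
  filter_upwards [hf σ, h1, h] with x h1 h2 h3
  rw [← h2, h1, h3]

theorem Antisymm.mul_left {k : ℕ} {f g : Config k → ℂ} (hg : Antisymm g)
    (hf : ∀ σ x, f (permute σ x) = f x) : Antisymm fun x => f x * g x := fun σ => by
  filter_upwards [hg σ] with x hx
  simp only [hf, hx]
  ring

/-- The Bessel weight `w` and its inverse `w'` act as mutually inverse multipliers on tempered
distributions. As `w'` is bounded for `r ≥ 0`, its action agrees with multiplication on `L²`, and
`L²` embeds injectively. -/
theorem memSobolev_iff_memLp {k : ℕ} {r : ℝ} (hr : 0 ≤ r) (ξ : L2 k) :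
    TemperedDistribution.MemSobolev r 2 (ξ : 𝓢'(Config k, ℂ)) ↔
      MemLp (fun x => (((1 + ‖x‖ ^ 2) ^ (r / 2) : ℝ) : ℂ) * (𝓕 ξ : L2 k) x) 2 := by
  rw [TemperedDistribution.memSobolev_iff_exists_smulLeftCLM_fourier,
    Lp.fourier_toTemperedDistribution_eq]
  set w : Config k → ℂ := fun x => (((1 + ‖x‖ ^ 2) ^ (r / 2) : ℝ) : ℂ) with hw
  set w' : Config k → ℂ := fun x => (((1 + ‖x‖ ^ 2) ^ (-r / 2) : ℝ) : ℂ) with hw'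
  have gw : w.HasTemperateGrowth := by rw [hw]; fun_prop
  have gw' : w'.HasTemperateGrowth := by rw [hw']; fun_prop
  have hmul : ∀ x, w x * w' x = 1 := by
    intro x
    simp only [hw, hw']
    rw [← Complex.ofReal_mul, ← Real.rpow_add (by positivity), neg_div, add_neg_cancel,
      Real.rpow_zero, Complex.ofReal_one]
  have hb : MemLp w' ⊤ (volume : Measure (Config k)) := by
    refine memLp_top_of_bound gw'.1.continuous.aestronglyMeasurable 1
      (Filter.Eventually.of_forall fun x => ?_)
    simp only [hw']
    rw [Complex.norm_real, Real.norm_of_nonneg (by positivity)]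
    exact Real.rpow_le_one_of_one_le_of_nonpos (by nlinarith [sq_nonneg ‖x‖]) (by linarith)
  have hsm : ∀ f : L2 k, ((hb.toLp _ • f : L2 k) : 𝓢'(Config k, ℂ))
      = TemperedDistribution.smulLeftCLM ℂ w' (f : 𝓢'(Config k, ℂ)) := fun f =>
    Lp.toTemperedDistribution_smul_eq gw' hb f
  have hco : ∀ f : L2 k, (hb.toLp _ • f : L2 k) =ᵐ[volume] fun x => w' x * f x := by
    intro f
    filter_upwards [Lp.coeFn_lpSMul (r := 2) (hb.toLp _) f, hb.coeFn_toLp] with x h1 h2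
    rw [h1, Pi.smul_apply', h2, smul_eq_mul]
  have hww : w * w' = fun _ => 1 := funext hmul
  have hww' : w' * w = fun _ => 1 := by rw [mul_comm, hww]
  have hinv : ∀ T : 𝓢'(Config k, ℂ), TemperedDistribution.smulLeftCLM ℂ w
      (TemperedDistribution.smulLeftCLM ℂ w' T) = T := fun T => by
    rw [TemperedDistribution.smulLeftCLM_smulLeftCLM_apply gw' gw]
    simp [hww']
  have hinv' : ∀ T : 𝓢'(Config k, ℂ), TemperedDistribution.smulLeftCLM ℂ w'
      (TemperedDistribution.smulLeftCLM ℂ w T) = T := fun T => by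
    rw [TemperedDistribution.smulLeftCLM_smulLeftCLM_apply gw gw']
    simp [hww]
  constructor
  · rintro ⟨f', hf'⟩
    have h1 : ((𝓕 ξ : L2 k) : 𝓢'(Config k, ℂ)) = ((hb.toLp _ • f' : L2 k) : 𝓢'(Config k, ℂ)) := by
      rw [hsm, ← hf', hinv']
    have h2 : (𝓕 ξ : L2 k) = (hb.toLp _ • f' : L2 k) :=
      LinearMap.ker_eq_bot.1 (Lp.ker_toTemperedDistributionCLM_eq_bot (F := ℂ)
        (μ := (volume : Measure (Config k))) (p := 2)) h1
    refine (Lp.memLp f').ae_eq ?_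
    filter_upwards [hco f'] with x hx
    rw [h2, hx, ← mul_assoc, hmul, one_mul]
  · intro h
    refine ⟨h.toLp _, ?_⟩
    have h2 : (𝓕 ξ : L2 k) = (hb.toLp _ • h.toLp _ : L2 k) := by
      apply Lp.ext
      filter_upwards [hco (h.toLp _), h.coeFn_toLp] with x hx hx2
      rw [hx, hx2, ← mul_assoc, mul_comm (w' x), hmul, one_mul]
    have h3 := congrArg (fun f : L2 k => TemperedDistribution.smulLeftCLM ℂ w
      (f : 𝓢'(Config k, ℂ))) h2
    refine h3.trans ?_
    simp only [hsm, hinv]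

theorem lpowNormSq_comp {k : ℕ} (m μ r : ℝ) (ξ : L2 k) :
    LpowNormSq m μ r (hat ξ) = ENNReal.ofReal ((2 * Real.pi) ^ (-(3 * (k : ℝ)) / 2)) ^ 2
      * ∫⁻ p : Config k, ‖((L m μ p ^ r : ℝ) : ℂ) * (𝓕 ξ : L2 k) ((2 * Real.pi)⁻¹ • p)‖ₑ ^ 2 := by
  have := Real.pi_pos
  rw [LpowNormSq, ← lintegral_const_mul' _ _ (by finiteness)]
  refine lintegral_congr fun p => ?_
  simp only [hat, enorm_mul, mul_pow]
  rw [← ofReal_norm (((2 * Real.pi) ^ (-(3 * (k : ℝ)) / 2) : ℝ) : ℂ), Complex.norm_real,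
    Real.norm_of_nonneg (by positivity)]
  ring

theorem enorm_ofReal_of_nonneg {x : ℝ} (hx : 0 ≤ x) : ‖(x : ℂ)‖ₑ = ENNReal.ofReal x := by
  rw [← ofReal_norm, Complex.norm_real, Real.norm_of_nonneg hx]

/-- By `exists_L_bounds`, `L ^ r` and the Bessel weight of order `r` are comparable after rescaling
the momentum by `2π`, so they give the same finiteness condition. -/
theorem memSobolev_iff {k : ℕ} {m μ r : ℝ} (hm : 0 < m) (hμ : 0 < μ) (hr : 0 ≤ r) (ξ : L2 k) :
    TemperedDistribution.MemSobolev r 2 (ξ : 𝓢'(Config k, ℂ)) ↔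
      LpowNormSq m μ r (hat ξ) < ⊤ := by
  have hpi := Real.pi_pos
  have hmeas : AEStronglyMeasurable
      (fun x => (((1 + ‖x‖ ^ 2) ^ (r / 2) : ℝ) : ℂ) * (𝓕 ξ : L2 k) x) volume := by
    refine AEStronglyMeasurable.mul ?_ (Lp.aestronglyMeasurable _)
    exact (Measurable.aestronglyMeasurable (by fun_prop))
  rw [memSobolev_iff_memLp hr, memLp_two_iff hmeas, lpowNormSq_comp]
  have hκ : ENNReal.ofReal ((2 * Real.pi) ^ (-(3 * (k : ℝ)) / 2)) ^ 2 ≠ 0 := by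
    refine pow_ne_zero _ ?_
    rw [ne_eq, ENNReal.ofReal_eq_zero, not_le]
    positivity
  have hc : ENNReal.ofReal ((2 * Real.pi)⁻¹ ^ Module.finrank ℝ (Config k)) ≠ 0 := by
    rw [ne_eq, ENNReal.ofReal_eq_zero, not_le]
    positivity
  rw [lintegral_eq_mul_lintegral_comp_smul (R := (2 * Real.pi)⁻¹) (by positivity)]
  obtain ⟨a, b, ha, hb, hab⟩ := exists_L_bounds k hm hμ
  have hw : ∀ p : Config k, (1 + ‖(2 * Real.pi)⁻¹ • p‖ ^ 2) ^ (r / 2)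
      = ((1 + ‖(2 * Real.pi)⁻¹ • p‖ ^ 2) ^ (1 / 2 : ℝ)) ^ r := by
    intro p
    rw [← Real.rpow_mul (by positivity)]; congr 1; ring
  constructor
  · intro h
    refine ENNReal.mul_lt_top (by finiteness) ?_
    have h1 := ENNReal.lt_top_of_mul_ne_top_right h.ne hc
    have h2 := ENNReal.mul_lt_top (a := ENNReal.ofReal (b ^ r) ^ 2) (by finiteness) h1
    rw [← lintegral_const_mul' _ _ (by finiteness)] at h2
    refine lt_of_le_of_lt (lintegral_mono fun p => ?_) h2
    have hLp := (L_pos hm hμ p).le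
    rw [enorm_mul, enorm_mul, ← mul_pow, ← mul_assoc,
      enorm_ofReal_of_nonneg (by positivity), enorm_ofReal_of_nonneg (by positivity),
      ← ENNReal.ofReal_mul (by positivity), hw, ← Real.mul_rpow hb.le (by positivity)]
    gcongr
    exact (hab p).2
  · intro h
    refine ENNReal.mul_lt_top (by finiteness) ?_
    have h1 := ENNReal.lt_top_of_mul_ne_top_right h.ne hκ
    have h2 := ENNReal.mul_lt_top (a := ENNReal.ofReal ((a ^ r)⁻¹) ^ 2) (by finiteness) h1
    rw [← lintegral_const_mul' _ _ (by finiteness)] at h2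
    refine lt_of_le_of_lt (lintegral_mono fun p => ?_) h2
    have hLp := (L_pos hm hμ p).le
    rw [enorm_mul, enorm_mul, ← mul_pow, ← mul_assoc,
      enorm_ofReal_of_nonneg (by positivity), enorm_ofReal_of_nonneg (by positivity),
      ← ENNReal.ofReal_mul (by positivity), hw]
    gcongr
    rw [le_inv_mul_iff₀ (by positivity), ← Real.mul_rpow ha.le (by positivity)]
    gcongr
    exact (hab p).1

theorem mem_Has_iff {k : ℕ} {m μ r : ℝ} (hm : 0 < m) (hμ : 0 < μ) (hr : 0 ≤ r) (ξ : L2 k) :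
    ξ ∈ Has k r ↔ Antisymm (hat ξ) ∧ LpowNormSq m μ r (hat ξ) < ⊤ := by
  rw [antisymm_hat_iff, ← memSobolev_iff hm hμ hr]
  rfl

theorem Has_mono {k : ℕ} {r r' : ℝ} (h : r' ≤ r) : Has k r ⊆ Has k r' :=
  fun _ hξ => ⟨hξ.1, hξ.2.mono h⟩

/-! ### The off-diagonal integral and the Schur test for its boundedness. -/

/-- The integration domain of the off-diagonal form. -/
abbrev Omega (n : ℕ) : Type := E3 × E3 × (Fin n → E3)

/-- `(s, t, q) ↦ (s, q)`. -/
noncomputable def left {n : ℕ} (x : Omega n) : Config (n + 1) := cons x.1 x.2.2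

/-- `(s, t, q) ↦ (t, q)`. -/
noncomputable def right {n : ℕ} (x : Omega n) : Config (n + 1) := cons x.2.1 x.2.2

/-- `(s, t, q) ↦ (t, s, q)`. -/
def swap {n : ℕ} (x : Omega n) : Omega n := (x.2.1, x.1, x.2.2)

/-- `G(s, t, q)`. -/
noncomputable def GG {n : ℕ} (m μ : ℝ) (x : Omega n) : ℝ :=
  G m μ (Fin.cons x.1 (Fin.cons x.2.1 x.2.2 : Fin (n + 1) → E3) : Fin (n + 2) → E3)

/-- The even part of the denominator of `G(s, t, q)`. -/
noncomputable def XX {n : ℕ} (m μ : ℝ) (x : Omega n) : ℝ :=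
  evenDen m (∑ i, x.2.2 i) (effQ m μ x.2.2) x.1 x.2.1

/-- The odd part of the denominator of `G(s, t, q)`. -/
noncomputable def BB {n : ℕ} (m : ℝ) (x : Omega n) : ℝ := oddDen m (∑ i, x.2.2 i) x.1 x.2.1

section omega

variable {n : ℕ}

theorem measurable_left : Measurable (left : Omega n → _) :=
  (measurable_cons n).comp (by fun_prop : Measurable fun x : Omega n => (x.1, x.2.2))

theorem measurable_right : Measurable (right : Omega n → _) :=
  (measurable_cons n).comp (by fun_prop : Measurable fun x : Omega n => (x.2.1, x.2.2))

theorem measurePreserving_swap : MeasurePreserving (swap : Omega n → Omega n) := by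
  have h1 := (measurePreserving_prodAssoc (volume : Measure E3) (volume : Measure E3)
    (volume : Measure (Fin n → E3)))
  have h2 : MeasurePreserving (Prod.map Prod.swap id : (E3 × E3) × (Fin n → E3) → _)
      (((volume : Measure E3).prod volume).prod volume)
      (((volume : Measure E3).prod volume).prod volume) :=
    Measure.measurePreserving_swap.prod (MeasurePreserving.id _)
  exact (h1.comp h2).comp h1.symm

theorem measurable_swap : Measurable (swap : Omega n → Omega n) := measurePreserving_swap.measurable

theorem measurableEmbedding_swap : MeasurableEmbedding (swap : Omega n → Omega n) :=
  (MeasurableEquiv.mk ⟨swap, swap, fun _ => rfl, fun _ => rfl⟩ measurable_swap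
    measurable_swap).measurableEmbedding

theorem quasiMeasurePreserving_right :
    Measure.QuasiMeasurePreserving (right : Omega n → _) volume volume :=
  (measurePreserving_cons n).quasiMeasurePreserving.comp Measure.quasiMeasurePreserving_snd

theorem quasiMeasurePreserving_left :
    Measure.QuasiMeasurePreserving (left : Omega n → _) volume volume :=
  quasiMeasurePreserving_right.comp measurePreserving_swap.quasiMeasurePreserving

theorem lintegral_omega {f : Omega n → ℝ≥0∞} (hf : Measurable f) :
    ∫⁻ x, f x = ∫⁻ z : E3 × (Fin n → E3), ∫⁻ t, f (z.1, t, z.2) := by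
  rw [← measurePreserving_swap.lintegral_comp hf]
  have : Measurable fun x : Omega n => f (swap x) := hf.comp measurable_swap
  exact lintegral_prod_symm' _ this

theorem ae_omega_ne_zero : ∀ᵐ x : Omega n, x.1 ≠ 0 ∧ x.2.1 ≠ 0 := by
  have h1 : ∀ᵐ x : Omega n, x.1 ≠ 0 := Measure.quasiMeasurePreserving_fst.ae ae_ne_zero
  have h2 : ∀ᵐ x : Omega n, x.2.1 ≠ 0 := measurePreserving_swap.quasiMeasurePreserving.ae h1
  exact h1.and h2

variable {m μ : ℝ}

theorem L_left (hm : 0 < m) (hμ : 0 < μ) (x : Omega n) : L m μ (left x)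
    = 2 * Real.pi ^ 2 * ell m x.1 (∑ i, x.2.2 i) (effQ m μ x.2.2) := L_cons hm hμ _ _

theorem L_right (hm : 0 < m) (hμ : 0 < μ) (x : Omega n) : L m μ (right x)
    = 2 * Real.pi ^ 2 * ell m x.2.1 (∑ i, x.2.2 i) (effQ m μ x.2.2) := L_cons hm hμ _ _

theorem GG_eq (hm : 0 < m) (hμ : 0 < μ) (x : Omega n) : GG m μ x = (XX m μ x + BB m x)⁻¹ :=
  G_cons hm hμ _ _ _

theorem XX_swap (x : Omega n) : XX m μ (swap x) = XX m μ x := evenDen_comm _ _ _ _ _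

theorem BB_swap (x : Omega n) : BB m (swap x) = BB m x := oddDen_comm _ _ _ _

theorem GG_swap (hm : 0 < m) (hμ : 0 < μ) (x : Omega n) : GG m μ (swap x) = GG m μ x := by
  rw [GG_eq hm hμ, GG_eq hm hμ, XX_swap, BB_swap]

theorem measurable_XX : Measurable (XX m μ : Omega n → ℝ) := by
  unfold XX evenDen effQ
  fun_prop

theorem measurable_BB : Measurable (BB m : Omega n → ℝ) := by
  unfold BB oddDen
  fun_prop

theorem measurable_GG (hm : 0 < m) (hμ : 0 < μ) : Measurable (GG m μ : Omega n → ℝ) := by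
  rw [funext (GG_eq hm hμ)]
  exact (measurable_XX.add measurable_BB).inv

theorem XX_pos (hm : 0 < m) (hμ : 0 < μ) (x : Omega n) : 0 < XX m μ x :=
  evenDen_pos hm _ (effQ_pos hm hμ _) _ _

theorem abs_BB_lt (hm : 0 < m) (hμ : 0 < μ) (x : Omega n) : |BB m x| < XX m μ x :=
  abs_oddDen_lt hm _ (effQ_pos hm hμ _) _ _

theorem den_pos (hm : 0 < m) (hμ : 0 < μ) (x : Omega n) : 0 < XX m μ x ^ 2 - BB m x ^ 2 :=
  den_sq_sub_pos hm _ (effQ_pos hm hμ _) _ _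

theorem GG_pos (hm : 0 < m) (hμ : 0 < μ) (x : Omega n) : 0 < GG m μ x := by
  rw [GG_eq hm hμ, inv_pos]
  linarith [(abs_lt.1 (abs_BB_lt hm hμ x)).1]

/-- Weighted arithmetic-geometric mean inequality in `[0, ∞]`. -/
theorem two_mul_le_weighted (a b : ℝ≥0∞) {w : ℝ} (hw : 0 < w) :
    2 * (a * b) ≤ a ^ 2 * ENNReal.ofReal w + b ^ 2 * ENNReal.ofReal w⁻¹ := by
  have h1 : ENNReal.ofReal w ≠ 0 := by simpa using hw
  have h2 : ENNReal.ofReal w⁻¹ ≠ 0 := by simpa using hw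
  rcases eq_or_ne a ⊤ with rfl | ha
  · simp [ENNReal.top_mul, h1]
  rcases eq_or_ne b ⊤ with rfl | hb
  · simp [ENNReal.top_mul, h2]
  lift a to NNReal using ha
  lift b to NNReal using hb
  have e : ∀ c : NNReal, (c : ℝ≥0∞) = ENNReal.ofReal c := fun c => (ENNReal.ofReal_coe_nnreal).symm
  rw [e a, e b, ← ENNReal.ofReal_mul (by positivity), ← ENNReal.ofReal_pow (by positivity),
    ← ENNReal.ofReal_pow (by positivity), ← ENNReal.ofReal_mul (by positivity),
    ← ENNReal.ofReal_mul (by positivity), ← ENNReal.ofReal_add (by positivity) (by positivity),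
    ← ENNReal.ofReal_ofNat 2, ← ENNReal.ofReal_mul (by positivity)]
  refine ENNReal.ofReal_le_ofReal ?_
  have : 0 ≤ w⁻¹ * ((a : ℝ) * w - b) ^ 2 := by positivity
  have e2 : w⁻¹ * ((a : ℝ) * w - b) ^ 2 = a ^ 2 * w - 2 * (a * b) + b ^ 2 * w⁻¹ := by
    field_simp; ring
  linarith

theorem mul_le_weighted (a b : ℝ≥0∞) {w : ℝ} (hw : 0 < w) :
    a * b ≤ a ^ 2 * ENNReal.ofReal w + b ^ 2 * ENNReal.ofReal w⁻¹ :=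
  le_trans (by rw [two_mul]; exact le_self_add) (two_mul_le_weighted a b hw)

theorem lintegral_left_mul_le {φ : Config (n + 1) → ℝ≥0∞} (hφ : Measurable φ)
    {k : Omega n → ℝ≥0∞} (hk : Measurable k) {ρ : Config (n + 1) → ℝ≥0∞} (hρ : Measurable ρ)
    (h : ∀ (s : E3) (q : Fin n → E3), ∫⁻ t, k (s, t, q) ≤ ρ (cons s q)) :
    ∫⁻ x : Omega n, φ (left x) * k x ≤ ∫⁻ p, φ p * ρ p := by
  have hf : Measurable fun x => φ (left x) * k x := (hφ.comp measurable_left).mul hk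
  have hg : Measurable fun p => φ p * ρ p := hφ.mul hρ
  rw [lintegral_omega hf, ← (measurePreserving_cons n).lintegral_comp hg]
  refine lintegral_mono fun z => ?_
  simp only [left]
  have hkt : Measurable fun t => k (z.1, t, z.2) :=
    hk.comp (by fun_prop : Measurable fun t : E3 => (z.1, t, z.2))
  rw [lintegral_const_mul _ hkt]
  exact mul_le_mul_right (h _ _) _

/-- The kernel of `L^{-α} G L^{α-1}`. -/
noncomputable def schurKernel (m μ α : ℝ) (x : Omega n) : ℝ :=
  L m μ (left x) ^ (-α) * L m μ (right x) ^ (α - 1) * GG m μ x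

theorem measurable_schurKernel (hm : 0 < m) (hμ : 0 < μ) (α : ℝ) :
    Measurable (schurKernel m μ α : Omega n → ℝ) := by
  have hL : Measurable (L m μ : Config (n + 1) → ℝ) := (continuous_L m μ).measurable
  exact (((hL.comp measurable_left).pow_const _).mul
    ((hL.comp measurable_right).pow_const _)).mul (measurable_GG hm hμ)

theorem schurKernel_swap (hm : 0 < m) (hμ : 0 < μ) (α : ℝ) (x : Omega n) :
    schurKernel m μ α (swap x) = schurKernel m μ (1 - α) x := by
  unfold schurKernel
  rw [GG_swap hm hμ]
  change L m μ (right x) ^ (-α) * L m μ (left x) ^ (α - 1) * _ = _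
  rw [show -(1 - α) = α - 1 by ring, show 1 - α - 1 = -α by ring]
  ring

theorem schurKernel_eq (hm : 0 < m) (hμ : 0 < μ) (α : ℝ) (x : Omega n) :
    schurKernel m μ α x = (2 * Real.pi ^ 2)⁻¹ *
      (ell m x.1 (∑ i, x.2.2 i) (effQ m μ x.2.2) ^ (-α)
        * ell m x.2.1 (∑ i, x.2.2 i) (effQ m μ x.2.2) ^ (α - 1) * (XX m μ x + BB m x)⁻¹) := by
  have hpi := Real.pi_pos
  have hQ := effQ_pos hm hμ x.2.2
  unfold schurKernel
  rw [L_left hm hμ, L_right hm hμ, GG_eq hm hμ,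
    Real.mul_rpow (by positivity) (ell_pos hm _ _ hQ).le,
    Real.mul_rpow (by positivity) (ell_pos hm _ _ hQ).le]
  have : (2 * Real.pi ^ 2)⁻¹ = (2 * Real.pi ^ 2) ^ (-α) * (2 * Real.pi ^ 2) ^ (α - 1) := by
    rw [← Real.rpow_add (by positivity), show -α + (α - 1) = -1 by ring, Real.rpow_neg_one]
  rw [this]
  ring

theorem exists_lintegral_weighted_schurKernel_le (hm : 0 < m) (hμ : 0 < μ) (n : ℕ) {α : ℝ}
    (h0 : 0 ≤ α) (h1 : α ≤ 1) :
    ∃ C : ℝ≥0∞, C ≠ ⊤ ∧ ∀ φ : Config (n + 1) → ℝ≥0∞, Measurable φ →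
      ∫⁻ x : Omega n, φ (left x) * ENNReal.ofReal
        ((‖x.1‖ ^ (3 / 2 : ℝ) * ‖x.2.1‖ ^ (-(3 / 2) : ℝ)) * schurKernel m μ α x)
          ≤ C * ∫⁻ p, φ p := by
  obtain ⟨C, hC, h⟩ := lintegral_schur_weight_le hm h0 h1
  have hpi := Real.pi_pos
  refine ⟨C, hC, fun φ hφ => ?_⟩
  have hkm : Measurable fun x : Omega n => ENNReal.ofReal
      ((‖x.1‖ ^ (3 / 2 : ℝ) * ‖x.2.1‖ ^ (-(3 / 2) : ℝ)) * schurKernel m μ α x) :=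
    (Measurable.mul (by fun_prop) (measurable_schurKernel hm hμ α)).ennreal_ofReal
  refine (lintegral_left_mul_le hφ hkm (ρ := fun _ => C) measurable_const fun s q => ?_).trans_eq
    (by rw [lintegral_mul_const _ hφ, mul_comm])
  refine le_trans ?_ (h s (∑ i, q i) (effQ m μ q) (effQ_pos hm hμ q))
  rw [← lintegral_const_mul' _ _ ENNReal.ofReal_ne_top]
  refine lintegral_mono fun t => ?_
  rw [← ENNReal.ofReal_mul (by positivity)]
  refine ENNReal.ofReal_le_ofReal ?_
  rw [schurKernel_eq hm hμ]
  simp only [XX, BB]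
  have hG := GG_pos hm hμ ((s, t, q) : Omega n)
  rw [GG_eq hm hμ] at hG
  simp only [XX, BB] at hG
  have e1 := ell_pos hm s (∑ i, q i) (effQ_pos hm hμ q)
  have e2 := ell_pos hm t (∑ i, q i) (effQ_pos hm hμ q)
  -- The value of the constant is irrelevant for boundedness, so this factor is dropped.
  have hle : (2 * Real.pi ^ 2)⁻¹ ≤ 1 := by
    refine inv_le_one_of_one_le₀ ?_
    nlinarith [Real.pi_gt_three]
  rw [mul_assoc]
  refine mul_le_mul_of_nonneg_left ?_ (by positivity)
  refine mul_le_mul_of_nonneg_left ?_ (by positivity)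
  exact mul_le_of_le_one_left (by positivity) hle

/-- The weighted mean inequality separates the two functions. Exchanging `s` and `t` in the second
term replaces `α` by `1 - α`, so a single family of row bounds suffices. -/
theorem exists_lintegral_schurKernel_le (hm : 0 < m) (hμ : 0 < μ) (n : ℕ) {α : ℝ}
    (h0 : 0 ≤ α) (h1 : α ≤ 1) :
    ∃ C : ℝ≥0∞, C ≠ ⊤ ∧ ∀ φ ψ : Config (n + 1) → ℝ≥0∞, Measurable φ → Measurable ψ →
      ∫⁻ x : Omega n, φ (left x) * ψ (right x) * ENNReal.ofReal (schurKernel m μ α x)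
        ≤ C * ((∫⁻ p, φ p ^ 2) + ∫⁻ p, ψ p ^ 2) := by
  obtain ⟨C1, hC1, H1⟩ := exists_lintegral_weighted_schurKernel_le hm hμ n h0 h1
  obtain ⟨C2, hC2, H2⟩ := exists_lintegral_weighted_schurKernel_le hm hμ n
    (α := 1 - α) (by linarith) (by linarith)
  refine ⟨C1 + C2, by finiteness, fun φ ψ hφ hψ => ?_⟩
  have hk := measurable_schurKernel (n := n) hm hμ α
  have hk0 : ∀ x : Omega n, 0 ≤ schurKernel m μ α x := fun x => by
    have a1 := (L_pos hm hμ (left x)).le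
    have a2 := (L_pos hm hμ (right x)).le
    have a3 := (GG_pos hm hμ x).le
    unfold schurKernel
    positivity
  set f1 : Omega n → ℝ≥0∞ := fun x => φ (left x) ^ 2 * ENNReal.ofReal
    ((‖x.1‖ ^ (3 / 2 : ℝ) * ‖x.2.1‖ ^ (-(3 / 2) : ℝ)) * schurKernel m μ α x) with hf1
  set f2 : Omega n → ℝ≥0∞ := fun x => ψ (left x) ^ 2 * ENNReal.ofReal
    ((‖x.1‖ ^ (3 / 2 : ℝ) * ‖x.2.1‖ ^ (-(3 / 2) : ℝ)) * schurKernel m μ (1 - α) x) with hf2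
  have hf1m : Measurable f1 := ((hφ.comp measurable_left).pow_const 2).mul
    (Measurable.mul (by fun_prop) hk).ennreal_ofReal
  have hf2m : Measurable f2 := ((hψ.comp measurable_left).pow_const 2).mul
    (Measurable.mul (by fun_prop) (measurable_schurKernel hm hμ _)).ennreal_ofReal
  have hpt : ∀ᵐ x : Omega n, φ (left x) * ψ (right x) * ENNReal.ofReal (schurKernel m μ α x)
      ≤ f1 x + f2 (swap x) := by
    filter_upwards [ae_omega_ne_zero] with x hx
    have hs : 0 < ‖x.1‖ := norm_pos_iff.2 hx.1
    have ht : 0 < ‖x.2.1‖ := norm_pos_iff.2 hx.2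
    have hw : 0 < ‖x.1‖ ^ (3 / 2 : ℝ) * ‖x.2.1‖ ^ (-(3 / 2) : ℝ) := by positivity
    have e2 : f2 (swap x) = ψ (right x) ^ 2 * ENNReal.ofReal
        ((‖x.1‖ ^ (3 / 2 : ℝ) * ‖x.2.1‖ ^ (-(3 / 2) : ℝ))⁻¹ * schurKernel m μ α x) := by
      simp only [hf2]
      rw [schurKernel_swap hm hμ, sub_sub_cancel]
      change ψ (right x) ^ 2 * ENNReal.ofReal ((‖x.2.1‖ ^ (3 / 2 : ℝ) * ‖x.1‖ ^ (-(3 / 2) : ℝ)) * _)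
        = _
      rw [mul_inv, Real.rpow_neg hs.le, Real.rpow_neg ht.le, inv_inv, mul_comm (‖x.2.1‖ ^ _)]
    simp only [e2, hf1]
    rw [ENNReal.ofReal_mul hw.le, ENNReal.ofReal_mul (inv_nonneg.2 hw.le), ← mul_assoc,
      ← mul_assoc, ← add_mul]
    exact mul_le_mul_left (mul_le_weighted _ _ hw) _
  calc _ ≤ ∫⁻ x, (f1 x + f2 (swap x)) := lintegral_mono_ae hpt
    _ = (∫⁻ x, f1 x) + ∫⁻ x, f2 x := by
      rw [lintegral_add_left hf1m, measurePreserving_swap.lintegral_comp hf2m]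
    _ ≤ C1 * (∫⁻ p, φ p ^ 2) + C2 * ∫⁻ p, ψ p ^ 2 :=
      add_le_add (H1 _ (hφ.pow_const 2)) (H2 _ (hψ.pow_const 2))
    _ ≤ (C1 + C2) * (∫⁻ p, φ p ^ 2) + (C1 + C2) * ∫⁻ p, ψ p ^ 2 := by
      gcongr
      · exact le_self_add
      · exact le_add_self
    _ = _ := by rw [mul_add]

end omega

/-! ### Control of the odd part by `Λ_β`. -/

section

/-- The symmetric weight `(x ^ β + y ^ β) / (x y) ^ ((β + 1) / 2)`. -/
noncomputable def wt (β x y : ℝ) : ℝ :=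
  x ^ ((β - 1) / 2) / y ^ ((β + 1) / 2) + y ^ ((β - 1) / 2) / x ^ ((β + 1) / 2)

theorem wt_comm (β x y : ℝ) : wt β x y = wt β y x := add_comm _ _

theorem wt_nonneg {β x y : ℝ} (hx : 0 ≤ x) (hy : 0 ≤ y) : 0 ≤ wt β x y := by
  unfold wt; positivity

theorem wt_mul {β c x y : ℝ} (hc : 0 < c) (hx : 0 < x) (hy : 0 < y) :
    wt β (c * x) (c * y) = c⁻¹ * wt β x y := by
  unfold wt
  have e : c ^ ((β + 1) / 2) = c ^ ((β - 1) / 2) * c := by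
    rw [show (β + 1) / 2 = (β - 1) / 2 + 1 by ring, Real.rpow_add hc, Real.rpow_one]
  rw [Real.mul_rpow hc.le hx.le, Real.mul_rpow hc.le hy.le, Real.mul_rpow hc.le hx.le,
    Real.mul_rpow hc.le hy.le, e]
  field_simp

theorem reg_add_le {β ε x y : ℝ} (hε : 0 ≤ ε) (hx : 0 < x) (hy : 0 < y) :
    reg β ε x + reg β ε y
      ≤ Real.sqrt (reg β ε x * x) * Real.sqrt (reg β ε y * y) * wt β x y := by
  have h := reg_add_mul_le (β := β) hε hx hy
  have hrx := (reg_pos (β := β) hε hx).le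
  have hry := (reg_pos (β := β) hε hy).le
  have hX : 0 < x ^ β := by positivity
  have hY : 0 < y ^ β := by positivity
  have hs : 0 < Real.sqrt (x ^ β * y ^ β) := Real.sqrt_pos.2 (by positivity)
  rw [← le_div_iff₀ hs] at h
  refine h.trans_eq ?_
  have hw : wt β x y = (x ^ β + y ^ β) / (Real.sqrt (x ^ β * y ^ β) * Real.sqrt (x * y)) := by
    have e1 : Real.sqrt (x ^ β * y ^ β) * Real.sqrt (x * y)
        = x ^ ((β + 1) / 2) * y ^ ((β + 1) / 2) := by
      rw [← Real.sqrt_mul (by positivity), Real.sqrt_eq_rpow, ← Real.mul_rpow hx.le hy.le,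
        ← Real.rpow_add_one (by positivity), ← Real.rpow_mul (by positivity),
        ← Real.mul_rpow hx.le hy.le]
      congr 1; ring
    have e2 : ∀ {x : ℝ}, 0 < x → x ^ β = x ^ ((β - 1) / 2) * x ^ ((β + 1) / 2) := by
      intro x hx
      rw [← Real.rpow_add hx]; congr 1; ring
    rw [e1, wt, e2 hx, e2 hy]
    field_simp
  rw [hw, Real.sqrt_mul hrx, Real.sqrt_mul hry, Real.sqrt_mul hrx, Real.sqrt_mul hx.le]
  have := Real.sqrt_pos.2 hx
  have := Real.sqrt_pos.2 hy
  field_simp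

variable {n : ℕ} {m μ : ℝ}

/-- The kernel that is controlled by `Λ_β`. -/
noncomputable def oddKernel (m μ β : ℝ) (x : Omega n) : ℝ :=
  wt β (L m μ (left x)) (L m μ (right x)) * (|BB m x| / (XX m μ x ^ 2 - BB m x ^ 2))

theorem measurable_L_left : Measurable fun x : Omega n => L m μ (left x) :=
  (continuous_L m μ).measurable.comp measurable_left

theorem measurable_L_right : Measurable fun x : Omega n => L m μ (right x) :=
  (continuous_L m μ).measurable.comp measurable_right

theorem measurable_oddKernel (β : ℝ) : Measurable (oddKernel m μ β : Omega n → ℝ) := by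
  have h1 := measurable_L_left (n := n) (m := m) (μ := μ)
  have h2 := measurable_L_right (n := n) (m := m) (μ := μ)
  have h3 := measurable_XX (n := n) (m := m) (μ := μ)
  have h4 := measurable_BB (n := n) (m := m)
  unfold oddKernel wt
  fun_prop

theorem oddKernel_swap (β : ℝ) (x : Omega n) :
    oddKernel m μ β (swap x) = oddKernel m μ β x := by
  unfold oddKernel
  rw [BB_swap, XX_swap]
  change wt β (L m μ (right x)) (L m μ (left x)) * _ = _
  rw [wt_comm]

/-- The constant combines `2/(1+m)` from `oddDen` with `1/(2π²)` from the homogeneity of `wt` of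
degree `-1`. -/
theorem oddKernel_div_norm_sq (hm : 0 < m) (hμ : 0 < μ) (β : ℝ) (s t : E3) (q : Fin n → E3) :
    1 / ‖t‖ ^ 2 * oddKernel m μ β (s, t, q)
      = (Real.pi ^ 2 * (1 + m))⁻¹ * LambdaIntegrand β m s (∑ i, q i) (effQ m μ q) t := by
  have hpi := Real.pi_pos
  have hQ := effQ_pos hm hμ q
  rw [lambdaIntegrand_eq, oddKernel, L_left hm hμ, L_right hm hμ,
    wt_mul (by positivity) (ell_pos hm _ _ hQ) (ell_pos hm _ _ hQ)]
  simp only [XX, BB, wt]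
  rw [show |oddDen m (∑ i, q i) s t| = 2 / (1 + m) * |inner ℝ (s + (2 + m)⁻¹ • ∑ i, q i)
    (t + (2 + m)⁻¹ • ∑ i, q i)| by rw [oddDen, abs_mul, abs_of_pos (by positivity)]]
  field_simp

theorem le_lambda (β m : ℝ) (s K : E3) {Q : ℝ} (hQ : 0 < Q) :
    ENNReal.ofReal ((‖s‖ ^ 2 + Q ^ 2) / (Real.pi ^ 2 * (1 + m))) *
      ∫⁻ t, ENNReal.ofReal (LambdaIntegrand β m s K Q t) ≤ Lambda β m :=
  le_iSup_of_le s (le_iSup_of_le K (le_iSup_of_le Q (le_iSup_of_le hQ le_rfl)))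

theorem norm_cons_sq (s : E3) (q : Fin n → E3) :
    ‖cons s q‖ ^ 2 = ‖s‖ ^ 2 + ∑ i, ‖q i‖ ^ 2 := by
  rw [norm_sq_config]
  simp only [cons, Fin.sum_univ_succ, Fin.cons_zero, Fin.cons_succ]

theorem norm_sq_div_le (hm : 0 < m) (hμ : 0 < μ) {s : E3} (hs : s ≠ 0) (q : Fin n → E3) :
    ‖s‖ ^ 2 / (‖s‖ ^ 2 + effQ m μ q ^ 2) ≤ ‖s‖ ^ 2 / ‖cons s q‖ ^ 2 := by
  have hsp : 0 < ‖s‖ ^ 2 := pow_pos (norm_pos_iff.2 hs) 2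
  have hq : 0 ≤ ∑ i, ‖q i‖ ^ 2 := Finset.sum_nonneg fun i _ => sq_nonneg _
  have hc : 0 ≤ (m + 1) / m * μ := by positivity
  rw [norm_cons_sq, effQ_sq hm hμ]
  refine div_le_div_of_nonneg_left hsp.le (add_pos_of_pos_of_nonneg hsp hq) ?_
  exact add_le_add_right (le_add_of_nonneg_right hc) _

/-- Row bound with weight `s²/t²`. The factor `s² + Q²` in `Λ_β` makes the gain `s²/(s² + Q²)`
explicit, and `Q²` dominates `∑ q_i²`. -/
theorem lintegral_oddKernel_weighted_le (hm : 0 < m) (hμ : 0 < μ) (β : ℝ) (s : E3)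
    (q : Fin n → E3) :
    ∫⁻ t, ENNReal.ofReal (‖s‖ ^ 2 / ‖t‖ ^ 2 * oddKernel m μ β (s, t, q))
      ≤ Lambda β m * ENNReal.ofReal (‖cons s q 0‖ ^ 2 / ‖cons s q‖ ^ 2) := by
  have hpi := Real.pi_pos
  have hQ := effQ_pos hm hμ q
  have hs0 : cons s q 0 = s := rfl
  rw [hs0]
  rcases eq_or_ne s 0 with rfl | hs
  · simp
  have hsp : 0 < ‖s‖ := norm_pos_iff.2 hs
  have hΛ := le_lambda β m s (∑ i, q i) hQ
  have hr := norm_sq_div_le hm hμ hs q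
  have hD : 0 < ‖s‖ ^ 2 + effQ m μ q ^ 2 := by positivity
  have e : ∀ t, ENNReal.ofReal (‖s‖ ^ 2 / ‖t‖ ^ 2 * oddKernel m μ β (s, t, q))
      = ENNReal.ofReal (‖s‖ ^ 2 / (‖s‖ ^ 2 + effQ m μ q ^ 2)) *
        (ENNReal.ofReal ((‖s‖ ^ 2 + effQ m μ q ^ 2) / (Real.pi ^ 2 * (1 + m))) *
          ENNReal.ofReal (LambdaIntegrand β m s (∑ i, q i) (effQ m μ q) t)) := by
    intro t
    have := oddKernel_div_norm_sq hm hμ β s t q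
    rw [← ENNReal.ofReal_mul (by positivity), ← ENNReal.ofReal_mul (by positivity)]
    congr 1
    calc _ = ‖s‖ ^ 2 * (1 / ‖t‖ ^ 2 * oddKernel m μ β (s, t, q)) := by ring
      _ = _ := by rw [this]; field_simp
  rw [lintegral_congr e, lintegral_const_mul' _ _ ENNReal.ofReal_ne_top,
    lintegral_const_mul' _ _ ENNReal.ofReal_ne_top]
  generalize ENNReal.ofReal ((‖s‖ ^ 2 + effQ m μ q ^ 2) / (Real.pi ^ 2 * (1 + m))) *
      ∫⁻ t, ENNReal.ofReal (LambdaIntegrand β m s (∑ i, q i) (effQ m μ q) t) = I at *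
  rw [mul_comm (Lambda β m)]
  exact mul_le_mul' (ENNReal.ofReal_le_ofReal hr) hΛ

/-- By symmetry of `Φ` every index contributes the same integral, and the fractions sum to at most
one. This cancels the factor `N - 1` of the off-diagonal form. -/
theorem lintegral_mul_ratio_le {Φ : Config (n + 1) → ℝ≥0∞} (hΦ : Measurable Φ)
    (hs : ∀ σ : Equiv.Perm (Fin (n + 1)), (fun p => Φ (permute σ p)) =ᵐ[volume] Φ) :
    ((n : ℝ≥0∞) + 1) * ∫⁻ p, Φ p * ENNReal.ofReal (‖p 0‖ ^ 2 / ‖p‖ ^ 2) ≤ ∫⁻ p, Φ p := by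
  have hm : ∀ i : Fin (n + 1),
      Measurable fun p : Config (n + 1) => ENNReal.ofReal (‖p i‖ ^ 2 / ‖p‖ ^ 2) := by
    intro i
    fun_prop
  have h : ∀ i : Fin (n + 1), ∫⁻ p, Φ p * ENNReal.ofReal (‖p i‖ ^ 2 / ‖p‖ ^ 2)
      = ∫⁻ p, Φ p * ENNReal.ofReal (‖p 0‖ ^ 2 / ‖p‖ ^ 2) := by
    intro i
    have hf : Measurable fun p : Config (n + 1) => Φ p * ENNReal.ofReal (‖p i‖ ^ 2 / ‖p‖ ^ 2) :=
      hΦ.mul (hm i)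
    rw [← (measurePreserving_permute (Equiv.swap 0 i)).lintegral_comp hf]
    refine lintegral_congr_ae ?_
    filter_upwards [hs (Equiv.swap 0 i)] with p hp
    have e1 : permute (Equiv.swap 0 i) p i = p 0 := by simp [permute]
    have e2 : ‖permute (Equiv.swap 0 i) p‖ = ‖p‖ := (permuteIso (Equiv.swap 0 i)).norm_map p
    rw [hp, e1, e2]
  have hsum : ((n : ℝ≥0∞) + 1) * ∫⁻ p, Φ p * ENNReal.ofReal (‖p 0‖ ^ 2 / ‖p‖ ^ 2)
      = ∫⁻ p, ∑ i : Fin (n + 1), Φ p * ENNReal.ofReal (‖p i‖ ^ 2 / ‖p‖ ^ 2) := by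
    have hi : ∀ i : Fin (n + 1), Measurable fun p : Config (n + 1) =>
        Φ p * ENNReal.ofReal (‖p i‖ ^ 2 / ‖p‖ ^ 2) := fun i => hΦ.mul (hm i)
    rw [lintegral_finsetSum _ fun i _ => hi i, Finset.sum_congr rfl fun i _ => h i]
    simp
  rw [hsum]
  refine lintegral_mono fun p => ?_
  simp only
  rw [← Finset.mul_sum, ← ENNReal.ofReal_sum_of_nonneg fun i _ => by positivity]
  refine mul_le_of_le_one_right' ?_
  rw [← ENNReal.ofReal_one]
  refine ENNReal.ofReal_le_ofReal ?_
  rw [← Finset.sum_div, ← norm_sq_config]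
  exact div_self_le_one _

theorem lintegral_oddKernel_le (hm : 0 < m) (hμ : 0 < μ) (β : ℝ)
    {Φ : Config (n + 1) → ℝ≥0∞} (hΦ : Measurable Φ)
    (hs : ∀ σ : Equiv.Perm (Fin (n + 1)), (fun p => Φ (permute σ p)) =ᵐ[volume] Φ) :
    ((n : ℝ≥0∞) + 1) * ∫⁻ x : Omega n, Φ (left x) * Φ (right x) * ENNReal.ofReal (oddKernel m μ β x)
      ≤ Lambda β m * ∫⁻ p, Φ p ^ 2 := by
  set f : Omega n → ℝ≥0∞ := fun x => Φ (left x) ^ 2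
    * ENNReal.ofReal (‖x.1‖ ^ 2 / ‖x.2.1‖ ^ 2 * oddKernel m μ β x) with hf
  have hkm : Measurable fun x : Omega n =>
      ENNReal.ofReal (‖x.1‖ ^ 2 / ‖x.2.1‖ ^ 2 * oddKernel m μ β x) :=
    (Measurable.mul (by fun_prop) (measurable_oddKernel β)).ennreal_ofReal
  have hfm : Measurable f := ((hΦ.comp measurable_left).pow_const 2).mul hkm
  have hΦ2 : Measurable fun p => Φ p ^ 2 := hΦ.pow_const 2
  have hpt : ∀ᵐ x : Omega n, 2 * (Φ (left x) * Φ (right x) * ENNReal.ofReal (oddKernel m μ β x))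
      ≤ f x + f (swap x) := by
    filter_upwards [ae_omega_ne_zero] with x hx
    have hs : 0 < ‖x.1‖ := norm_pos_iff.2 hx.1
    have ht : 0 < ‖x.2.1‖ := norm_pos_iff.2 hx.2
    have hw : 0 < ‖x.1‖ ^ 2 / ‖x.2.1‖ ^ 2 := by positivity
    have e2 : f (swap x) = Φ (right x) ^ 2
        * ENNReal.ofReal ((‖x.1‖ ^ 2 / ‖x.2.1‖ ^ 2)⁻¹ * oddKernel m μ β x) := by
      simp only [hf]
      rw [oddKernel_swap, inv_div]
      rfl
    rw [e2]
    simp only [hf]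
    rw [ENNReal.ofReal_mul hw.le, ENNReal.ofReal_mul (inv_nonneg.2 hw.le), ← mul_assoc 2,
      ← mul_assoc (Φ (left x) ^ 2), ← mul_assoc (Φ (right x) ^ 2), ← add_mul]
    exact mul_le_mul_left (two_mul_le_weighted _ _ hw) _
  have h1 : ∫⁻ x : Omega n, Φ (left x) * Φ (right x) * ENNReal.ofReal (oddKernel m μ β x)
      ≤ ∫⁻ x, f x := by
    have h2 : 2 * ∫⁻ x : Omega n, Φ (left x) * Φ (right x) * ENNReal.ofReal (oddKernel m μ β x)
        ≤ 2 * ∫⁻ x, f x := by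
      rw [← lintegral_const_mul' _ _ ENNReal.ofNat_ne_top]
      refine (lintegral_mono_ae hpt).trans_eq ?_
      rw [lintegral_add_left hfm, measurePreserving_swap.lintegral_comp hfm, two_mul]
    exact (ENNReal.mul_le_mul_iff_right two_ne_zero ENNReal.ofNat_ne_top).1 h2
  have hρ : Measurable fun p : Config (n + 1) =>
      Lambda β m * ENNReal.ofReal (‖p 0‖ ^ 2 / ‖p‖ ^ 2) := by fun_prop
  have h2 : ∫⁻ x, f x ≤ Lambda β m * ∫⁻ p, Φ p ^ 2 * ENNReal.ofReal (‖p 0‖ ^ 2 / ‖p‖ ^ 2) := by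
    refine (lintegral_left_mul_le hΦ2 hkm hρ
      fun s q => lintegral_oddKernel_weighted_le hm hμ β s q).trans_eq ?_
    rw [← lintegral_const_mul _ (by fun_prop)]
    refine lintegral_congr fun p => ?_
    ring
  have h3 := lintegral_mul_ratio_le hΦ2 fun σ => by
    filter_upwards [hs σ] with p hp
    rw [hp]
  calc _ ≤ ((n : ℝ≥0∞) + 1) * (Lambda β m
        * ∫⁻ p, Φ p ^ 2 * ENNReal.ofReal (‖p 0‖ ^ 2 / ‖p‖ ^ 2)) :=
        mul_le_mul_right (h1.trans h2) _
    _ = Lambda β m * (((n : ℝ≥0∞) + 1)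
        * ∫⁻ p, Φ p ^ 2 * ENNReal.ofReal (‖p 0‖ ^ 2 / ‖p‖ ^ 2)) := by ring
    _ ≤ _ := mul_le_mul_right h3 _

end

/-! ### The off-diagonal form in momentum space and its even part. -/

section

variable {n : ℕ} {m μ : ℝ}

/-- The off-diagonal form in momentum space. -/
noncomputable def offForm (m μ : ℝ) (u v : Config (n + 1) → ℂ) : ℂ :=
  ((n : ℂ) + 1) * ∫ x : Omega n, conj (u (left x)) * v (right x) * (GG m μ x : ℂ)

theorem Toff_eq (ζ ξ : L2 (n + 1)) : Toff m μ ζ ξ = offForm m μ (hat ζ) (hat ξ) := rfl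

theorem offForm_congr {u u' v v' : Config (n + 1) → ℂ} (hu : u =ᵐ[volume] u')
    (hv : v =ᵐ[volume] v') : offForm m μ u v = offForm m μ u' v' := by
  unfold offForm
  congr 1
  refine integral_congr_ae ?_
  filter_upwards [quasiMeasurePreserving_left.ae hu, quasiMeasurePreserving_right.ae hv]
    with x h1 h2
  rw [h1, h2]

theorem measurable_L {k : ℕ} : Measurable (L m μ : Config k → ℝ) := (continuous_L m μ).measurable

/-- The powers of `L` removed from `G` in `schurKernel` are put on `u` and `v`. The value `α = 1/2`
serves the form domain; `α = 0` allows a merely square integrable `u` against `v` in `H¹`. -/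
theorem exists_lintegral_off_le (hm : 0 < m) (hμ : 0 < μ) (n : ℕ) {α : ℝ} (h0 : 0 ≤ α)
    (h1 : α ≤ 1) :
    ∃ C : ℝ≥0∞, C ≠ ⊤ ∧ ∀ u v : Config (n + 1) → ℂ, Measurable u → Measurable v →
      ∫⁻ x : Omega n, ‖conj (u (left x)) * v (right x) * (GG m μ x : ℂ)‖ₑ
        ≤ C * (LpowNormSq m μ α u + LpowNormSq m μ (1 - α) v) := by
  obtain ⟨C, hC, h⟩ := exists_lintegral_schurKernel_le hm hμ n h0 h1
  refine ⟨C, hC, fun u v hu hv => ?_⟩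
  have hL := measurable_L (m := m) (μ := μ) (k := n + 1)
  have hmu : ∀ {r : ℝ} {u : Config (n + 1) → ℂ}, Measurable u →
      Measurable fun p => ‖((L m μ p ^ r : ℝ) : ℂ) * u p‖ₑ := fun hu => by fun_prop
  refine le_trans (le_of_eq ?_) (h _ _ (hmu (r := α) hu) (hmu (r := 1 - α) hv))
  refine lintegral_congr fun x => ?_
  have p1 := L_pos hm hμ (left x)
  have p2 := L_pos hm hμ (right x)
  have p3 := GG_pos hm hμ x
  have e : GG m μ x = L m μ (left x) ^ α * L m μ (right x) ^ (1 - α) * schurKernel m μ α x := by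
    have e1 : L m μ (left x) ^ α * L m μ (left x) ^ (-α) = 1 := by
      rw [← Real.rpow_add p1]; simp
    have e2 : L m μ (right x) ^ (1 - α) * L m μ (right x) ^ (α - 1) = 1 := by
      rw [← Real.rpow_add p2]; simp
    unfold schurKernel
    calc GG m μ x = (L m μ (left x) ^ α * L m μ (left x) ^ (-α))
          * (L m μ (right x) ^ (1 - α) * L m μ (right x) ^ (α - 1)) * GG m μ x := by
          rw [e1, e2]; ring
      _ = _ := by ring
  have hs : 0 ≤ schurKernel m μ α x := by
    unfold schurKernel; positivity
  rw [e]
  simp only [enorm_mul, RCLike.enorm_conj, Complex.ofReal_mul]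
  rw [enorm_ofReal_of_nonneg hs]
  ring

theorem integrable_off (hm : 0 < m) (hμ : 0 < μ) {α : ℝ} (h0 : 0 ≤ α) (h1 : α ≤ 1)
    {u v : Config (n + 1) → ℂ} (hu : Measurable u) (hv : Measurable v)
    (hu' : LpowNormSq m μ α u < ⊤) (hv' : LpowNormSq m μ (1 - α) v < ⊤) :
    Integrable fun x : Omega n => conj (u (left x)) * v (right x) * (GG m μ x : ℂ) := by
  obtain ⟨C, hC, h⟩ := exists_lintegral_off_le hm hμ n h0 h1
  have hG := measurable_GG (n := n) hm hμ
  have h1 := hu.comp (measurable_left (n := n))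
  have h2 := hv.comp (measurable_right (n := n))
  refine ⟨Measurable.aestronglyMeasurable ?_, (h u v hu hv).trans_lt (by finiteness)⟩
  exact ((Complex.continuous_conj.measurable.comp h1).mul h2).mul
    (Complex.measurable_ofReal.comp hG)

theorem measurable_reg {β ε : ℝ} : Measurable (reg β ε) := by
  unfold reg; fun_prop

/-- `Re (conj u(s, q) u(t, q))`. -/
noncomputable def cross (u : Config (n + 1) → ℂ) (x : Omega n) : ℝ :=
  (conj (u (left x)) * u (right x)).re

theorem cross_swap (u : Config (n + 1) → ℂ) (x : Omega n) : cross u (swap x) = cross u x := by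
  change (conj (u (right x)) * u (left x)).re = (conj (u (left x)) * u (right x)).re
  simp only [Complex.mul_re, Complex.conj_re, Complex.conj_im]
  ring

theorem measurable_cross {u : Config (n + 1) → ℂ} (hu : Measurable u) :
    Measurable (cross u : Omega n → ℝ) :=
  Complex.measurable_re.comp ((Complex.continuous_conj.measurable.comp
    (hu.comp measurable_left)).mul (hu.comp measurable_right))

theorem abs_cross_le (u : Config (n + 1) → ℂ) (x : Omega n) :
    |cross u x| ≤ ‖u (left x)‖ * ‖u (right x)‖ := by
  refine (Complex.abs_re_le_norm _).trans ?_
  rw [norm_mul, RCLike.norm_conj]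

/-- For fixed `q`, `cross u` is a sum of two rank one kernels, from the real and imaginary parts of
`u`; its product with `PSD_reg_evenPart` is again positive semidefinite, and Fubini reduces to fixed
`q`. -/
theorem integral_even_nonneg (hm : 0 < m) (hμ : 0 < μ) {β ε : ℝ} (h0 : 0 ≤ β) (h2 : β ≤ 2)
    (hε : 0 ≤ ε) {u : Config (n + 1) → ℂ} (hu : Measurable u)
    (h_int : Integrable fun x : Omega n => cross u x *
      ((reg β ε (L m μ (left x)) + reg β ε (L m μ (right x)))
        * (XX m μ x / (XX m μ x ^ 2 - BB m x ^ 2)))) :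
    0 ≤ ∫ x : Omega n, cross u x * ((reg β ε (L m μ (left x)) + reg β ε (L m μ (right x)))
        * (XX m μ x / (XX m μ x ^ 2 - BB m x ^ 2))) := by
  have hmeas : Measurable fun x : Omega n => cross u x *
      ((reg β ε (L m μ (left x)) + reg β ε (L m μ (right x)))
        * (XX m μ x / (XX m μ x ^ 2 - BB m x ^ 2))) := by
    have a1 := measurable_cross hu
    have a2 := measurable_reg (β := β) (ε := ε).comp (measurable_L_left (n := n) (m := m) (μ := μ))
    have a3 := measurable_reg (β := β) (ε := ε).comp (measurable_L_right (n := n) (m := m) (μ := μ))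
    have a4 := measurable_XX (n := n) (m := m) (μ := μ)
    have a5 := measurable_BB (n := n) (m := m)
    exact a1.mul ((a2.add a3).mul (a4.div ((a4.pow_const 2).sub (a5.pow_const 2))))
  set F : Omega n → ℝ := fun x => cross u x *
      ((reg β ε (L m μ (left x)) + reg β ε (L m μ (right x)))
        * (XX m μ x / (XX m μ x ^ 2 - BB m x ^ 2))) with hF
  have hp := measurePreserving_prodAssoc (volume : Measure E3) (volume : Measure E3)
    (volume : Measure (Fin n → E3))
  have h_int' : Integrable (fun z : (E3 × E3) × (Fin n → E3) => F (MeasurableEquiv.prodAssoc z))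
      (((volume : Measure E3).prod volume).prod volume) :=
    (hp.integrable_comp_emb MeasurableEquiv.prodAssoc.measurableEmbedding).2 h_int
  have e : ∫ x, F x = ∫ z, F (MeasurableEquiv.prodAssoc z)
      ∂(((volume : Measure E3).prod volume).prod (volume : Measure (Fin n → E3))) :=
    (hp.integral_comp MeasurableEquiv.prodAssoc.measurableEmbedding F).symm
  rw [e, integral_prod_symm _ h_int']
  refine integral_nonneg_of_ae ?_
  filter_upwards [h_int'.prod_left_ae] with q hq
  have hQ := effQ_pos hm hμ q
  have k1 := PSD_reg_evenPart hm (∑ i, q i) hQ h0 h2 hε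
  have k2 := ((PSD.rankOne fun s : E3 => (u (cons s q)).re).add
    (PSD.rankOne fun s : E3 => (u (cons s q)).im)).mul k1
  have hK : PSD fun s t : E3 => F (s, t, q) := by
    convert k2 using 3 with s t
    simp only [hF, cross]
    rw [L_left hm hμ, L_right hm hμ]
    simp only [XX, BB, left, right, Complex.mul_re, Complex.conj_re, Complex.conj_im]
    ring
  have hKm : Measurable (Function.uncurry fun s t : E3 => F (s, t, q)) :=
    hmeas.comp (by fun_prop : Measurable fun z : E3 × E3 => (z.1, z.2, q))
  exact hK.integral_nonneg hKm hq

end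

/-! ### Lower bound for the off-diagonal form tested with `f(L)u`. -/

section

variable {n : ℕ} {m μ : ℝ}

/-- `∫ f(L) L |u|²` for the regularised symbol `f = reg β ε`. -/
noncomputable def regEnergy {k : ℕ} (m μ β ε : ℝ) (u : Config k → ℂ) : ℝ≥0∞ :=
  ∫⁻ p, ENNReal.ofReal (reg β ε (L m μ p) * L m μ p) * ‖u p‖ₑ ^ 2

theorem lpowNormSq_eq (hm : 0 < m) (hμ : 0 < μ) {k : ℕ} (r : ℝ) (u : Config k → ℂ) :
    LpowNormSq m μ r u = ∫⁻ p, ENNReal.ofReal (L m μ p ^ (2 * r)) * ‖u p‖ₑ ^ 2 := by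
  refine lintegral_congr fun p => ?_
  have hp := L_pos hm hμ p
  rw [enorm_mul, enorm_ofReal_of_nonneg (by positivity), mul_pow,
    ← ENNReal.ofReal_pow (by positivity), ← Real.rpow_natCast, ← Real.rpow_mul hp.le]
  norm_num [mul_comm]

theorem regEnergy_lt_top (hm : 0 < m) (hμ : 0 < μ) {k : ℕ} {β ε : ℝ} (hε : 0 < ε)
    {u : Config k → ℂ} (hu : LpowNormSq m μ (1 / 2) u < ⊤) : regEnergy m μ β ε u < ⊤ := by
  refine lt_of_le_of_lt ?_ (ENNReal.mul_lt_top (ENNReal.ofReal_lt_top (r := ε⁻¹)) hu)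
  rw [lpowNormSq_eq hm hμ, ← lintegral_const_mul' _ _ ENNReal.ofReal_ne_top]
  refine lintegral_mono fun p => ?_
  have hp := L_pos hm hμ p
  rw [← mul_assoc, ← ENNReal.ofReal_mul (by positivity)]
  refine mul_le_mul_left (ENNReal.ofReal_le_ofReal ?_) _
  norm_num
  exact mul_le_mul_of_nonneg_right (reg_le_inv hε hp.le) hp.le

theorem abs_BB_le (hm : 0 < m) (μ : ℝ) (x : Omega n) :
    |BB m x| ≤ (1 + m)⁻¹ * XX m μ x :=
  abs_oddDen_le hm _ _ _ _

theorem XX_sub_BB_pos (hm : 0 < m) (hμ : 0 < μ) (x : Omega n) : 0 < XX m μ x - BB m x := by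
  linarith [(abs_lt.1 (abs_BB_lt hm hμ x)).2]

/-- The even part is `G` times a bounded factor, so it inherits the integrability of `G`. -/
theorem XX_div_eq (hm : 0 < m) (hμ : 0 < μ) (x : Omega n) :
    XX m μ x / (XX m μ x ^ 2 - BB m x ^ 2) = XX m μ x / (XX m μ x - BB m x) * GG m μ x := by
  have h1 := (XX_sub_BB_pos hm hμ x).ne'
  have h2 := GG_pos hm hμ x
  rw [GG_eq hm hμ] at h2 ⊢
  have h3 := (inv_pos.1 h2).ne'
  rw [show XX m μ x ^ 2 - BB m x ^ 2 = (XX m μ x - BB m x) * (XX m μ x + BB m x) by ring]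
  field_simp

theorem BB_div_eq (hm : 0 < m) (hμ : 0 < μ) (x : Omega n) :
    BB m x / (XX m μ x ^ 2 - BB m x ^ 2)
      = XX m μ x / (XX m μ x ^ 2 - BB m x ^ 2) - GG m μ x := by
  have h1 := (XX_sub_BB_pos hm hμ x).ne'
  have h2 := GG_pos hm hμ x
  rw [GG_eq hm hμ] at h2 ⊢
  have h3 := (inv_pos.1 h2).ne'
  rw [show XX m μ x ^ 2 - BB m x ^ 2 = (XX m μ x - BB m x) * (XX m μ x + BB m x) by ring]
  field_simp
  ring

theorem ratio_le (hm : 0 < m) (hμ : 0 < μ) (x : Omega n) :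
    ‖XX m μ x / (XX m μ x - BB m x)‖ ≤ (1 + m) / m := by
  have h1 := XX_sub_BB_pos hm hμ x
  have h2 := XX_pos hm hμ x
  have h3 := (abs_le.1 (abs_BB_le hm μ x)).2
  rw [Real.norm_of_nonneg (by positivity), div_le_div_iff₀ h1 hm]
  have e : (1 + m) * ((1 + m)⁻¹ * XX m μ x) = XX m μ x := by field_simp
  have := mul_le_mul_of_nonneg_left h3 (by positivity : 0 ≤ 1 + m)
  rw [e] at this
  linarith

/-- The symmetrised regularised symbol. -/
noncomputable def regSum (m μ β ε : ℝ) (x : Omega n) : ℝ :=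
  reg β ε (L m μ (left x)) + reg β ε (L m μ (right x))

theorem measurable_reg_left {β ε : ℝ} :
    Measurable fun x : Omega n => reg β ε (L m μ (left x)) := measurable_reg.comp measurable_L_left

theorem norm_reg_le (hm : 0 < m) (hμ : 0 < μ) {β ε : ℝ} (hε : 0 < ε) {k : ℕ} (p : Config k) :
    ‖reg β ε (L m μ p)‖ ≤ ε⁻¹ := by
  rw [Real.norm_of_nonneg (reg_nonneg hε.le (L_pos hm hμ p).le)]
  exact reg_le_inv hε (L_pos hm hμ p).le

theorem integrable_cross_GG (hm : 0 < m) (hμ : 0 < μ) {u : Config (n + 1) → ℂ}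
    (hu : Measurable u) (hu' : LpowNormSq m μ (1 / 2) u < ⊤) :
    Integrable fun x : Omega n => cross u x * GG m μ x := by
  have h := (integrable_off hm hμ (α := 1 / 2) (by norm_num) (by norm_num) hu hu hu'
    (by norm_num at hu' ⊢; exact hu')).re
  refine h.congr (Filter.Eventually.of_forall fun x => ?_)
  exact Complex.re_mul_ofReal _ _

theorem integrable_reg_left_cross_GG (hm : 0 < m) (hμ : 0 < μ) {β ε : ℝ} (hε : 0 < ε)
    {u : Config (n + 1) → ℂ} (hu : Measurable u) (hu' : LpowNormSq m μ (1 / 2) u < ⊤) :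
    Integrable fun x : Omega n => reg β ε (L m μ (left x)) * (cross u x * GG m μ x) :=
  (integrable_cross_GG hm hμ hu hu').bdd_mul measurable_reg_left.aestronglyMeasurable
    (Filter.Eventually.of_forall fun _ => norm_reg_le hm hμ hε _)

theorem integral_regSum_cross_GG (hm : 0 < m) (hμ : 0 < μ) {β ε : ℝ} (hε : 0 < ε)
    {u : Config (n + 1) → ℂ} (hu : Measurable u) (hu' : LpowNormSq m μ (1 / 2) u < ⊤) :
    Integrable (fun x : Omega n => regSum m μ β ε x * (cross u x * GG m μ x)) ∧
    ∫ x : Omega n, regSum m μ β ε x * (cross u x * GG m μ x)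
      = 2 * ∫ x : Omega n, reg β ε (L m μ (left x)) * (cross u x * GG m μ x) := by
  set f : Omega n → ℝ := fun x => reg β ε (L m μ (left x)) * (cross u x * GG m μ x) with hf
  have hi : Integrable f := integrable_reg_left_cross_GG hm hμ hε hu hu'
  have hi' : Integrable (fun x => f (swap x)) :=
    (measurePreserving_swap.integrable_comp_emb measurableEmbedding_swap).2 hi
  have e : ∀ x : Omega n, regSum m μ β ε x * (cross u x * GG m μ x) = f x + f (swap x) := by
    intro x
    simp only [hf]
    rw [cross_swap, GG_swap hm hμ, regSum, add_mul]
    rfl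
  simp only [e]
  refine ⟨hi.add hi', ?_⟩
  rw [integral_add hi hi', measurePreserving_swap.integral_comp measurableEmbedding_swap, two_mul]

theorem integrable_regSum_even (hm : 0 < m) (hμ : 0 < μ) {β ε : ℝ} (hε : 0 < ε)
    {u : Config (n + 1) → ℂ} (hu : Measurable u) (hu' : LpowNormSq m μ (1 / 2) u < ⊤) :
    Integrable fun x : Omega n => cross u x * (regSum m μ β ε x
        * (XX m μ x / (XX m μ x ^ 2 - BB m x ^ 2))) := by
  have a4 := measurable_XX (n := n) (m := m) (μ := μ)
  have a5 := measurable_BB (n := n) (m := m)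
  have hr : Measurable fun x : Omega n => XX m μ x / (XX m μ x - BB m x) := a4.div (a4.sub a5)
  have h := (integral_regSum_cross_GG hm hμ (β := β) hε hu hu').1.bdd_mul hr.aestronglyMeasurable
    (Filter.Eventually.of_forall fun x => ratio_le hm hμ x)
  refine h.congr (Filter.Eventually.of_forall fun x => ?_)
  simp only [XX_div_eq hm hμ x]
  ring

/-- The density whose square integrates to `regEnergy`. -/
noncomputable def regDensity {k : ℕ} (m μ β ε : ℝ) (u : Config k → ℂ) (p : Config k) : ℝ≥0∞ :=
  ENNReal.ofReal (Real.sqrt (reg β ε (L m μ p) * L m μ p)) * ‖u p‖ₑ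

theorem measurable_regDensity {k : ℕ} {β ε : ℝ} {u : Config k → ℂ} (hu : Measurable u) :
    Measurable (regDensity m μ β ε u) := by
  have h1 := measurable_L (m := m) (μ := μ) (k := k)
  have h2 := (measurable_reg (β := β) (ε := ε)).comp h1
  exact ((h2.mul h1).sqrt.ennreal_ofReal).mul hu.enorm

theorem lintegral_regDensity_sq (hm : 0 < m) (hμ : 0 < μ) {k : ℕ} {β ε : ℝ} (hε : 0 ≤ ε)
    (u : Config k → ℂ) : ∫⁻ p, regDensity m μ β ε u p ^ 2 = regEnergy m μ β ε u := by
  refine lintegral_congr fun p => ?_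
  have hp := L_pos hm hμ p
  have hr := reg_nonneg (β := β) hε hp.le
  rw [regDensity, mul_pow, ← ENNReal.ofReal_pow (by positivity), Real.sq_sqrt (by positivity)]

theorem regDensity_permute {k : ℕ} {β ε : ℝ} {u : Config k → ℂ} (hu : Antisymm u)
    (σ : Equiv.Perm (Fin k)) :
    (fun p => regDensity m μ β ε u (permute σ p)) =ᵐ[volume] regDensity m μ β ε u := by
  filter_upwards [hu σ] with p hp
  simp only [regDensity]
  rw [L_permute, hp, enorm_mul]
  have : ‖((Equiv.Perm.sign σ : ℤ) : ℂ)‖ₑ = 1 := by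
    rcases Int.units_eq_one_or (Equiv.Perm.sign σ) with h | h <;> simp [h]
  rw [this, one_mul]

/-- By `reg_add_le` the symmetrised symbol splits into the densities `√(f(L) L) |u|` at the two
points times `wt`, to which the Schur bound `lintegral_oddKernel_le` applies. -/
theorem abs_integral_odd_le (hm : 0 < m) (hμ : 0 < μ) {β ε : ℝ} (h0 : 0 ≤ β) (h2 : β ≤ 2)
    (hε : 0 < ε) {u : Config (n + 1) → ℂ} (hu : Measurable u) (ha : Antisymm u)
    (hu' : LpowNormSq m μ (1 / 2) u < ⊤) :
    ((n : ℝ) + 1) * |∫ x : Omega n, cross u x * (regSum m μ β ε x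
        * (BB m x / (XX m μ x ^ 2 - BB m x ^ 2)))|
      ≤ (Lambda β m * regEnergy m μ β ε u).toReal := by
  have hE := regEnergy_lt_top hm hμ (β := β) hε hu'
  have hΛ := lambda_ne_top hm h0 h2
  have key := lintegral_oddKernel_le hm hμ β (measurable_regDensity (m := m) (μ := μ) (β := β)
    (ε := ε) hu) (regDensity_permute ha)
  rw [lintegral_regDensity_sq hm hμ hε.le] at key
  have hb : ‖∫ x : Omega n, cross u x * (regSum m μ β ε x
        * (BB m x / (XX m μ x ^ 2 - BB m x ^ 2)))‖ₑ
      ≤ ∫⁻ x : Omega n, regDensity m μ β ε u (left x) * regDensity m μ β ε u (right x)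
        * ENNReal.ofReal (oddKernel m μ β x) := by
    refine (enorm_integral_le_lintegral_enorm _).trans (lintegral_mono fun x => ?_)
    have p1 := L_pos hm hμ (left x)
    have p2 := L_pos hm hμ (right x)
    have hr := reg_add_le (β := β) hε.le p1 p2
    have hD := den_pos hm hμ x
    have hc := abs_cross_le u x
    have r1 := reg_nonneg (β := β) hε.le p1.le
    have r2 := reg_nonneg (β := β) hε.le p2.le
    have hw := wt_nonneg (β := β) p1.le p2.le
    simp only [regDensity, oddKernel]
    rw [← ofReal_norm (u (left x)), ← ofReal_norm (u (right x)),
      ← ofReal_norm, ← ENNReal.ofReal_mul (by positivity),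
      ← ENNReal.ofReal_mul (by positivity), ← ENNReal.ofReal_mul (by positivity),
      ← ENNReal.ofReal_mul (by positivity)]
    refine ENNReal.ofReal_le_ofReal ?_
    rw [Real.norm_eq_abs, abs_mul, abs_mul, abs_div, abs_of_pos hD, regSum,
      abs_of_nonneg (add_nonneg r1 r2)]
    calc _ ≤ (‖u (left x)‖ * ‖u (right x)‖) *
          ((Real.sqrt (reg β ε (L m μ (left x)) * L m μ (left x))
            * Real.sqrt (reg β ε (L m μ (right x)) * L m μ (right x))
            * wt β (L m μ (left x)) (L m μ (right x)))
          * (|BB m x| / (XX m μ x ^ 2 - BB m x ^ 2))) := by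
          gcongr
      _ = _ := by ring
  have h3 : ((n : ℝ≥0∞) + 1) * ‖∫ x : Omega n, cross u x * (regSum m μ β ε x
        * (BB m x / (XX m μ x ^ 2 - BB m x ^ 2)))‖ₑ ≤ Lambda β m * regEnergy m μ β ε u :=
    (mul_le_mul_right hb _).trans key
  have h4 := ENNReal.toReal_mono (by finiteness) h3
  rw [ENNReal.toReal_mul, toReal_enorm, Real.norm_eq_abs] at h4
  refine le_trans (le_of_eq ?_) h4
  congr 1

/-- The symmetrised integrand is even part minus odd part: the first integral is nonnegative, the
second is controlled by `Λ_β`. The factor `1/2` comes from the symmetrisation. -/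
theorem re_offForm_reg_ge (hm : 0 < m) (hμ : 0 < μ) {β ε : ℝ} (h0 : 0 ≤ β) (h2 : β ≤ 2)
    (hε : 0 < ε) {u : Config (n + 1) → ℂ} (hu : Measurable u) (ha : Antisymm u)
    (hu' : LpowNormSq m μ (1 / 2) u < ⊤) :
    -((Lambda β m * regEnergy m μ β ε u).toReal / 2)
      ≤ (offForm m μ (fun p => (reg β ε (L m μ p) : ℂ) * u p) u).re := by
  have hodd := abs_integral_odd_le hm hμ h0 h2 hε hu ha hu'
  obtain ⟨hsi, hs⟩ := integral_regSum_cross_GG hm hμ (β := β) hε hu hu'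
  have hei := integrable_regSum_even hm hμ (β := β) hε hu hu'
  have he := integral_even_nonneg hm hμ h0 h2 hε.le hu hei
  have hsplit : ∫ x : Omega n, cross u x * (regSum m μ β ε x
        * (BB m x / (XX m μ x ^ 2 - BB m x ^ 2)))
      = (∫ x : Omega n, cross u x * (regSum m μ β ε x
        * (XX m μ x / (XX m μ x ^ 2 - BB m x ^ 2))))
        - ∫ x : Omega n, regSum m μ β ε x * (cross u x * GG m μ x) := by
    rw [← integral_sub hei hsi]
    refine integral_congr_ae (Filter.Eventually.of_forall fun x => ?_)
    simp only [BB_div_eq hm hμ x]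
    ring
  have hre : (offForm m μ (fun p => (reg β ε (L m μ p) : ℂ) * u p) u).re
      = ((n : ℝ) + 1) * ∫ x : Omega n, reg β ε (L m μ (left x)) * (cross u x * GG m μ x) := by
    have hi := integrable_off hm hμ (α := 1 / 2) (by norm_num) (by norm_num) hu hu hu'
      (by norm_num at hu' ⊢; exact hu')
    have hi2 : Integrable fun x : Omega n => conj ((reg β ε (L m μ (left x)) : ℂ) * u (left x))
        * u (right x) * (GG m μ x : ℂ) := by
      have hr : Measurable fun x : Omega n => (reg β ε (L m μ (left x)) : ℂ) :=
        Complex.measurable_ofReal.comp measurable_reg_left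
      refine (hi.bdd_mul (c := ε⁻¹) hr.aestronglyMeasurable
        (Filter.Eventually.of_forall fun x => ?_)).congr (Filter.Eventually.of_forall fun x => ?_)
      · rw [Complex.norm_real]
        exact norm_reg_le hm hμ hε _
      · simp only [map_mul, Complex.conj_ofReal]
        ring
    have e := Complex.reCLM.integral_comp_comm hi2
    simp only [Complex.reCLM_apply] at e
    unfold offForm
    rw [show ((n : ℂ) + 1) = (((n : ℝ) + 1 : ℝ) : ℂ) by push_cast; rfl, Complex.re_ofReal_mul, ← e]
    congr 1
    refine integral_congr_ae (Filter.Eventually.of_forall fun x => ?_)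
    simp only [map_mul, Complex.conj_ofReal]
    rw [Complex.re_mul_ofReal, mul_assoc, Complex.re_ofReal_mul, mul_assoc]
    rfl
  change 0 ≤ ∫ x : Omega n, cross u x * (regSum m μ β ε x
        * (XX m μ x / (XX m μ x ^ 2 - BB m x ^ 2))) at he
  rw [hre]
  have hn : (0 : ℝ) ≤ (n : ℝ) + 1 := by positivity
  have h5 := mul_le_mul_of_nonneg_left (le_abs_self (∫ x : Omega n, cross u x * (regSum m μ β ε x
        * (BB m x / (XX m μ x ^ 2 - BB m x ^ 2))))) hn
  have h6 := mul_nonneg hn he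
  rw [hsplit, hs] at h5
  rw [hsplit, hs] at hodd
  nlinarith

end

/-! ### The lower bound on `Γ`. -/

section

variable {n k : ℕ} {m μ : ℝ}

theorem le_L (hm : 0 < m) (μ : ℝ) (p : Config k) :
    2 * Real.pi ^ 2 * Real.sqrt μ ≤ L m μ p := by
  rw [L_eq_sqrt hm]
  gcongr
  have : 0 ≤ m / (m + 1) * ‖p‖ ^ 2 + m / (m + 1) ^ 2 * ‖∑ i, p i‖ ^ 2 := by positivity
  linarith

theorem lpowNormSq_congr {r : ℝ} {u v : Config k → ℂ} (h : u =ᵐ[volume] v) :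
    LpowNormSq m μ r u = LpowNormSq m μ r v :=
  lintegral_congr_ae (h.mono fun p hp => by simp only [hp])

theorem lpowNormSq_zero (u : Config k → ℂ) : LpowNormSq m μ 0 u = ∫⁻ p, ‖u p‖ₑ ^ 2 := by
  simp [LpowNormSq]

theorem lpowNormSq_lt_top_mono (hm : 0 < m) (hμ : 0 < μ) {r r' : ℝ} (h : r' ≤ r)
    {u : Config k → ℂ} (hu : LpowNormSq m μ r u < ⊤) : LpowNormSq m μ r' u < ⊤ := by
  have hpi := Real.pi_pos
  set c : ℝ := 2 * Real.pi ^ 2 * Real.sqrt μ with hc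
  have hcp : 0 < c := by have := Real.sqrt_pos.2 hμ; positivity
  refine lt_of_le_of_lt ?_
    (ENNReal.mul_lt_top (ENNReal.ofReal_lt_top (r := c ^ (2 * r' - 2 * r))) hu)
  rw [lpowNormSq_eq hm hμ, lpowNormSq_eq hm hμ, ← lintegral_const_mul' _ _ ENNReal.ofReal_ne_top]
  refine lintegral_mono fun p => ?_
  have hp := L_pos hm hμ p
  rw [← mul_assoc, ← ENNReal.ofReal_mul (by positivity)]
  refine mul_le_mul_left (ENNReal.ofReal_le_ofReal ?_) _
  calc L m μ p ^ (2 * r') = L m μ p ^ (2 * r' - 2 * r) * L m μ p ^ (2 * r) := by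
        rw [← Real.rpow_add hp]; congr 1; ring
    _ ≤ _ := by
      refine mul_le_mul_of_nonneg_right ?_ (by positivity)
      exact Real.rpow_le_rpow_of_nonpos hcp (le_L hm μ p) (by linarith)

theorem lpowNormSq_ofReal_mul_le {r c : ℝ} {f : Config k → ℝ}
    (hf : ∀ p, ‖f p‖ ≤ c) (u : Config k → ℂ) :
    LpowNormSq m μ r (fun p => (f p : ℂ) * u p) ≤ ENNReal.ofReal c ^ 2 * LpowNormSq m μ r u := by
  unfold LpowNormSq
  rw [← lintegral_const_mul' _ _ (by finiteness)]
  refine lintegral_mono fun p => ?_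
  rw [← mul_pow]
  refine pow_le_pow_left' ?_ 2
  simp only [enorm_mul]
  rw [mul_left_comm]
  refine mul_le_mul_left ?_ _
  rw [← ofReal_norm, Complex.norm_real]
  exact ENNReal.ofReal_le_ofReal (hf p)

theorem exists_mem_Has (hm : 0 < m) (hμ : 0 < μ) {r : ℝ} (hr : 0 ≤ r) {u : Config k → ℂ}
    (hu : AEStronglyMeasurable u) (ha : Antisymm u) (h : LpowNormSq m μ r u < ⊤) :
    ∃ ζ ∈ Has k r, hat ζ =ᵐ[volume] u := by
  have h0 := lpowNormSq_lt_top_mono hm hμ hr h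
  rw [lpowNormSq_zero, ← memLp_two_iff hu] at h0
  obtain ⟨ζ, hζ⟩ := exists_hat_eq h0
  exact ⟨ζ, (mem_Has_iff hm hμ hr ζ).2 ⟨ha.congr hζ.symm, by rwa [lpowNormSq_congr hζ]⟩, hζ⟩

theorem exists_reg_test (hm : 0 < m) (hμ : 0 < μ) {β ε : ℝ} (hε : 0 < ε) {ξ : L2 k}
    (hξ : ξ ∈ Has k (1 / 2)) :
    ∃ ζ ∈ Has k (1 / 2), hat ζ =ᵐ[volume] fun p => (reg β ε (L m μ p) : ℂ) * hat ξ p := by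
  obtain ⟨ha, hf⟩ := (mem_Has_iff hm hμ (by norm_num) ξ).1 hξ
  refine exists_mem_Has hm hμ (by norm_num) ?_ (ha.mul_left fun σ x => ?_) ?_
  · exact ((Complex.measurable_ofReal.comp (measurable_reg.comp measurable_L)).mul
      (measurable_hat ξ)).aestronglyMeasurable
  · rw [L_permute]
  · refine (lpowNormSq_ofReal_mul_le (fun p => norm_reg_le hm hμ hε p) _).trans_lt ?_
    exact ENNReal.mul_lt_top (by finiteness) hf

theorem Tdiag_reg (hm : 0 < m) (hμ : 0 < μ) {β ε : ℝ} (hε : 0 < ε) {ζ ξ : L2 k}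
    (hζ : hat ζ =ᵐ[volume] fun p => (reg β ε (L m μ p) : ℂ) * hat ξ p) :
    Tdiag m μ ζ ξ = ((regEnergy m μ β ε (hat ξ)).toReal : ℂ) := by
  have hLm := measurable_L (m := m) (μ := μ) (k := k)
  have hr : Measurable fun p : Config k => reg β ε (L m μ p) := measurable_reg.comp hLm
  have hm2 : Measurable fun p : Config k => reg β ε (L m μ p) * L m μ p * ‖hat ξ p‖ ^ 2 :=
    (hr.mul hLm).mul ((measurable_hat ξ).norm.pow_const 2)
  have hnn : ∀ p : Config k, 0 ≤ reg β ε (L m μ p) * L m μ p := fun p =>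
    mul_nonneg (reg_nonneg hε.le (L_pos hm hμ p).le) (L_pos hm hμ p).le
  have e : Tdiag m μ ζ ξ
      = ((∫ p, reg β ε (L m μ p) * L m μ p * ‖hat ξ p‖ ^ 2 : ℝ) : ℂ) := by
    refine Eq.trans ?_ integral_complex_ofReal
    refine integral_congr_ae ?_
    filter_upwards [hζ] with p hp
    rw [hp, map_mul, Complex.conj_ofReal]
    push_cast
    rw [← Complex.conj_mul']
    ring
  rw [e, integral_eq_lintegral_of_nonneg_ae
    (Filter.Eventually.of_forall fun p => mul_nonneg (hnn p) (sq_nonneg _))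
    hm2.aestronglyMeasurable]
  congr 2
  refine lintegral_congr fun p => ?_
  rw [ENNReal.ofReal_mul (hnn p), ENNReal.ofReal_pow (norm_nonneg _), ofReal_norm]

/-- From `f(L) ≤ L ^ β` one gets `f(L) ≤ √(f(L) L) · L^{(β-1)/2}`; the weighted mean inequality then
splits the pairing with a free parameter `c`. -/
theorem enorm_integral_reg_le (hm : 0 < m) (hμ : 0 < μ) {β ε c : ℝ} (hε : 0 < ε) (hc : 0 < c)
    {ζ ξ : L2 k} {g : Config k → ℂ}
    (hζ : hat ζ =ᵐ[volume] fun p => (reg β ε (L m μ p) : ℂ) * hat ξ p) :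
    2 * ‖∫ p, conj (hat ζ p) * g p‖ₑ ≤ ENNReal.ofReal c * regEnergy m μ β ε (hat ξ)
      + ENNReal.ofReal c⁻¹ * LpowNormSq m μ ((β - 1) / 2) g := by
  have hd := measurable_regDensity (m := m) (μ := μ) (β := β) (ε := ε) (measurable_hat ξ)
  have hd2 : Measurable fun p => ENNReal.ofReal c * regDensity m μ β ε (hat ξ) p ^ 2 :=
    (hd.pow_const 2).const_mul _
  rw [← lintegral_regDensity_sq hm hμ hε.le, LpowNormSq, ← lintegral_const_mul' _ _ (by finiteness),
    ← lintegral_const_mul' _ _ (by finiteness), ← lintegral_add_left hd2]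
  refine (mul_le_mul_right (enorm_integral_le_lintegral_enorm _) 2).trans ?_
  rw [← lintegral_const_mul' _ _ (by finiteness)]
  refine lintegral_mono_ae ?_
  filter_upwards [hζ] with p hp
  refine le_trans (mul_le_mul_right ?_ 2) ((two_mul_le_weighted (regDensity m μ β ε (hat ξ) p)
    ‖((L m μ p ^ ((β - 1) / 2) : ℝ) : ℂ) * g p‖ₑ hc).trans_eq (by ring))
  have hLp := L_pos hm hμ p
  have hr := reg_nonneg (β := β) hε.le hLp.le
  rw [hp, enorm_mul, RCLike.enorm_conj, enorm_mul, enorm_mul, enorm_ofReal_of_nonneg hr,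
    enorm_ofReal_of_nonneg (by positivity), regDensity]
  calc _ = ENNReal.ofReal (reg β ε (L m μ p)) * (‖hat ξ p‖ₑ * ‖g p‖ₑ) := by ring
    _ ≤ ENNReal.ofReal (Real.sqrt (reg β ε (L m μ p) * L m μ p) * L m μ p ^ ((β - 1) / 2))
        * (‖hat ξ p‖ₑ * ‖g p‖ₑ) := by
      refine mul_le_mul_left (ENNReal.ofReal_le_ofReal ?_) _
      refine (pow_le_pow_iff_left₀ hr (by positivity) two_ne_zero).1 ?_
      rw [mul_pow, Real.sq_sqrt (by positivity), ← Real.rpow_natCast, ← Real.rpow_natCast,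
        ← Real.rpow_mul hLp.le]
      have e : L m μ p * L m μ p ^ ((β - 1) / 2 * (2 : ℕ)) = L m μ p ^ β := by
        rw [mul_comm, ← Real.rpow_add_one hLp.ne']
        congr 1; push_cast; ring
      rw [mul_assoc, e, Real.rpow_natCast, sq]
      exact mul_le_mul_of_nonneg_left (reg_le_rpow hε.le hLp.le) hr
    _ = _ := by rw [ENNReal.ofReal_mul (by positivity)]; ring

theorem regEnergy_le (hm : 0 < m) (hμ : 0 < μ) {β ε : ℝ} (h0 : 0 ≤ β) (h2 : β ≤ 2) (hε : 0 < ε)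
    {ξ : L2 (n + 1)} {g : Config (n + 1) → ℂ} (hg : IsGammaHat m μ ξ g)
    (hΛ : (Lambda β m).toReal < 1) :
    ENNReal.ofReal (1 - (Lambda β m).toReal) * regEnergy m μ β ε (hat ξ)
      ≤ LpowNormSq m μ ((β - 1) / 2) g := by
  rcases eq_or_ne (LpowNormSq m μ ((β - 1) / 2) g) ⊤ with htop | hB
  · rw [htop]; exact le_top
  obtain ⟨ha, hf⟩ := (mem_Has_iff hm hμ (by norm_num) ξ).1 hg.mem_form_domain
  obtain ⟨ζ, hζ, hζe⟩ := exists_reg_test hm hμ (β := β) hε hg.mem_form_domain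
  have hF := (regEnergy_lt_top hm hμ (β := β) hε hf).ne
  have h1 := hg.form_eq ζ hζ
  have hoff := re_offForm_reg_ge hm hμ h0 h2 hε (measurable_hat ξ) ha hf
  rw [Tdiag_reg hm hμ hε hζe, Toff_eq, offForm_congr hζe (ae_eq_refl _)] at h1
  set F := regEnergy m μ β ε (hat ξ) with hFdef
  set B := LpowNormSq m μ ((β - 1) / 2) g with hBdef
  set Λ := (Lambda β m).toReal with hΛdef
  have hΛ0 : 0 ≤ Λ := ENNReal.toReal_nonneg
  -- This is the coercivity constant of the form. Used also as the weight, it turns `2cF ≤ cF + B/c`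
  -- into `c²F ≤ B`, and `c² = 1 - Λ + Λ²/4 ≥ 1 - Λ`.
  set c : ℝ := 1 - Λ / 2 with hc
  have hcp : 0 < c := by linarith
  have h3 := enorm_integral_reg_le hm hμ hε hcp hζe (g := g)
  have h4 := ENNReal.toReal_mono (by finiteness) h3
  rw [ENNReal.toReal_mul, toReal_enorm, ENNReal.toReal_add (by finiteness) (by finiteness),
    ENNReal.toReal_mul, ENNReal.toReal_mul, ENNReal.toReal_ofReal hcp.le,
    ENNReal.toReal_ofReal (by positivity), ← hFdef, ← hBdef, h1, ENNReal.toReal_ofNat] at h4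
  rw [ENNReal.toReal_mul, ← hΛdef] at hoff
  have h5 := (Complex.re_le_norm ((F.toReal : ℂ)
    + offForm m μ (fun p => (reg β ε (L m μ p) : ℂ) * hat ξ p) (hat ξ)))
  rw [Complex.add_re, Complex.ofReal_re] at h5
  have h6 : c * F.toReal ≤ c⁻¹ * B.toReal := by
    have : c * F.toReal = F.toReal - Λ * F.toReal / 2 := by rw [hc]; ring
    linarith
  have h7 : c ^ 2 * F.toReal ≤ B.toReal := by
    have := mul_le_mul_of_nonneg_left h6 hcp.le
    rw [mul_inv_cancel_left₀ hcp.ne'] at this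
    linarith [this, (by ring : c ^ 2 * F.toReal = c * (c * F.toReal))]
  rw [← ENNReal.ofReal_toReal hF, ← ENNReal.ofReal_toReal hB,
    ← ENNReal.ofReal_mul (by linarith)]
  refine ENNReal.ofReal_le_ofReal (le_trans ?_ h7)
  refine mul_le_mul_of_nonneg_right ?_ ENNReal.toReal_nonneg
  rw [hc]
  nlinarith [sq_nonneg Λ]

theorem tendsto_reg {β x : ℝ} :
    Filter.Tendsto (fun j : ℕ => reg β (1 / ((j : ℝ) + 1)) x) Filter.atTop (nhds (x ^ β)) := by
  have h := (tendsto_one_div_add_atTop_nhds_zero_nat (𝕜 := ℝ)).mul_const (x ^ β)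
  have h2 := (tendsto_const_nhds (x := x ^ β)).div (h.const_add 1) (by norm_num)
  rw [zero_mul, add_zero, div_one] at h2
  exact h2

/-- Fatou's lemma along `ε = 1/(j+1)`; finiteness of the limit is part of the conclusion when `M` is
finite. -/
theorem lpowNormSq_le_of_regEnergy_le (hm : 0 < m) (hμ : 0 < μ) {β : ℝ} {u : Config k → ℂ}
    (hu : Measurable u) {M : ℝ≥0∞} (h : ∀ ε, 0 < ε → regEnergy m μ β ε u ≤ M) :
    LpowNormSq m μ ((β + 1) / 2) u ≤ M := by
  have hLm := measurable_L (m := m) (μ := μ) (k := k)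
  have hmeas : ∀ j : ℕ, Measurable fun p : Config k => ENNReal.ofReal
      (reg β (1 / ((j : ℝ) + 1)) (L m μ p) * L m μ p) * ‖u p‖ₑ ^ 2 := fun j =>
    ((measurable_reg.comp hLm).mul hLm).ennreal_ofReal.mul (hu.enorm.pow_const 2)
  have hlim : ∀ p, Filter.Tendsto (fun j : ℕ => ENNReal.ofReal
      (reg β (1 / ((j : ℝ) + 1)) (L m μ p) * L m μ p) * ‖u p‖ₑ ^ 2) Filter.atTop
      (nhds (ENNReal.ofReal (L m μ p ^ (2 * ((β + 1) / 2))) * ‖u p‖ₑ ^ 2)) := by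
    intro p
    have hp := L_pos hm hμ p
    refine ENNReal.Tendsto.mul_const ?_ (Or.inr (by finiteness))
    have e : L m μ p ^ (2 * ((β + 1) / 2)) = L m μ p ^ β * L m μ p := by
      rw [← Real.rpow_add_one hp.ne']; congr 1; ring
    rw [e]
    exact ENNReal.tendsto_ofReal (tendsto_reg.mul_const _)
  rw [lpowNormSq_eq hm hμ]
  calc _ = ∫⁻ p, Filter.liminf (fun j : ℕ => ENNReal.ofReal
        (reg β (1 / ((j : ℝ) + 1)) (L m μ p) * L m μ p) * ‖u p‖ₑ ^ 2) Filter.atTop :=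
        lintegral_congr fun p => (hlim p).liminf_eq.symm
    _ ≤ Filter.liminf (fun j : ℕ => regEnergy m μ β (1 / ((j : ℝ) + 1)) u) Filter.atTop :=
        lintegral_liminf_le hmeas
    _ ≤ Filter.liminf (fun _ : ℕ => M) Filter.atTop :=
        Filter.liminf_le_liminf (Filter.Eventually.of_forall fun j => h _ (by positivity))
    _ = M := Filter.liminf_const _

/-- The lower bound on `Γ`; only `ξ ∈ H^{1/2}` is needed. -/
theorem IsGammaHat.lower_bound (hm : 0 < m) (hμ : 0 < μ) {β : ℝ} (h0 : 0 ≤ β) (h2 : β ≤ 2)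
    {ξ : L2 (n + 1)} {g : Config (n + 1) → ℂ} (hg : IsGammaHat m μ ξ g) :
    ENNReal.ofReal (1 - (Lambda β m).toReal) * LpowNormSq m μ ((β + 1) / 2) (hat ξ)
      ≤ LpowNormSq m μ ((β - 1) / 2) g := by
  -- For `Λ ≥ 1` the factor truncates to zero and the bound is empty.
  rcases le_or_gt 1 (Lambda β m).toReal with h | h
  · rw [ENNReal.ofReal_of_nonpos (by linarith), zero_mul]
    exact zero_le
  have hne : ENNReal.ofReal (1 - (Lambda β m).toReal) ≠ 0 := by
    rw [ne_eq, ENNReal.ofReal_eq_zero]; linarith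
  rw [mul_comm, ← ENNReal.le_div_iff_mul_le (Or.inl hne) (Or.inl ENNReal.ofReal_ne_top)]
  refine lpowNormSq_le_of_regEnergy_le hm hμ (measurable_hat ξ) fun ε hε => ?_
  rw [ENNReal.le_div_iff_mul_le (Or.inl hne) (Or.inl ENNReal.ofReal_ne_top), mul_comm]
  exact regEnergy_le hm hμ h0 h2 hε hg h

end

/-! ### Existence and uniqueness of `Γξ`, and the operator domain. -/

section

variable {n k : ℕ} {m μ : ℝ}

/-- `L²_as` as a submodule. -/
noncomputable def antisymmSubmodule (k : ℕ) : Submodule ℂ (L2 k) :=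
  ⨅ σ : Equiv.Perm (Fin k), LinearMap.eqLocus
    (Lp.compMeasurePreservingₗᵢ ℂ (permute σ) (measurePreserving_permute σ)).toLinearMap
    (((Equiv.Perm.sign σ : ℤ) : ℂ) • (LinearMap.id : L2 k →ₗ[ℂ] L2 k))

theorem mem_antisymmSubmodule (ξ : L2 k) : ξ ∈ antisymmSubmodule k ↔ ξ ∈ L2as k := by
  refine Iff.trans ?_ (antisymm_iff_comp ξ).symm
  simp only [antisymmSubmodule, Submodule.mem_iInf, LinearMap.mem_eqLocus]
  rfl

theorem isClosed_antisymmSubmodule (k : ℕ) :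
    IsClosed (antisymmSubmodule k : Set (L2 k)) := by
  rw [antisymmSubmodule, Submodule.coe_iInf]
  refine isClosed_iInter fun σ => ?_
  refine isClosed_eq (LinearIsometry.continuous _) ?_
  exact continuous_const_smul (((Equiv.Perm.sign σ : ℤ) : ℂ))

/-- The full sesquilinear form in momentum space. -/
noncomputable def fullForm (m μ : ℝ) (φ u : Config (n + 1) → ℂ) : ℂ :=
  (∫ p, conj (φ p) * u p * (L m μ p : ℂ)) + offForm m μ φ u

theorem fullForm_congr {φ φ' : Config (n + 1) → ℂ} (h : φ =ᵐ[volume] φ')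
    (u : Config (n + 1) → ℂ) : fullForm m μ φ u = fullForm m μ φ' u := by
  unfold fullForm
  rw [offForm_congr h (ae_eq_refl u)]
  congr 1
  refine integral_congr_ae ?_
  filter_upwards [h] with p hp
  rw [hp]

theorem lintegral_diag_le (hm : 0 < m) (hμ : 0 < μ) (α : ℝ) {φ u : Config k → ℂ}
    (hφ : Measurable φ) :
    ∫⁻ p, ‖conj (φ p) * u p * (L m μ p : ℂ)‖ₑ
      ≤ LpowNormSq m μ α φ + LpowNormSq m μ (1 - α) u := by
  have hLm := measurable_L (m := m) (μ := μ) (k := k)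
  have h1 : Measurable fun p => ‖((L m μ p ^ α : ℝ) : ℂ) * φ p‖ₑ ^ 2 := by fun_prop
  unfold LpowNormSq
  rw [← lintegral_add_left h1]
  refine lintegral_mono fun p => ?_
  have hp := L_pos hm hμ p
  have e : L m μ p = L m μ p ^ α * L m μ p ^ (1 - α) := by
    rw [← Real.rpow_add hp, add_sub_cancel, Real.rpow_one]
  have h := mul_le_weighted ‖((L m μ p ^ α : ℝ) : ℂ) * φ p‖ₑ
    ‖((L m μ p ^ (1 - α) : ℝ) : ℂ) * u p‖ₑ one_pos
  rw [inv_one, ENNReal.ofReal_one, mul_one, mul_one] at h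
  refine le_trans (le_of_eq ?_) h
  conv_lhs => rw [e]
  simp only [enorm_mul, RCLike.enorm_conj, Complex.ofReal_mul]
  ring

theorem integrable_diag (hm : 0 < m) (hμ : 0 < μ) (α : ℝ) {φ u : Config k → ℂ}
    (hφ : Measurable φ) (hu : Measurable u) (hφ' : LpowNormSq m μ α φ < ⊤)
    (hu' : LpowNormSq m μ (1 - α) u < ⊤) :
    Integrable fun p => conj (φ p) * u p * (L m μ p : ℂ) := by
  have hLm := measurable_L (m := m) (μ := μ) (k := k)
  refine ⟨Measurable.aestronglyMeasurable ?_,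
    (lintegral_diag_le hm hμ α hφ).trans_lt (by finiteness)⟩
  exact ((Complex.continuous_conj.measurable.comp hφ).mul hu).mul
    (Complex.measurable_ofReal.comp hLm)

theorem exists_enorm_fullForm_le (hm : 0 < m) (hμ : 0 < μ) (n : ℕ) {α : ℝ} (h0 : 0 ≤ α)
    (h1 : α ≤ 1) :
    ∃ C : ℝ≥0∞, C ≠ ⊤ ∧ ∀ φ u : Config (n + 1) → ℂ, Measurable φ → Measurable u →
      ‖fullForm m μ φ u‖ₑ ≤ C * (LpowNormSq m μ α φ + LpowNormSq m μ (1 - α) u) := by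
  obtain ⟨C, hC, h⟩ := exists_lintegral_off_le hm hμ n h0 h1
  refine ⟨1 + ‖(n : ℂ) + 1‖ₑ * C, by finiteness, fun φ u hφ hu => ?_⟩
  unfold fullForm offForm
  refine (enorm_add_le _ _).trans ?_
  rw [add_mul (1 : ℝ≥0∞), one_mul, enorm_mul, mul_assoc ‖(n : ℂ) + 1‖ₑ]
  refine add_le_add ?_ (mul_le_mul_right ?_ _)
  · exact (enorm_integral_le_lintegral_enorm _).trans (lintegral_diag_le hm hμ α hφ)
  · exact (enorm_integral_le_lintegral_enorm _).trans (h φ u hφ hu)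

theorem fullForm_add (hm : 0 < m) (hμ : 0 < μ) {α : ℝ} (h0 : 0 ≤ α) (h1 : α ≤ 1)
    {φ φ' u : Config (n + 1) → ℂ} (hφ : Measurable φ) (hφ' : Measurable φ') (hu : Measurable u)
    (fφ : LpowNormSq m μ α φ < ⊤) (fφ' : LpowNormSq m μ α φ' < ⊤)
    (fu : LpowNormSq m μ (1 - α) u < ⊤) :
    fullForm m μ (fun p => φ p + φ' p) u = fullForm m μ φ u + fullForm m μ φ' u := by
  unfold fullForm offForm
  simp only [map_add, add_mul]
  rw [integral_add (integrable_diag hm hμ α hφ hu fφ fu) (integrable_diag hm hμ α hφ' hu fφ' fu),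
    integral_add (integrable_off hm hμ h0 h1 hφ hu fφ fu)
      (integrable_off hm hμ h0 h1 hφ' hu fφ' fu)]
  ring

theorem fullForm_const_mul (a : ℂ) (φ u : Config (n + 1) → ℂ) :
    fullForm m μ (fun p => a * φ p) u = conj a * fullForm m μ φ u := by
  unfold fullForm offForm
  simp only [map_mul, mul_assoc, integral_const_mul]
  ring

/-- Multiplication by `L^r` in momentum space. -/
noncomputable def LpowMul (m μ r : ℝ) (w : Config k → ℂ) (p : Config k) : ℂ :=
  ((L m μ p ^ r : ℝ) : ℂ) * w p

theorem measurable_LpowMul {r : ℝ} {w : Config k → ℂ} (hw : Measurable w) :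
    Measurable (LpowMul m μ r w) :=
  (Complex.measurable_ofReal.comp (measurable_L.pow_const r)).mul hw

theorem LpowMul_LpowMul (hm : 0 < m) (hμ : 0 < μ) (r s : ℝ) (w : Config k → ℂ) :
    LpowMul m μ r (LpowMul m μ s w) = LpowMul m μ (r + s) w := by
  funext p
  simp only [LpowMul]
  rw [Real.rpow_add (L_pos hm hμ p), Complex.ofReal_mul, mul_assoc]

theorem LpowMul_zero (w : Config k → ℂ) : LpowMul m μ 0 w = w := by
  funext p
  simp [LpowMul]

theorem lpowNormSq_LpowMul (hm : 0 < m) (hμ : 0 < μ) (r s : ℝ) (w : Config k → ℂ) :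
    LpowNormSq m μ r (LpowMul m μ s w) = LpowNormSq m μ (r + s) w := by
  have h : ∀ (r : ℝ) (w : Config k → ℂ),
      LpowNormSq m μ r w = ∫⁻ p, ‖LpowMul m μ r w p‖ₑ ^ 2 := fun _ _ => rfl
  rw [h, h, LpowMul_LpowMul hm hμ]

theorem antisymm_LpowMul {w : Config k → ℂ} (hw : Antisymm w) (r : ℝ) :
    Antisymm (LpowMul m μ r w) :=
  hw.mul_left fun σ x => by rw [L_permute]

theorem measurable_Lp (w : L2 k) : Measurable (w : Config k → ℂ) :=
  (Lp.stronglyMeasurable w).measurable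

theorem lpowNormSq_LpowMul_neg (hm : 0 < m) (hμ : 0 < μ) (α : ℝ) (w : L2 k) :
    LpowNormSq m μ α (LpowMul m μ (-α) w) = ‖w‖ₑ ^ 2 := by
  rw [lpowNormSq_LpowMul hm hμ, add_neg_cancel, lpowNormSq_zero, enorm_sq_eq_lintegral]

/-- After `L^{-α}` is inserted, the form is a bounded antilinear functional of `w ∈ L²`. The Riesz
theorem is applied on the closed subspace `L²_as`, so the representative is antisymmetric. -/
theorem exists_inner_eq_fullForm (hm : 0 < m) (hμ : 0 < μ) {α : ℝ} (h0 : 0 ≤ α) (h1 : α ≤ 1)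
    {u : Config (n + 1) → ℂ} (hu : Measurable u) (fu : LpowNormSq m μ (1 - α) u < ⊤) :
    ∃ v ∈ L2as (n + 1), ∀ w ∈ L2as (n + 1),
      inner ℂ w v = fullForm m μ (LpowMul m μ (-α) w) u := by
  have hw : ∀ w : L2 (n + 1), Measurable (LpowMul m μ (-α) w) := fun w =>
    measurable_LpowMul (measurable_Lp w)
  have fw : ∀ w : L2 (n + 1), LpowNormSq m μ α (LpowMul m μ (-α) w) < ⊤ := fun w => by
    rw [lpowNormSq_LpowMul_neg hm hμ]; finiteness
  let ℓ : L2 (n + 1) →ₗ[ℂ] ℂ :=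
    { toFun := fun w => conj (fullForm m μ (LpowMul m μ (-α) w) u)
      map_add' := fun w w' => by
        rw [← map_add, ← fullForm_add hm hμ h0 h1 (hw w) (hw w') hu (fw w) (fw w') fu]
        congr 1
        refine fullForm_congr ?_ u
        filter_upwards [Lp.coeFn_add w w'] with p hp
        simp only [LpowMul, hp, Pi.add_apply, mul_add]
      map_smul' := fun a w => by
        have : fullForm m μ (LpowMul m μ (-α) (a • w : L2 (n + 1))) u
            = conj a * fullForm m μ (LpowMul m μ (-α) w) u := by
          rw [← fullForm_const_mul]
          refine fullForm_congr ?_ u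
          filter_upwards [Lp.coeFn_smul a w] with p hp
          simp only [LpowMul, hp, Pi.smul_apply, smul_eq_mul]
          ring
        rw [this, map_mul, Complex.conj_conj]
        rfl }
  obtain ⟨C, hC, hbd⟩ := exists_enorm_fullForm_le hm hμ n h0 h1
  set M : ℝ≥0∞ := C * (1 + LpowNormSq m μ (1 - α) u) with hM
  have hMt : M ≠ ⊤ := by finiteness
  have hball : ∀ z ∈ Metric.closedBall (0 : L2 (n + 1)) 1, ‖ℓ z‖ ≤ M.toReal := by
    intro z hz
    have hz1 : ‖z‖ₑ ≤ 1 := by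
      rw [← ofReal_norm, ← ENNReal.ofReal_one]
      exact ENNReal.ofReal_le_ofReal (by simpa using hz)
    have h2 := hbd _ _ (hw z) hu
    rw [lpowNormSq_LpowMul_neg hm hμ] at h2
    have h3 : ‖fullForm m μ (LpowMul m μ (-α) z) u‖ₑ ≤ M :=
      h2.trans (mul_le_mul_right (add_le_add_left (pow_le_one' hz1 2) _) _)
    have h4 := ENNReal.toReal_mono hMt h3
    rw [toReal_enorm] at h4
    change ‖conj (fullForm m μ (LpowMul m μ (-α) z) u)‖ ≤ _
    rwa [RCLike.norm_conj]
  have hcont := LinearMap.bound_of_ball_bound' one_pos M.toReal ℓ hball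
  let ℓc : L2 (n + 1) →L[ℂ] ℂ := ℓ.mkContinuous (M.toReal / 1) hcont
  have : CompleteSpace (antisymmSubmodule (n + 1)) :=
    (isClosed_antisymmSubmodule (n + 1)).completeSpace_coe
  let v := (InnerProductSpace.toDual ℂ (antisymmSubmodule (n + 1))).symm
    (ℓc.comp (antisymmSubmodule (n + 1)).subtypeL)
  refine ⟨v, (mem_antisymmSubmodule _).1 v.2, fun w hwa => ?_⟩
  have hv := InnerProductSpace.toDual_symm_apply (𝕜 := ℂ)
    (x := (⟨w, (mem_antisymmSubmodule w).2 hwa⟩ : antisymmSubmodule (n + 1)))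
    (y := ℓc.comp (antisymmSubmodule (n + 1)).subtypeL)
  have hv2 : inner ℂ (v : L2 (n + 1)) w = conj (fullForm m μ (LpowMul m μ (-α) w) u) := hv
  rw [← inner_conj_symm, hv2, Complex.conj_conj]

theorem exists_integral_eq_fullForm (hm : 0 < m) (hμ : 0 < μ) {α : ℝ} (h0 : 0 ≤ α) (h1 : α ≤ 1)
    {u : Config (n + 1) → ℂ} (hu : Measurable u) (fu : LpowNormSq m μ (1 - α) u < ⊤) :
    ∃ g : Config (n + 1) → ℂ, Measurable g ∧ Antisymm g ∧ LpowNormSq m μ (-α) g < ⊤ ∧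
      ∀ φ : Config (n + 1) → ℂ, Measurable φ → Antisymm φ → LpowNormSq m μ α φ < ⊤ →
        ∫ p, conj (φ p) * g p = fullForm m μ φ u := by
  obtain ⟨v, hva, hv⟩ := exists_inner_eq_fullForm hm hμ h0 h1 hu fu
  refine ⟨LpowMul m μ α v, measurable_LpowMul (measurable_Lp v), antisymm_LpowMul hva α, ?_,
    fun φ hφ haφ fφ => ?_⟩
  · have := lpowNormSq_LpowMul_neg hm hμ (-α) v
    rw [neg_neg] at this
    rw [this]
    finiteness
  have hmem : MemLp (LpowMul m μ α φ) 2 :=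
    (memLp_two_iff (measurable_LpowMul hφ).aestronglyMeasurable).2 fφ
  have hcoe := hmem.coeFn_toLp
  have haw : hmem.toLp ∈ L2as (n + 1) := (antisymm_LpowMul haφ α).congr hcoe.symm
  have e := hv _ haw
  have e2 : fullForm m μ (LpowMul m μ (-α) (hmem.toLp : L2 (n + 1))) u = fullForm m μ φ u := by
    refine fullForm_congr ?_ u
    have : φ = LpowMul m μ (-α) (LpowMul m μ α φ) := by
      rw [LpowMul_LpowMul hm hμ, neg_add_cancel, LpowMul_zero]
    conv_rhs => rw [this]
    filter_upwards [hcoe] with p hp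
    simp only [LpowMul] at hp ⊢
    rw [hp]
  rw [← e2, ← e, inner_eq_integral]
  refine integral_congr_ae ?_
  filter_upwards [hcoe] with p hp
  rw [hp]
  simp only [LpowMul, map_mul, Complex.conj_ofReal]
  ring

theorem exists_isGammaHat (hm : 0 < m) (hμ : 0 < μ) {ξ : L2 (n + 1)}
    (hξ : ξ ∈ Has (n + 1) (1 / 2)) : ∃ g : Config (n + 1) → ℂ, IsGammaHat m μ ξ g := by
  have hf := ((mem_Has_iff hm hμ (by norm_num) ξ).1 hξ).2
  obtain ⟨g, hg, ha, fg, h⟩ := exists_integral_eq_fullForm hm hμ (α := 1 / 2) (by norm_num)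
    (by norm_num) (measurable_hat ξ) (by norm_num at hf ⊢; exact hf)
  refine ⟨g, hξ, hg.aestronglyMeasurable, ha, by rwa [neg_div], fun ζ hζ => ?_⟩
  obtain ⟨hζa, hζf⟩ := (mem_Has_iff hm hμ (by norm_num) ζ).1 hζ
  exact h _ (measurable_hat ζ) hζa hζf

theorem exists_isGamma (hm : 0 < m) (hμ : 0 < μ) {ξ : L2 (n + 1)}
    (hξ : ξ ∈ Has (n + 1) 1) : ∃ η : L2 (n + 1), IsGamma m μ ξ η := by
  have hf := ((mem_Has_iff hm hμ zero_le_one ξ).1 hξ).2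
  -- With `α = 0` all regularity is put on `ξ ∈ H¹`, so the representative itself is square
  -- integrable.
  obtain ⟨g, hg, ha, fg, h⟩ := exists_integral_eq_fullForm hm hμ (α := 0) le_rfl
    zero_le_one (measurable_hat ξ) (by rwa [sub_zero])
  rw [neg_zero, lpowNormSq_zero, ← memLp_two_iff hg.aestronglyMeasurable] at fg
  obtain ⟨η, hη⟩ := exists_hat_eq fg
  refine ⟨η, Has_mono (by norm_num) hξ, (antisymm_hat_iff η).1 (ha.congr hη.symm), fun ζ hζ => ?_⟩
  obtain ⟨hζa, hζf⟩ := (mem_Has_iff hm hμ (by norm_num) ζ).1 hζ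
  have e := h _ (measurable_hat ζ) hζa (lpowNormSq_lt_top_mono hm hμ (by norm_num) hζf)
  rw [← integral_conj_hat_mul_hat]
  refine Eq.trans (integral_congr_ae ?_) e
  filter_upwards [hη] with p hp
  rw [hp]

/-- The test function with Fourier transform `L^{-1/2} d̂` lies in `H^{1/2}_as` and gives the
integral of a strictly positive weight times `|d̂|²`. -/
theorem eq_zero_of_inner_eq_zero (hm : 0 < m) (hμ : 0 < μ) {d : L2 k} (hd : d ∈ L2as k)
    (h : ∀ ζ ∈ Has k (1 / 2), inner ℂ ζ d = 0) : d = 0 := by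
  have hmeas : Measurable (LpowMul m μ (-(1 / 2)) (hat d)) :=
    measurable_LpowMul (measurable_hat d)
  obtain ⟨ζ, hζ, hζe⟩ := exists_mem_Has hm hμ (r := 1 / 2) (by norm_num)
    hmeas.aestronglyMeasurable (antisymm_LpowMul ((antisymm_hat_iff d).2 hd) _) (by
      rw [lpowNormSq_LpowMul hm hμ, add_neg_cancel, lpowNormSq_zero, lintegral_enorm_hat_sq]
      finiteness)
  have h1 := h ζ hζ
  have hLm := measurable_L (m := m) (μ := μ) (k := k)
  have e : inner ℂ ζ d = ((∫ p, L m μ p ^ (-(1 / 2) : ℝ) * ‖hat d p‖ ^ 2 : ℝ) : ℂ) := by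
    rw [← integral_conj_hat_mul_hat]
    refine Eq.trans ?_ integral_complex_ofReal
    refine integral_congr_ae ?_
    filter_upwards [hζe] with p hp
    rw [hp, LpowMul, map_mul, Complex.conj_ofReal, mul_assoc, Complex.conj_mul']
    push_cast
    rfl
  rw [e, Complex.ofReal_eq_zero] at h1
  have hpos : ∀ p : Config k, 0 < L m μ p ^ (-(1 / 2) : ℝ) := fun p =>
    Real.rpow_pos_of_pos (L_pos hm hμ p) _
  have h_int : Integrable fun p : Config k => L m μ p ^ (-(1 / 2) : ℝ) * ‖hat d p‖ ^ 2 := by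
    have h2 : Integrable fun p => ‖hat d p‖ ^ 2 :=
      (memLp_two_iff_integrable_sq_norm (measurable_hat d).aestronglyMeasurable).1 (memLp_hat d)
    refine h2.bdd_mul (c := (2 * Real.pi ^ 2 * Real.sqrt μ) ^ (-(1 / 2) : ℝ))
      (hLm.pow_const _).aestronglyMeasurable (Filter.Eventually.of_forall fun p => ?_)
    rw [Real.norm_of_nonneg (hpos p).le]
    have := Real.pi_pos
    have := Real.sqrt_pos.2 hμ
    exact Real.rpow_le_rpow_of_nonpos (by positivity) (le_L hm μ p) (by norm_num)
  rw [integral_eq_zero_iff_of_nonneg (fun p => mul_nonneg (hpos p).le (sq_nonneg _)) h_int] at h1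
  refine eq_zero_of_hat ?_
  filter_upwards [h1] with p hp
  have hp' : L m μ p ^ (-(1 / 2) : ℝ) * ‖hat d p‖ ^ 2 = 0 := hp
  have hsq := (mul_eq_zero.1 hp').resolve_left (hpos p).ne'
  exact norm_eq_zero.1 ((pow_eq_zero_iff two_ne_zero).1 hsq)

theorem IsGamma.unique (hm : 0 < m) (hμ : 0 < μ) {ξ η η' : L2 (n + 1)} (h : IsGamma m μ ξ η)
    (h' : IsGamma m μ ξ η') : η = η' := by
  refine sub_eq_zero.1 (eq_zero_of_inner_eq_zero hm hμ ?_ fun ζ hζ => ?_)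
  · exact (mem_antisymmSubmodule _).1 (sub_mem ((mem_antisymmSubmodule _).2 h.2.1)
      ((mem_antisymmSubmodule _).2 h'.2.1))
  · rw [inner_sub_right, h.2.2 ζ hζ, h'.2.2 ζ hζ, sub_self]

theorem IsGamma.isGammaHat (hm : 0 < m) (hμ : 0 < μ) {ξ η : L2 (n + 1)} (h : IsGamma m μ ξ η) :
    IsGammaHat m μ ξ (hat η) where
  mem_form_domain := h.1
  aestronglyMeasurable := (measurable_hat η).aestronglyMeasurable
  antisymm := (antisymm_hat_iff η).2 h.2.1
  finite_norm := by
    refine lpowNormSq_lt_top_mono hm hμ (r := 0) (by norm_num) ?_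
    rw [lpowNormSq_zero, lintegral_enorm_hat_sq]
    finiteness
  form_eq ζ hζ := by rw [integral_conj_hat_mul_hat, h.2.2 ζ hζ]

theorem IsGamma.lower_bound (hm : 0 < m) (hμ : 0 < μ) {ξ η : L2 (n + 1)} (h : IsGamma m μ ξ η) :
    ENNReal.ofReal (1 - (Lambda 1 m).toReal) * LpowNormSq m μ 1 (hat ξ) ≤ ‖η‖ₑ ^ 2 := by
  have h1 := (h.isGammaHat hm hμ).lower_bound hm hμ zero_le_one one_le_two
  rw [show ((1 : ℝ) + 1) / 2 = 1 by norm_num, show ((1 : ℝ) - 1) / 2 = 0 by norm_num,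
    lpowNormSq_zero, lintegral_enorm_hat_sq] at h1
  exact h1

theorem domL_eq_Has (hm : 0 < m) (hμ : 0 < μ) (k : ℕ) : domL k m μ = Has k 1 := by
  ext ξ
  rw [mem_Has_iff hm hμ zero_le_one, antisymm_hat_iff]
  rfl

/-- An element of the operator domain is a priori only in `H^{1/2}`; the lower bound, valid there,
forces `Lξ` into `L²` once its constant is positive. -/
theorem domGamma_eq_Has (hm : 0 < m) (hμ : 0 < μ) (n : ℕ) (hΛ : Lambda 1 m < 1) :
    domGamma n m μ = Has (n + 1) 1 := by
  refine Set.Subset.antisymm ?_ fun ξ hξ => exists_isGamma hm hμ hξ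
  rintro ξ ⟨η, hη⟩
  rw [mem_Has_iff hm hμ zero_le_one]
  refine ⟨((mem_Has_iff hm hμ (by norm_num) ξ).1 hη.1).1, ?_⟩
  have h := (hη.lower_bound hm hμ).trans_lt (by finiteness)
  refine ENNReal.lt_top_of_mul_ne_top_right h.ne ?_
  have hΛ' := (ENNReal.toReal_lt_toReal hΛ.ne_top ENNReal.one_ne_top).2 hΛ
  rw [ENNReal.toReal_one] at hΛ'
  rw [ne_eq, ENNReal.ofReal_eq_zero]
  linarith

end

end PointInteraction

/-- The number of fermions is `N = n + 2 ≥ 2`, and `ξ` is a function on `ℝ^{3(N-1)}`. -/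
theorem theorem2 (n : ℕ) (m μ : ℝ) (hm : 0 < m) (hμ : 0 < μ) :
    (∀ ξ ∈ Has (n + 1) 1,
      (∃! η : L2 (n + 1), IsGamma m μ ξ η) ∧
      ∀ η : L2 (n + 1), IsGamma m μ ξ η →
        ENNReal.ofReal (1 - (Lambda 1 m).toReal) * LpowNormSq m μ 1 (hat ξ) ≤ ‖η‖ₑ ^ 2) ∧
    (Lambda 1 m < 1 →
      domGamma n m μ = domL (n + 1) m μ ∧ domL (n + 1) m μ = Has (n + 1) 1) ∧
    (∀ β : ℝ, 0 ≤ β → β ≤ 2 →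
      Lambda β m ≠ ⊤ ∧
      ∀ ξ ∈ Has (n + 1) ((β + 1) / 2),
        (∃ g : Config (n + 1) → ℂ, IsGammaHat m μ ξ g) ∧
        ∀ g : Config (n + 1) → ℂ, IsGammaHat m μ ξ g →
          ENNReal.ofReal (1 - (Lambda β m).toReal) * LpowNormSq m μ ((β + 1) / 2) (hat ξ)
            ≤ LpowNormSq m μ ((β - 1) / 2) g) := by
  refine ⟨fun ξ hξ => ⟨?_, fun η hη => hη.lower_bound hm hμ⟩, fun hΛ => ?_, fun β h0 h2 =>
    ⟨lambda_ne_top hm h0 h2, fun ξ hξ => ⟨?_, fun g hg => hg.lower_bound hm hμ h0 h2⟩⟩⟩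
  · obtain ⟨η, hη⟩ := exists_isGamma hm hμ hξ
    exact ⟨η, hη, fun η' hη' => hη'.unique hm hμ hη⟩
  · rw [domL_eq_Has hm hμ, domGamma_eq_Has hm hμ n hΛ]
    exact ⟨rfl, rfl⟩
  · exact exists_isGammaHat hm hμ (Has_mono (by linarith) hξ)
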